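/- **Conventions.** Throughout, $1/\infty=0$, $c/0=\infty$ for $c\in(0,\infty]$, and $0\cdot\infty=0$. Norms $\|\cdot\|_{r,I}$ are Lebesgue norms $L_r(I)$ with respect to Lebesgue measure (essential supremum if $r=\infty$), $r'$ is the conjugate index of $r$, and, for $s<r$, $\frac1\varrho=\frac1s-\frac1r$. A measurable function $a:(0,\infty)\to[0,\infty]$, not identically $0$ and not identically $\infty$, is *slowly varying* if for each $\varepsilon>0$ the function $t^{\varepsilon}a(t)$ is equivalent on $(0,\infty)$ (up to positive multiplicative constants) to a non-decreasing function and $t^{-\varepsilon}a(t)$ to a non-increasing one. Let $(\Omega_1,\mu_1)$, $(\Omega_2,\mu_2)$ be $\sigma$-finite measure spaces with $\mu_1(\Omega_1)=\mu_2(\Omega_2)=\infty$, and let $f^*(t)=\inf\{h>0:\mu(\{|f|>h\})\le t\}$, $t>0$, be the decreasing rearrangement of a scalar (real or complex) measurable function $f$. A function $g$ on $\Omega_1$ is *equimeasurable* with $f:(0,\infty)\to[0,\infty)$ if $\mu_1(\{|g|>h\})=|\{t>0: f(t)>h\}|$ for all $h\ge0$. For $1\le p,r\le\infty$ and $a$ slowly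 varying, the Lorentz–Karamata space $L_{p,r;a}$ consists of the measurable $f$ with $\|f\|_{p,r;a}=\|t^{\frac1p-\frac1r}a(t)f^*(t)\|_{r,(0,\infty)}<\infty$. Let $1\le p_1<\infty$ and $1\le q_1,q_2,r,s\le\infty$ with $q_1\ne q_2$, put $m=(\frac1{q_1}-\frac1{q_2})\,p_1$, and for non-negative measurable $g$ on $(0,\infty)$ put $$S_\sigma g(x)=x^{-\frac1{q_1}}\int_0^{x^m}t^{\frac1{p_1}-1}g(t)\,dt+x^{-\frac1{q_2}}\int_{x^m}^\infty t^{-1}g(t)\,dt,\qquad x>0.$$ Let $T$ be a quasilinear operator mapping a linear subspace $\mathcal D$ of the $\mu_1$-measurable scalar functions on $\Omega_1$ into the $\mu_2$-measurable scalar functions on $\Omega_2$; that is, there is $k\ge1$ such that $|T(f+g)|\le k(|Tf|+|Tg|)$ and $|T(\alpha f)|=|\alpha||Tf|$ hold $\mu_2$-a.e. for all $f,g\in\mathcal D$ and all scalars $\alpha$. Assume: * ($T$ is of joint weak type $(p_1,q_1;\infty,q_2)$) there is $C<\infty$ such that every measurable $f$ on $\Omega_1$ with $S_\sigma f^*(1)<\infty$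 belongs to $\mathcal D$ and satisfies $(Tf)^*(x)\le C\,S_\sigma f^*(x)$ for all $x>0$; * ($T\in \mathrm{LB}_2(\infty,q_2;m)$) there is $c>0$ such that for every non-increasing $f:(0,\infty)\to[0,\infty)$ there is a measurable $g$ on $\Omega_1$, equimeasurable with $f$, such that, provided $g\in\mathcal D$ (so that $Tg$ is defined), $(Tg)^*(x)\ge c\,x^{-\frac1{q_2}}\int_{x^m}^\infty t^{-1}f(t)\,dt$ for all $x>0$. Let $a,b$ be slowly varying on $(0,\infty)$, where $a$ is assumed non-decreasing if $r=\infty$, and let $b_*(t)=b(t^{1/m})$. **Theorem.** $T$ is bounded from $L_{\infty,r;a}$ to $L_{q_2,s;b}$ (that is, $L_{\infty,r;a}\subseteq\mathcal D$ and $\|Tf\|_{q_2,s;b}\le C'\|f\|_{\infty,r;a}$ for all $f\in L_{\infty,r;a}$, with some $C'<\infty$ independent of $f$) if and only if $$\|t^{-\frac1r}a(t)\|_{r,(0,\infty)}=\infty\qquad\text{and}\qquad R_\infty(r,s,a,b_*;0,\infty)<\infty .$$ Here $R_\infty(r,s,a,b;0,\infty)$ equals $R_1+R_2$ if $1<r,s<\infty$;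 $R_1$ if $r=1$ or $1=s<r<\infty$; $R_2$ if $1<r<s=\infty$; and $R_3$ if $r=\infty$; where, with $V(t)=\int_0^t u^{-1}a(u)^r\,du$, $$R_1=\begin{cases}\sup\limits_{x>0}\|t^{-\frac1s}b(t)\log\frac xt\|_{s,(0,x)}\,\|t^{-\frac1r}a(t)\|_{r,(0,x)}^{-1}, & r\le s,\\[4pt] \Big\|x^{-\frac1\varrho}a(x)^{\frac r\varrho}\,\|t^{-\frac1s}b(t)\log\frac xt\|_{s,(0,x)}\,\|t^{-\frac1r}a(t)\|_{r,(0,x)}^{-\frac rs}\Big\|_{\varrho,(0,\infty)}, & r>s,\end{cases}$$ $$R_2=\begin{cases}\sup\limits_{x>0}\|t^{-\frac1s}b(t)\|_{s,(0,x)}\,\|t^{-\frac1{r'}}a(t)^{\frac r{r'}}V(t)^{-1}\log\frac tx\|_{r',(x,\infty)}, & r\le s,\\[4pt] \Big\|x^{-\frac1\varrho}b(x)^{\frac s\varrho}\,\|t^{-\frac1s}b(t)\|_{s,(0,x)}^{\frac sr}\,\|t^{-\frac1{r'}}a(t)^{\frac r{r'}}V(t)^{-1}\log\frac tx\|_{r',(x,\infty)}\Big\|_{\varrho,(0,\infty)},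 & r>s,\end{cases}$$ $$R_3=\Big\|t^{-\frac1s}b(t)\int_t^\infty u^{-1}\|a\|_{\infty,(0,u)}^{-1}\,du\Big\|_{s,(0,\infty)} .$$ -/

import Mathlib

open MeasureTheory Set
open scoped ENNReal NNReal

noncomputable section

namespace LorentzKaramata

/-! Indices `p, q, r, s ∈ [1, ∞]` are elements of `ℝ≥0∞`; all non-negative quantities take values
in `ℝ≥0∞`, where `∞ * 0 = 0`, `c / ∞ = 0` for `c < ∞`, and `0⁻¹ = ∞`. -/

/-- The real number `1 / p`, with `1 / ∞ = 0`. -/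
def recip (p : ℝ≥0∞) : ℝ := (p⁻¹).toReal

/-- The conjugate index `p'` of `p ∈ [1, ∞]`, given by `1 / p + 1 / p' = 1`. -/
def conj (p : ℝ≥0∞) : ℝ≥0∞ := (1 - p⁻¹)⁻¹

/-- The index `ϱ` with `1 / ϱ = 1 / s - 1 / r`, used only when `s < r`. -/
def rho (r s : ℝ≥0∞) : ℝ≥0∞ := (s⁻¹ - r⁻¹)⁻¹

/-- The power `t ^ α` of a real number `t > 0`, as an element of `[0, ∞]`. -/
def pw (t α : ℝ) : ℝ≥0∞ := ENNReal.ofReal t ^ α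

/-- The Lebesgue norm `‖h‖_{r, I}` of a non-negative function `h` on `I ⊆ ℝ`
(the essential supremum if `r = ∞`). -/
def lebNorm (r : ℝ≥0∞) (I : Set ℝ) (h : ℝ → ℝ≥0∞) : ℝ≥0∞ := eLpNorm h r (volume.restrict I)

section Rearrangement

variable {R : Type*} [MeasurableSpace R]

/-- The distribution function `h ↦ μ {x | u x > h}` of a non-negative function `u`. -/
def distribution (μ : Measure R) (u : R → ℝ≥0∞) (h : ℝ≥0∞) : ℝ≥0∞ := μ {x | h < u x}

/-- The decreasing rearrangement
`f^*(t) = inf {h > 0 | μ {x | |f x| > h} ≤ t}` of a scalar function `f`. -/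
def rearrangement {𝕜 : Type*} [RCLike 𝕜] (μ : Measure R) (f : R → 𝕜) (t : ℝ) : ℝ≥0∞ :=
  sInf {h : ℝ≥0∞ | 0 < h ∧ distribution μ (fun x => ‖f x‖ₑ) h ≤ ENNReal.ofReal t}

/-- The scalar function `g` on `(R, μ)` is equimeasurable with the non-negative function `f`
on `(0, ∞)` with Lebesgue measure. -/
def Equimeasurable {𝕜 : Type*} [RCLike 𝕜] (μ : Measure R) (g : R → 𝕜) (f : ℝ → ℝ≥0) : Prop :=
  ∀ h : ℝ≥0, distribution μ (fun x => ‖g x‖ₑ) h =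
    distribution (volume.restrict (Ioi (0 : ℝ))) (fun t => (f t : ℝ≥0∞)) h

end Rearrangement

/-- `E ≈ F` on `I`: each is at most a constant in `(0, ∞)` times the other. -/
def EquivOn (I : Set ℝ) (E F : ℝ → ℝ≥0∞) : Prop :=
  ∃ c : ℝ≥0, 0 < c ∧ ∀ t ∈ I, E t ≤ c * F t ∧ F t ≤ c * E t

/-- Slowly varying functions on the interval `I ⊆ (0, ∞)`. -/
structure SlowlyVarying (I : Set ℝ) (a : ℝ → ℝ≥0∞) : Prop where
  measurable : AEMeasurable a (volume.restrict I)
  not_zero : ∃ t ∈ I, a t ≠ 0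
  not_top : ∃ t ∈ I, a t ≠ ∞
  equiv_mono : ∀ ε : ℝ, 0 < ε →
    ∃ g : ℝ → ℝ≥0∞, MonotoneOn g I ∧ EquivOn I (fun t => pw t ε * a t) g
  equiv_anti : ∀ ε : ℝ, 0 < ε →
    ∃ g : ℝ → ℝ≥0∞, AntitoneOn g I ∧ EquivOn I (fun t => pw t (-ε) * a t) g

/-- The slope `m` of the interpolation segment `[(1/p₁, 1/q₁); (1/p₂, 1/q₂)]`. -/
def slope (p₁ q₁ p₂ q₂ : ℝ≥0∞) : ℝ := (recip q₁ - recip q₂) / (recip p₁ - recip p₂)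

/-- The first part of the Calderón operator: `x^{-1/q} ∫_0^{x^m} t^{1/p - 1} g(t) dt`. -/
def calderonLeft (p q : ℝ≥0∞) (m : ℝ) (g : ℝ → ℝ≥0∞) (x : ℝ) : ℝ≥0∞ :=
  pw x (-recip q) * ∫⁻ t in Ioo 0 (x ^ m), pw t (recip p - 1) * g t

/-- The second part of the Calderón operator: `x^{-1/q} ∫_{x^m}^∞ t^{1/p - 1} g(t) dt`. -/
def calderonRight (p q : ℝ≥0∞) (m : ℝ) (g : ℝ → ℝ≥0∞) (x : ℝ) : ℝ≥0∞ :=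
  pw x (-recip q) * ∫⁻ t in Ioi (x ^ m), pw t (recip p - 1) * g t

/-- The Calderón operator `S_σ`, where `σ = [(1/p₁, 1/q₁); (1/p₂, 1/q₂)]`. -/
def calderon (p₁ q₁ p₂ q₂ : ℝ≥0∞) (g : ℝ → ℝ≥0∞) (x : ℝ) : ℝ≥0∞ :=
  calderonLeft p₁ q₁ (slope p₁ q₁ p₂ q₂) g x + calderonRight p₂ q₂ (slope p₁ q₁ p₂ q₂) g x

/-- A quasilinear operator from a linear subspace (`domain`) of the scalar `μ₁`-measurable
functions on `R₁` to the scalar `μ₂`-measurable functions on `R₂`. -/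
structure QuasilinearOperator (𝕜 : Type*) [RCLike 𝕜] {R₁ R₂ : Type*} [MeasurableSpace R₁]
    [MeasurableSpace R₂] (μ₁ : Measure R₁) (μ₂ : Measure R₂) where
  domain : Submodule 𝕜 (R₁ → 𝕜)
  aemeasurable_of_mem : ∀ f ∈ domain, AEMeasurable f μ₁
  toFun : domain → R₂ → 𝕜
  aemeasurable_toFun : ∀ f, AEMeasurable (toFun f) μ₂
  quasi_add : ∃ k : ℝ, 1 ≤ k ∧ ∀ f g : domain, ∀ᵐ y ∂μ₂,
    ‖toFun (f + g) y‖ ≤ k * (‖toFun f y‖ + ‖toFun g y‖)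
  norm_smul : ∀ (α : 𝕜) (f : domain), ∀ᵐ y ∂μ₂, ‖toFun (α • f) y‖ = ‖α‖ * ‖toFun f y‖

section Operators

variable {𝕜 : Type*} [RCLike 𝕜] {R₁ R₂ : Type*} [MeasurableSpace R₁] [MeasurableSpace R₂]
  {μ₁ : Measure R₁} {μ₂ : Measure R₂}

/-- `T ∈ JW(p₁, q₁; p₂, q₂)`: every measurable `f` with `S_σ f^*(1) < ∞` lies in the domain of `T`,
and `(T f)^* ≤ C S_σ f^*` on `(0, ∞)` for all these `f`, with `C` independent of `f`. -/
def JointWeakType (T : QuasilinearOperator 𝕜 μ₁ μ₂) (p₁ q₁ p₂ q₂ : ℝ≥0∞) : Prop :=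
  ∃ C : ℝ≥0, ∀ f : R₁ → 𝕜, AEMeasurable f μ₁ →
    calderon p₁ q₁ p₂ q₂ (rearrangement μ₁ f) 1 < ∞ →
    ∃ hf : f ∈ T.domain, ∀ x : ℝ, 0 < x →
      rearrangement μ₂ (T.toFun ⟨f, hf⟩) x ≤ C * calderon p₁ q₁ p₂ q₂ (rearrangement μ₁ f) x

/-- `T ∈ LB₂(p₂, q₂; m)`: every non-increasing `f : (0, ∞) → [0, ∞)` is equimeasurable with some
`g` on `R₁` such that `(T g)^*(x) ≥ c x^{-1/q₂} ∫_{x^m}^∞ t^{1/p₂ - 1} f(t) dt` for all `x > 0`, with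
`c > 0` independent of `f`. The inequality is only demanded where `T g` is defined; if `T` is also of
joint weak type, then `T g` is defined whenever `S_σ f(1) < ∞`. -/
def LowerBound₂ (T : QuasilinearOperator 𝕜 μ₁ μ₂) (p₂ q₂ : ℝ≥0∞) (m : ℝ) : Prop :=
  ∃ c : ℝ≥0, 0 < c ∧ ∀ f : ℝ → ℝ≥0, AntitoneOn f (Ioi 0) →
    ∃ g : R₁ → 𝕜, AEMeasurable g μ₁ ∧ Equimeasurable μ₁ g f ∧
      ∀ hg : g ∈ T.domain, ∀ x : ℝ, 0 < x →
        c * calderonRight p₂ q₂ m (fun t => (f t : ℝ≥0∞)) x ≤ rearrangement μ₂ (T.toFun ⟨g, hg⟩) x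

end Operators

section Spaces

variable {𝕜 : Type*} [RCLike 𝕜]

/-- The functional `‖t^{1/p - 1/r} a(t) f^*(t)‖_{r, (0, ∞)}` of the Lorentz-Karamata space
`L_{p,r;a}` over a measure space of infinite measure. -/
def lkNorm {R : Type*} [MeasurableSpace R] (μ : Measure R) (p r : ℝ≥0∞) (a : ℝ → ℝ≥0∞)
    (f : R → 𝕜) : ℝ≥0∞ :=
  lebNorm r (Ioi 0) (fun t => pw t (recip p - recip r) * a t * rearrangement μ f t)

/-- The Lorentz-Karamata space `L_{p,r;a}(R, μ)`, when `μ(R) = ∞`. -/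
def lkSpace (𝕜 : Type*) [RCLike 𝕜] {R : Type*} [MeasurableSpace R] (μ : Measure R) (p r : ℝ≥0∞)
    (a : ℝ → ℝ≥0∞) : Set (R → 𝕜) :=
  {f | AEMeasurable f μ ∧ lkNorm μ p r a f < ∞}

/-- `T : L_{p,r;a} ⟶ L_{q,s;b}`, i.e. `T` is defined on `L_{p,r;a}` and bounded into `L_{q,s;b}`. -/
def BoundedLK {R₁ R₂ : Type*} [MeasurableSpace R₁] [MeasurableSpace R₂] {μ₁ : Measure R₁}
    {μ₂ : Measure R₂} (T : QuasilinearOperator 𝕜 μ₁ μ₂) (p r : ℝ≥0∞) (a : ℝ → ℝ≥0∞)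
    (q s : ℝ≥0∞) (b : ℝ → ℝ≥0∞) : Prop :=
  ∃ C : ℝ≥0, ∀ f ∈ lkSpace 𝕜 μ₁ p r a, ∃ hf : f ∈ T.domain,
    lkNorm μ₂ q s b (T.toFun ⟨f, hf⟩) ≤ C * lkNorm μ₁ p r a f

end Spaces

/-- `b_*(t) = b(t^{1/m})`. -/
def lowerStar (m : ℝ) (b : ℝ → ℝ≥0∞) (t : ℝ) : ℝ≥0∞ := b (t ^ (1 / m))

/-- The quantity `R₁(r, s, a, b; 0, ∞)`. -/
def R₁ (r s : ℝ≥0∞) (a b : ℝ → ℝ≥0∞) : ℝ≥0∞ :=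
  if r ≤ s then
    ⨆ x ∈ Ioi (0 : ℝ),
      lebNorm s (Ioo 0 x) (fun t => pw t (-recip s) * b t * ENNReal.ofReal (Real.log (x / t))) *
        (lebNorm r (Ioo 0 x) (fun t => pw t (-recip r) * a t))⁻¹
  else
    lebNorm (rho r s) (Ioi 0) (fun x =>
      pw x (-recip (rho r s)) * a x ^ (r.toReal * recip (rho r s)) *
        lebNorm s (Ioo 0 x) (fun t => pw t (-recip s) * b t * ENNReal.ofReal (Real.log (x / t))) *
        lebNorm r (Ioo 0 x) (fun t => pw t (-recip r) * a t) ^ (-(r.toReal * recip s)))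

/-- `V(t) = ∫_0^t u^{-1} a(u)^r du`. -/
def V (r : ℝ≥0∞) (a : ℝ → ℝ≥0∞) (t : ℝ) : ℝ≥0∞ :=
  ∫⁻ u in Ioo 0 t, pw u (-1) * a u ^ r.toReal

/-- The quantity `R₂(r, s, a, b; 0, ∞)`. -/
def R₂ (r s : ℝ≥0∞) (a b : ℝ → ℝ≥0∞) : ℝ≥0∞ :=
  if r ≤ s then
    ⨆ x ∈ Ioi (0 : ℝ),
      lebNorm s (Ioo 0 x) (fun t => pw t (-recip s) * b t) *
        lebNorm (conj r) (Ioi x) (fun t => pw t (-recip (conj r)) *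
          a t ^ (r.toReal * recip (conj r)) * (V r a t)⁻¹ * ENNReal.ofReal (Real.log (t / x)))
  else
    lebNorm (rho r s) (Ioi 0) (fun x =>
      pw x (-recip (rho r s)) * b x ^ (s.toReal * recip (rho r s)) *
        lebNorm s (Ioo 0 x) (fun t => pw t (-recip s) * b t) ^ (s.toReal * recip r) *
        lebNorm (conj r) (Ioi x) (fun t => pw t (-recip (conj r)) *
          a t ^ (r.toReal * recip (conj r)) * (V r a t)⁻¹ * ENNReal.ofReal (Real.log (t / x))))

/-- The quantity `R₃(∞, s, a, b; 0, ∞)`. -/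
def R₃ (s : ℝ≥0∞) (a b : ℝ → ℝ≥0∞) : ℝ≥0∞ :=
  lebNorm s (Ioi 0) (fun t => pw t (-recip s) * b t *
    ∫⁻ u in Ioi t, pw u (-1) * (lebNorm ∞ (Ioo 0 u) a)⁻¹)

/-- The quantity `R_∞(r, s, a, b; 0, ∞)` for `r, s ∈ [1, ∞]`: it is `R₃` if `r = ∞`, `R₁` if `r = 1`
or `1 = s < r < ∞`, `R₂` if `1 < r < s = ∞`, and `R₁ + R₂` if `1 < r, s < ∞`. -/
def Rinf (r s : ℝ≥0∞) (a b : ℝ → ℝ≥0∞) : ℝ≥0∞ :=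
  if r = ∞ then R₃ s a b
  else if r = 1 ∨ s = 1 then R₁ r s a b
  else if s = ∞ then R₂ r s a b
  else R₁ r s a b + R₂ r s a b

end LorentzKaramata

end

noncomputable section

namespace LorentzKaramata

/-! ### Atomless measures on the half-line -/

/-- The mass of an interval under an atomless measure takes all intermediate values. -/
theorem exists_measure_Ioo_eq (m : Measure ℝ) [NullSingletonClass m] {α β : ℝ} (hαβ : α ≤ β)
    (hfin : m (Ioo α β) ≠ ∞) {c : ℝ≥0∞} (hc : c ≤ m (Ioo α β)) :
    ∃ y ∈ Icc α β, m (Ioo α y) = c := by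
  have hcf : c ≠ ∞ := ne_top_of_le_ne_top hfin hc
  set m' := m.restrict (Ioo α β) with hm'
  have : IsFiniteMeasure m' := ⟨by rw [hm', Measure.restrict_apply_univ]; exact hfin.lt_top⟩
  have hcont : Continuous fun y => ∫ _ in α..y, (1 : ℝ) ∂m' :=
    (integrable_const (1 : ℝ)).continuous_primitive α
  have hval : ∀ y ∈ Icc α β, ∫ _ in α..y, (1 : ℝ) ∂m' = (m (Ioo α y)).toReal := by
    intro y hy
    rw [intervalIntegral.integral_const', Ioc_eq_empty (not_lt.2 hy.1)]
    have h1 : m' (Ioc α y) = m (Ioo α y) := by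
      rw [← measure_congr Ioo_ae_eq_Ioc, hm', Measure.restrict_apply measurableSet_Ioo,
        inter_eq_left.2 (Ioo_subset_Ioo_right hy.2)]
    simp [Measure.real, h1]
  have := intermediate_value_Icc hαβ hcont.continuousOn
  obtain ⟨y, hy, hyc⟩ : c.toReal ∈ (fun y => ∫ _ in α..y, (1 : ℝ) ∂m') '' Icc α β := by
    apply this
    constructor
    · simp
    · rw [hval β ⟨hαβ, le_rfl⟩]
      exact ENNReal.toReal_mono hfin hc
  refine ⟨y, hy, ?_⟩
  beta_reduce at hyc
  rw [hval y hy] at hyc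
  exact (ENNReal.toReal_eq_toReal_iff'
    (measure_ne_top_of_subset (Ioo_subset_Ioo_right hy.2) hfin) hcf).1 hyc

/-- An atomless measure on `(0, ∞)` of infinite mass, of finite mass near `0`, which charges all
intervals. -/
structure IsWeight (ν : Measure ℝ) : Prop where
  null : ν (Iic 0) = 0
  ne_top : ∀ x, ν (Iio x) ≠ ∞
  pos : ∀ x y, 0 < x → x < y → ν (Ioo x y) ≠ 0
  total : ν univ = ∞

theorem ae_pos_of_null {ν : Measure ℝ} (h : ν (Iic 0) = 0) : ∀ᵐ t ∂ν, 0 < t := by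
  rw [ae_iff]
  convert h using 2
  ext t
  simp

section Weight

variable {ν : Measure ℝ}

theorem measurable_measure_Iio (ν : Measure ℝ) : Measurable fun x => ν (Iio x) :=
  Monotone.measurable fun _ _ h => measure_mono (Iio_subset_Iio h)

theorem IsWeight.ne_zero (hν : IsWeight ν) {x : ℝ} (hx : 0 < x) : ν (Iio x) ≠ 0 := fun h =>
  hν.pos (x / 2) x (by linarith) (by linarith)
    (measure_mono_null (fun _ ht => ht.2) h)

theorem IsWeight.Iio_lt (hν : IsWeight ν) {x y : ℝ} (hx : 0 < x) (hxy : x < y) :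
    ν (Iio x) < ν (Iio y) := by
  have h : ν (Iio x) + ν (Ioo x y) ≤ ν (Iio y) := by
    rw [← measure_union (by
      rw [disjoint_left]; intro t h1 h2; exact lt_asymm h1 h2.1) measurableSet_Ioo]
    exact measure_mono (union_subset (Iio_subset_Iio hxy.le) fun t ht => ht.2)
  exact (ENNReal.lt_add_right (hν.ne_top x) (hν.pos x y hx hxy)).trans_le h

theorem IsWeight.exists_eq [NullSingletonClass ν] (hν : IsWeight ν) {y : ℝ≥0∞} (hy0 : y ≠ 0)
    (hy : y ≠ ∞) : ∃ x, 0 < x ∧ ν (Iio x) = y := by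
  have h1 : ⨆ n : ℕ, ν (Iio (n : ℝ)) = ∞ := by
    rw [← hν.total, ← Monotone.measure_iUnion]
    · congr 1
      rw [eq_univ_iff_forall]
      intro x
      obtain ⟨n, hn⟩ := exists_nat_gt x
      exact mem_iUnion.2 ⟨n, hn⟩
    · intro i j hij
      exact Iio_subset_Iio (by exact_mod_cast hij)
  obtain ⟨n, hn⟩ := lt_iSup_iff.1 (h1 ▸ hy.lt_top)
  have hI : ∀ z : ℝ, ν (Ioo 0 z) = ν (Iio z) := by
    intro z
    refine le_antisymm (measure_mono fun t ht => ht.2) ?_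
    calc ν (Iio z) ≤ ν (Iic 0 ∪ Ioo 0 z) := measure_mono fun t ht => by
          rcases le_or_gt t 0 with h | h
          · exact Or.inl h
          · exact Or.inr ⟨h, ht⟩
      _ ≤ ν (Iic 0) + ν (Ioo 0 z) := measure_union_le _ _
      _ = ν (Ioo 0 z) := by rw [hν.null, zero_add]
  obtain ⟨x, hx, hxy⟩ := exists_measure_Ioo_eq ν (α := 0) (β := n) (Nat.cast_nonneg n)
    (by rw [hI]; exact hν.ne_top _) (c := y) (by rw [hI]; exact hn.le)
  rw [hI] at hxy
  refine ⟨x, ?_, hxy⟩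
  rcases hx.1.lt_or_eq with h | h
  · exact h
  · exfalso
    apply hy0
    rw [← hxy, ← h]
    exact measure_mono_null Iio_subset_Iic_self hν.null

/-- The distribution function of `ν` pushes `ν` forward to Lebesgue measure. -/
theorem IsWeight.map_eq [NullSingletonClass ν] (hν : IsWeight ν) :
    ν.map (fun x => (ν (Iio x)).toReal) = volume.restrict (Ioi 0) := by
  have hm : Measurable fun x => (ν (Iio x)).toReal := (measurable_measure_Iio ν).ennreal_toReal
  have hIic : ∀ y : ℝ, ν.map (fun x => (ν (Iio x)).toReal) (Iic y) = ENNReal.ofReal y := by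
    intro y
    rw [Measure.map_apply hm measurableSet_Iic]
    rcases le_or_gt y 0 with hy | hy
    · rw [ENNReal.ofReal_of_nonpos hy]
      refine measure_mono_null (fun t ht => ?_) hν.null
      by_contra h
      have h' : 0 < t := not_le.1 h
      have : 0 < (ν (Iio t)).toReal := ENNReal.toReal_pos (hν.ne_zero h') (hν.ne_top t)
      exact absurd (le_trans ht hy) (not_le.2 this)
    · obtain ⟨x, hx, hxy⟩ := hν.exists_eq (y := ENNReal.ofReal y)
        (by simpa using hy) ENNReal.ofReal_ne_top
      have : (fun x => (ν (Iio x)).toReal) ⁻¹' Iic y = Iic x := by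
        ext t
        simp only [mem_preimage, mem_Iic]
        rw [← ENNReal.le_ofReal_iff_toReal_le (hν.ne_top t) hy.le, ← hxy]
        constructor
        · intro h
          by_contra h'
          exact absurd h (not_le.2 (hν.Iio_lt hx (not_le.1 h')))
        · intro h
          exact measure_mono (Iio_subset_Iio h)
      rw [this, ← measure_congr Iio_ae_eq_Iic, hxy]
  have : IsLocallyFiniteMeasure (ν.map (fun x => (ν (Iio x)).toReal)) := by
    refine ⟨fun x => ⟨Iic (x + 1), Iic_mem_nhds (by linarith), ?_⟩⟩
    rw [hIic]
    exact ENNReal.ofReal_lt_top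
  refine Measure.ext_of_Ioc _ _ fun α β hαβ => ?_
  have hadd : ν.map (fun x => (ν (Iio x)).toReal) (Iic β)
      = ν.map (fun x => (ν (Iio x)).toReal) (Iic α)
        + ν.map (fun x => (ν (Iio x)).toReal) (Ioc α β) := by
    rw [← measure_union (Iic_disjoint_Ioc le_rfl) measurableSet_Ioc, Iic_union_Ioc_eq_Iic hαβ.le]
  rw [hIic, hIic] at hadd
  have hI : Ioc α β ∩ Ioi 0 = Ioc (max α 0) β := by
    ext t; simp only [mem_inter_iff, mem_Ioc, mem_Ioi, max_lt_iff]; tauto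
  rw [Measure.restrict_apply measurableSet_Ioc, hI, Real.volume_Ioc,
    ENNReal.ofReal_sub _ (le_max_right _ _)]
  have hmax : ENNReal.ofReal (max α 0) = ENNReal.ofReal α := by
    rcases le_total α 0 with h | h
    · rw [max_eq_right h, ENNReal.ofReal_zero, ENNReal.ofReal_of_nonpos h]
    · rw [max_eq_left h]
  rw [hmax, hadd, ENNReal.add_sub_cancel_left ENNReal.ofReal_ne_top]

theorem lintegral_Ioo_rpow {c e : ℝ} (hc : 0 ≤ c) (he : -1 < e) :
    ∫⁻ y in Ioo 0 c, ENNReal.ofReal y ^ e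
      = ENNReal.ofReal (1 / (e + 1)) * ENNReal.ofReal c ^ (e + 1) := by
  have h1 : ∫⁻ y in Ioo 0 c, ENNReal.ofReal y ^ e = ∫⁻ y in Ioo 0 c, ENNReal.ofReal (y ^ e) := by
    refine setLIntegral_congr_fun measurableSet_Ioo fun y hy => ?_
    exact ENNReal.ofReal_rpow_of_pos hy.1
  have hint : IntegrableOn (fun y : ℝ => y ^ e) (Ioo 0 c) :=
    ((intervalIntegrable_iff_integrableOn_Ioo_of_le hc).1
      (intervalIntegral.intervalIntegrable_rpow' he))
  rw [h1, ← ofReal_integral_eq_lintegral_ofReal hint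
    ((ae_restrict_iff' measurableSet_Ioo).2 (Filter.Eventually.of_forall fun y hy =>
      Real.rpow_nonneg hy.1.le _)), ← integral_Ioc_eq_integral_Ioo,
    ← intervalIntegral.integral_of_le hc, integral_rpow (Or.inl he),
    Real.zero_rpow (by linarith), sub_zero, div_eq_mul_one_div, mul_comm,
    ENNReal.ofReal_mul (by apply one_div_nonneg.2; linarith),
    ENNReal.ofReal_rpow_of_nonneg hc (by linarith)]

theorem lintegral_Ioi_rpow {c e : ℝ} (hc : 0 < c) (he : e < -1) :
    ∫⁻ y in Ioi c, ENNReal.ofReal y ^ e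
      = ENNReal.ofReal (1 / (-e - 1)) * ENNReal.ofReal c ^ (e + 1) := by
  have h1 : ∫⁻ y in Ioi c, ENNReal.ofReal y ^ e = ∫⁻ y in Ioi c, ENNReal.ofReal (y ^ e) := by
    refine setLIntegral_congr_fun measurableSet_Ioi fun y hy => ?_
    exact ENNReal.ofReal_rpow_of_pos (hc.trans hy)
  rw [h1, ← ofReal_integral_eq_lintegral_ofReal (integrableOn_Ioi_rpow_of_lt he hc)
    ((ae_restrict_iff' measurableSet_Ioi).2 (Filter.Eventually.of_forall fun y hy =>
      Real.rpow_nonneg (hc.trans hy).le _)), integral_Ioi_rpow_of_lt he hc,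
    ENNReal.ofReal_rpow_of_pos hc, ← ENNReal.ofReal_mul (by apply one_div_nonneg.2; linarith)]
  congr 1
  rw [show -e - 1 = -(e + 1) by ring, one_div, inv_neg, div_eq_mul_inv]
  ring

theorem IsWeight.ofReal_toReal (hν : IsWeight ν) (x : ℝ) :
    ENNReal.ofReal (ν (Iio x)).toReal = ν (Iio x) := ENNReal.ofReal_toReal (hν.ne_top x)

theorem IsWeight.ae_pos (hν : IsWeight ν) : ∀ᵐ t ∂ν, 0 < t := ae_pos_of_null hν.null

/-- `∫_0^x V^e dν = V(x)^{e + 1} / (e + 1)` for `e > -1`. -/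
theorem IsWeight.lintegral_Iio_rpow [NullSingletonClass ν] (hν : IsWeight ν) {x e : ℝ}
    (he : -1 < e) :
    ∫⁻ t in Iio x, ν (Iio t) ^ e ∂ν = ENNReal.ofReal (1 / (e + 1)) * ν (Iio x) ^ (e + 1) := by
  have hm : Measurable fun x => (ν (Iio x)).toReal := (measurable_measure_Iio ν).ennreal_toReal
  rw [← hν.ofReal_toReal x, ← lintegral_Ioo_rpow ENNReal.toReal_nonneg he,
    ← lintegral_indicator measurableSet_Iio]
  have : Ioo 0 (ν (Iio x)).toReal = Iio (ν (Iio x)).toReal ∩ Ioi 0 := by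
    ext; simp [and_comm]
  rw [this, ← Measure.restrict_restrict measurableSet_Iio, ← hν.map_eq,
    ← lintegral_indicator measurableSet_Iio, lintegral_map _ hm]
  · refine lintegral_congr_ae ?_
    filter_upwards [hν.ae_pos] with t ht
    by_cases htx : t < x
    · have : (ν (Iio t)).toReal < (ν (Iio x)).toReal :=
        ENNReal.toReal_strict_mono (hν.ne_top x) (hν.Iio_lt ht htx)
      rw [indicator_of_mem (show t ∈ Iio x from htx), indicator_of_mem (show _ ∈ Iio _ from this),
        hν.ofReal_toReal]
    · have : ¬ (ν (Iio t)).toReal < (ν (Iio x)).toReal := not_lt.2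
        (ENNReal.toReal_mono (hν.ne_top t) (measure_mono (Iio_subset_Iio (not_lt.1 htx))))
      rw [indicator_of_notMem (show t ∉ Iio x from htx),
        indicator_of_notMem (show _ ∉ Iio _ from this)]
  · exact (ENNReal.measurable_ofReal.pow_const _).indicator measurableSet_Iio

/-- `∫_x^∞ V^e dν = V(x)^{e + 1} / (-e - 1)` for `e < -1`. -/
theorem IsWeight.lintegral_Ioi_rpow [NullSingletonClass ν] (hν : IsWeight ν) {x e : ℝ} (hx : 0 < x)
    (he : e < -1) :
    ∫⁻ t in Ioi x, ν (Iio t) ^ e ∂ν = ENNReal.ofReal (1 / (-e - 1)) * ν (Iio x) ^ (e + 1) := by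
  have hm : Measurable fun x => (ν (Iio x)).toReal := (measurable_measure_Iio ν).ennreal_toReal
  have hpos : 0 < (ν (Iio x)).toReal := ENNReal.toReal_pos (hν.ne_zero hx) (hν.ne_top x)
  rw [← hν.ofReal_toReal x, ← LorentzKaramata.lintegral_Ioi_rpow hpos he,
    ← lintegral_indicator measurableSet_Ioi]
  have : Ioi (ν (Iio x)).toReal = Ioi (ν (Iio x)).toReal ∩ Ioi 0 := by
    rw [Ioi_inter_Ioi, sup_eq_left.2 hpos.le]
  rw [this, ← Measure.restrict_restrict measurableSet_Ioi, ← hν.map_eq,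
    ← lintegral_indicator measurableSet_Ioi, lintegral_map _ hm]
  · refine lintegral_congr_ae ?_
    filter_upwards [hν.ae_pos] with t ht
    by_cases htx : x < t
    · have : (ν (Iio x)).toReal < (ν (Iio t)).toReal :=
        ENNReal.toReal_strict_mono (hν.ne_top t) (hν.Iio_lt hx htx)
      rw [indicator_of_mem (show t ∈ Ioi x from htx), indicator_of_mem (show _ ∈ Ioi _ from this),
        hν.ofReal_toReal]
    · have : ¬ (ν (Iio x)).toReal < (ν (Iio t)).toReal := not_lt.2
        (ENNReal.toReal_mono (hν.ne_top x) (measure_mono (Iio_subset_Iio (not_lt.1 htx))))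
      rw [indicator_of_notMem (show t ∉ Ioi x from htx),
        indicator_of_notMem (show _ ∉ Ioi _ from this)]
  · exact (ENNReal.measurable_ofReal.pow_const _).indicator measurableSet_Ioi

end Weight

/-! ### Hardy inequalities with respect to an atomless measure -/

theorem lintegral_mul_rpow_le {α : Type*} [MeasurableSpace α] (m : Measure α) {p q : ℝ}
    (hpq : p.HolderConjugate q) {f g : α → ℝ≥0∞} (hf : AEMeasurable f m) (hg : AEMeasurable g m) :
    (∫⁻ x, f x * g x ∂m) ^ p ≤ (∫⁻ x, f x ^ p ∂m) * (∫⁻ x, g x ^ q ∂m) ^ (p / q) := by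
  have h := ENNReal.lintegral_mul_le_Lp_mul_Lq m hpq hf hg
  have hp := hpq.pos
  calc (∫⁻ x, f x * g x ∂m) ^ p
      ≤ ((∫⁻ a, f a ^ p ∂m) ^ (1 / p) * (∫⁻ a, g a ^ q ∂m) ^ (1 / q)) ^ p :=
        ENNReal.rpow_le_rpow h hp.le
    _ = _ := by
        rw [ENNReal.mul_rpow_of_nonneg _ _ hp.le, ← ENNReal.rpow_mul, ← ENNReal.rpow_mul,
          one_div_mul_cancel hp.ne', ENNReal.rpow_one]
        congr 2
        ring

theorem lintegral_mul_lintegral_Iio (m ν : Measure ℝ) [SFinite m] [SFinite ν] {A B : ℝ → ℝ≥0∞}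
    (hA : Measurable A) (hB : Measurable B) :
    ∫⁻ t, A t * ∫⁻ u in Iio t, B u ∂m ∂ν = ∫⁻ u, B u * ∫⁻ t in Ioi u, A t ∂ν ∂m := by
  have hS : MeasurableSet {p : ℝ × ℝ | p.2 < p.1} := measurableSet_lt measurable_snd measurable_fst
  have hmeas : Measurable (fun p : ℝ × ℝ => {p : ℝ × ℝ | p.2 < p.1}.indicator
      (fun p => A p.1 * B p.2) p) :=
    ((hA.comp measurable_fst).mul (hB.comp measurable_snd)).indicator hS
  calc ∫⁻ t, A t * ∫⁻ u in Iio t, B u ∂m ∂ν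
      = ∫⁻ t, ∫⁻ u, {p : ℝ × ℝ | p.2 < p.1}.indicator (fun p => A p.1 * B p.2) (t, u) ∂m ∂ν := by
        refine lintegral_congr fun t => ?_
        rw [← lintegral_const_mul _ hB, ← lintegral_indicator measurableSet_Iio]
        rfl
    _ = ∫⁻ u, ∫⁻ t, {p : ℝ × ℝ | p.2 < p.1}.indicator (fun p => A p.1 * B p.2) (t, u) ∂ν ∂m :=
        lintegral_lintegral_swap hmeas.aemeasurable
    _ = _ := by
        refine lintegral_congr fun u => ?_
        rw [← lintegral_const_mul _ hA, ← lintegral_indicator measurableSet_Ioi]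
        refine lintegral_congr fun t => ?_
        simp only [indicator, mem_ofPred_eq, mem_Ioi]
        split_ifs
        · rw [mul_comm]
        · rfl

theorem measurable_lintegral_Iio (m : Measure ℝ) (B : ℝ → ℝ≥0∞) :
    Measurable fun t => ∫⁻ u in Iio t, B u ∂m :=
  Monotone.measurable fun _ _ h => lintegral_mono_set (Iio_subset_Iio h)

theorem measurable_lintegral_Ioi (m : Measure ℝ) (B : ℝ → ℝ≥0∞) :
    Measurable fun t => ∫⁻ u in Ioi t, B u ∂m :=
  Antitone.measurable fun _ _ h => lintegral_mono_set (Ioi_subset_Ioi h)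

section

variable {ν : Measure ℝ} [SFinite ν] [NullSingletonClass ν]

/-- Hardy's inequality for averages. -/
theorem IsWeight.hardy_Iio (hν : IsWeight ν) {p q : ℝ} (hpq : p.HolderConjugate q) :
    ∃ C : ℝ≥0, ∀ g : ℝ → ℝ≥0∞, Measurable g →
      ∫⁻ t, ((∫⁻ u in Iio t, g u ∂ν) * (ν (Iio t))⁻¹) ^ p ∂ν ≤ C * ∫⁻ t, g t ^ p ∂ν := by
  have hp := hpq.pos
  have hq := hpq.symm.pos
  have hp1 := hpq.lt
  have hq1 := hpq.symm.lt
  have hinv := hpq.inv_add_inv_eq_one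
  set c₁ : ℝ≥0 := (1 / (-(1 / p) + 1)).toNNReal
  set c₂ : ℝ≥0 := (1 / (-(-1 - 1 / q) - 1)).toNNReal
  have hVm := measurable_measure_Iio ν
  refine ⟨c₁ ^ (p / q) * c₂, fun g hg => ?_⟩
  have hpq0 : 0 < p / q := by positivity
  have hexp : (-(1 / p) + 1) * (p / q) + -p = -1 - 1 / q := by
    have : -(1 / p) + 1 = 1 / q := by simp only [one_div]; linarith
    rw [this]
    have h2 : p = p * q⁻¹ + 1 := by
      have := congrArg (p * ·) hinv
      simp only [mul_add, mul_inv_cancel₀ hp.ne', mul_one] at this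
      linarith
    have h3 : p * q⁻¹ * q⁻¹ = p * q⁻¹ - q⁻¹ * 1 + 0 := by
      have : q⁻¹ = 1 - p⁻¹ := by linarith
      calc p * q⁻¹ * q⁻¹ = p * q⁻¹ * (1 - p⁻¹) := by rw [← this]
        _ = _ := by field_simp; ring
    simp only [div_eq_mul_inv, one_mul]
    nlinarith
  have hc₁ : (c₁ : ℝ≥0∞) ^ (p / q) ≠ ∞ := ENNReal.rpow_ne_top_of_nonneg hpq0.le ENNReal.coe_ne_top
  calc ∫⁻ t, ((∫⁻ u in Iio t, g u ∂ν) * (ν (Iio t))⁻¹) ^ p ∂ν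
      ≤ ∫⁻ t, c₁ ^ (p / q) * (ν (Iio t) ^ (-1 - 1 / q) *
          ∫⁻ u in Iio t, g u ^ p * ν (Iio u) ^ (1 / q) ∂ν) ∂ν := by
        refine lintegral_mono_ae ?_
        filter_upwards [hν.ae_pos] with t ht
        have hV0 := hν.ne_zero ht
        have hVt := hν.ne_top t
        have h1 : ∫⁻ u in Iio t, g u ∂ν = ∫⁻ u in Iio t,
            (g u * ν (Iio u) ^ (1 / (p * q))) * ν (Iio u) ^ (-(1 / (p * q))) ∂ν := by
          refine setLIntegral_congr_fun_ae measurableSet_Iio ?_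
          filter_upwards [hν.ae_pos] with u hu _
          rw [mul_assoc, ← ENNReal.rpow_add _ _ (hν.ne_zero hu) (hν.ne_top u), add_neg_cancel,
            ENNReal.rpow_zero, mul_one]
        have h2 : (∫⁻ u in Iio t, g u ∂ν) ^ p ≤
            (∫⁻ u in Iio t, g u ^ p * ν (Iio u) ^ (1 / q) ∂ν) *
              (c₁ * ν (Iio t) ^ (-(1 / p) + 1)) ^ (p / q) := by
          rw [h1]
          refine (lintegral_mul_rpow_le _ hpq (hg.fun_mul (hVm.pow_const _)).aemeasurable
            (hVm.pow_const _).aemeasurable).trans_eq ?_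
          refine congrArg₂ (· * ·) (lintegral_congr fun u => ?_) (congrArg (· ^ (p / q)) ?_)
          · rw [ENNReal.mul_rpow_of_nonneg _ _ hp.le, ← ENNReal.rpow_mul]
            congr 2
            field_simp
          · rw [show (c₁ : ℝ≥0∞) = ENNReal.ofReal (1 / (-(1 / p) + 1)) from rfl,
              ← hν.lintegral_Iio_rpow (x := t) (e := -(1 / p))
                (by have : 1 / p < 1 := by rw [div_lt_one hp]; exact hp1
                    linarith)]
            refine lintegral_congr fun u => ?_
            rw [← ENNReal.rpow_mul]
            congr 1
            field_simp
        rw [ENNReal.mul_rpow_of_nonneg _ _ hp.le, ENNReal.inv_rpow, ← ENNReal.rpow_neg]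
        refine (mul_le_mul_left h2 _).trans_eq ?_
        rw [ENNReal.mul_rpow_of_nonneg _ _ hpq0.le, ← ENNReal.rpow_mul, ← hexp,
          ENNReal.rpow_add _ _ hV0 hVt]
        ring
    _ = c₁ ^ (p / q) * ∫⁻ u, (g u ^ p * ν (Iio u) ^ (1 / q)) *
          ∫⁻ t in Ioi u, ν (Iio t) ^ (-1 - 1 / q) ∂ν ∂ν := by
        rw [lintegral_const_mul' _ _ hc₁, lintegral_mul_lintegral_Iio _ _ (hVm.pow_const _)
          ((hg.pow_const _).fun_mul (hVm.pow_const _))]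
    _ = c₁ ^ (p / q) * ∫⁻ u, c₂ * g u ^ p ∂ν := by
        congr 1
        refine lintegral_congr_ae ?_
        filter_upwards [hν.ae_pos] with u hu
        have hq' : 0 < 1 / q := by positivity
        rw [hν.lintegral_Ioi_rpow hu (by linarith),
          show ENNReal.ofReal (1 / (-(-1 - 1 / q) - 1)) = (c₂ : ℝ≥0∞) from rfl]
        calc _ = c₂ * g u ^ p * (ν (Iio u) ^ (1 / q) * ν (Iio u) ^ (-1 - 1 / q + 1)) := by ring
          _ = _ := by
            rw [← ENNReal.rpow_add _ _ (hν.ne_zero hu) (hν.ne_top u),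
              show 1 / q + (-1 - 1 / q + 1) = 0 by ring, ENNReal.rpow_zero, mul_one]
    _ = _ := by
        rw [lintegral_const_mul' _ _ ENNReal.coe_ne_top, ENNReal.coe_mul, mul_assoc,
          ENNReal.coe_rpow_of_nonneg _ hpq0.le]

/-- The dual Hardy inequality. -/
theorem IsWeight.hardy_Ioi (hν : IsWeight ν) {p q : ℝ} (hpq : p.HolderConjugate q) :
    ∃ C : ℝ≥0, ∀ h : ℝ → ℝ≥0∞, Measurable h →
      ∫⁻ x, (∫⁻ t in Ioi x, h t ∂ν) ^ p ∂ν ≤ C * ∫⁻ t, (h t * ν (Iio t)) ^ p ∂ν := by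
  have hp := hpq.pos
  have hq := hpq.symm.pos
  have hp1 := hpq.lt
  have hq1 := hpq.symm.lt
  have hinv := hpq.inv_add_inv_eq_one
  have hmul := hpq.mul_eq_add
  set c₁ : ℝ≥0 := (1 / (-(1 / p - q) - 1)).toNNReal
  set c₂ : ℝ≥0 := (1 / ((-1 + 1 / q) + 1)).toNNReal
  have hVm := measurable_measure_Iio ν
  refine ⟨c₁ ^ (p / q) * c₂, fun h hh => ?_⟩
  have hpq0 : 0 < p / q := by positivity
  have hexp : (1 / p - q + 1) * (p / q) = -1 + 1 / q := by
    field_simp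
    nlinarith
  have hlt : 1 / p - q < -1 := by
    have : 1 / p * p = 1 := one_div_mul_cancel hp.ne'
    have h1 : 1 / p < q - 1 := by
      rw [div_lt_iff₀ hp]
      nlinarith
    linarith
  have hc₁ : (c₁ : ℝ≥0∞) ^ (p / q) ≠ ∞ := ENNReal.rpow_ne_top_of_nonneg hpq0.le ENNReal.coe_ne_top
  calc ∫⁻ x, (∫⁻ t in Ioi x, h t ∂ν) ^ p ∂ν
      ≤ ∫⁻ x, c₁ ^ (p / q) * (ν (Iio x) ^ (-1 + 1 / q) *
          ∫⁻ t in Ioi x, (h t * ν (Iio t)) ^ p * ν (Iio t) ^ (-(1 / q)) ∂ν) ∂ν := by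
        refine lintegral_mono_ae ?_
        filter_upwards [hν.ae_pos] with x hx
        have h1 : ∫⁻ t in Ioi x, h t ∂ν = ∫⁻ t in Ioi x,
            (h t * ν (Iio t) * ν (Iio t) ^ (-(1 / (p * q)))) *
              ν (Iio t) ^ (1 / (p * q) - 1) ∂ν := by
          refine setLIntegral_congr_fun_ae measurableSet_Ioi ?_
          filter_upwards [hν.ae_pos] with u hu _
          rw [mul_assoc, ← ENNReal.rpow_add _ _ (hν.ne_zero hu) (hν.ne_top u), mul_assoc,
            show -(1 / (p * q)) + (1 / (p * q) - 1) = -1 by ring, ENNReal.rpow_neg_one,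
            ENNReal.mul_inv_cancel (hν.ne_zero hu) (hν.ne_top u), mul_one]
        rw [h1]
        refine (lintegral_mul_rpow_le _ hpq
          ((hh.fun_mul hVm).fun_mul (hVm.pow_const _)).aemeasurable (hVm.pow_const _).aemeasurable).trans_eq ?_
        have h2 : ∫⁻ t in Ioi x, (ν (Iio t) ^ (1 / (p * q) - 1)) ^ q ∂ν =
            c₁ * ν (Iio x) ^ (1 / p - q + 1) := by
          rw [show (c₁ : ℝ≥0∞) = ENNReal.ofReal (1 / (-(1 / p - q) - 1)) from rfl,
            ← hν.lintegral_Ioi_rpow hx hlt]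
          refine lintegral_congr fun u => ?_
          rw [← ENNReal.rpow_mul]
          congr 1
          field_simp
        rw [h2, ENNReal.mul_rpow_of_nonneg _ _ hpq0.le, ← ENNReal.rpow_mul, hexp, mul_left_comm,
          mul_comm (∫⁻ _ in _, _ ∂_)]
        congr 2
        refine lintegral_congr fun u => ?_
        rw [ENNReal.mul_rpow_of_nonneg _ _ hp.le, ← ENNReal.rpow_mul]
        congr 2
        field_simp
    _ = c₁ ^ (p / q) * ∫⁻ t, ((h t * ν (Iio t)) ^ p * ν (Iio t) ^ (-(1 / q))) *
          ∫⁻ x in Iio t, ν (Iio x) ^ (-1 + 1 / q) ∂ν ∂ν := by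
        rw [lintegral_const_mul' _ _ hc₁, ← lintegral_mul_lintegral_Iio _ _
          (((hh.fun_mul hVm).pow_const _).fun_mul (hVm.pow_const _)) (hVm.pow_const _)]
    _ = c₁ ^ (p / q) * ∫⁻ t, c₂ * (h t * ν (Iio t)) ^ p ∂ν := by
        congr 1
        refine lintegral_congr_ae ?_
        filter_upwards [hν.ae_pos] with u hu
        have hq' : 0 < 1 / q := by positivity
        rw [hν.lintegral_Iio_rpow (by linarith),
          show ENNReal.ofReal (1 / ((-1 + 1 / q) + 1)) = (c₂ : ℝ≥0∞) from rfl]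
        calc _ = c₂ * (h u * ν (Iio u)) ^ p *
              (ν (Iio u) ^ (-(1 / q)) * ν (Iio u) ^ (-1 + 1 / q + 1)) := by ring
          _ = _ := by
            rw [← ENNReal.rpow_add _ _ (hν.ne_zero hu) (hν.ne_top u),
              show -(1 / q) + (-1 + 1 / q + 1) = 0 by ring, ENNReal.rpow_zero, mul_one]
    _ = _ := by
        rw [lintegral_const_mul' _ _ ENNReal.coe_ne_top, ENNReal.coe_mul, mul_assoc,
          ENNReal.coe_rpow_of_nonneg _ hpq0.le]

end

/-! ### Functionals on decreasing functions -/

theorem iSup_rpow {ι : Sort*} (f : ι → ℝ≥0∞) {y : ℝ} (hy : 0 < y) :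
    (⨆ i, f i) ^ y = ⨆ i, f i ^ y :=
  (ENNReal.orderIsoRpow y hy).map_iSup f

/-- The truncation `min (f t) n` of `f` to `(-∞, n)`. -/
def trunc (f : ℝ → ℝ≥0∞) (n : ℕ) : ℝ → ℝ≥0∞ := (Iio (n : ℝ)).indicator fun t => min (f t) n

theorem measurable_trunc {f : ℝ → ℝ≥0∞} (hf : Measurable f) (n : ℕ) : Measurable (trunc f n) :=
  (hf.min measurable_const).indicator measurableSet_Iio

theorem trunc_le (f : ℝ → ℝ≥0∞) (n : ℕ) (t : ℝ) : trunc f n t ≤ f t :=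
  (indicator_le_self' (fun _ _ => zero_le) t).trans (min_le_left _ _)

theorem trunc_le_natCast (f : ℝ → ℝ≥0∞) (n : ℕ) (t : ℝ) : trunc f n t ≤ n :=
  (indicator_le_self' (fun _ _ => zero_le) t).trans (min_le_right _ _)

theorem trunc_of_le (f : ℝ → ℝ≥0∞) (n : ℕ) {t : ℝ} (h : n ≤ t) : trunc f n t = 0 :=
  indicator_of_notMem (by simpa using h) _

theorem trunc_mono (f : ℝ → ℝ≥0∞) : Monotone (trunc f) := by
  intro i j hij t
  simp only [trunc, indicator, mem_Iio]
  have : (i : ℝ) ≤ j := by exact_mod_cast hij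
  split_ifs with h1 h2
  · gcongr
  · exact absurd (h1.trans_le this) h2
  · exact zero_le
  · exact le_rfl

theorem trunc_le_trunc {f g : ℝ → ℝ≥0∞} (n : ℕ) {t : ℝ} (h : f t ≤ g t) :
    trunc f n t ≤ trunc g n t :=
  indicator_le_indicator (min_le_min h le_rfl)

theorem antitone_trunc {f : ℝ → ℝ≥0∞} (hf : Antitone f) (n : ℕ) : Antitone (trunc f n) := by
  intro x y hxy
  simp only [trunc, indicator, mem_Iio]
  split_ifs with h1 h2
  · exact min_le_min (hf hxy) le_rfl
  · exact absurd (hxy.trans_lt h1) h2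
  · exact zero_le
  · exact le_rfl

theorem iSup_trunc (f : ℝ → ℝ≥0∞) (t : ℝ) : ⨆ n, trunc f n t = f t := by
  refine le_antisymm (iSup_le fun n => trunc_le f n t) (le_of_forall_lt fun c hc => ?_)
  obtain ⟨n₁, hn₁⟩ := exists_nat_gt t
  obtain ⟨n₂, hn₂⟩ := ENNReal.exists_nat_gt (ne_top_of_lt hc)
  refine lt_of_lt_of_le ?_ (le_iSup (fun n => trunc f n t) (max n₁ n₂))
  have h1 : t < ((max n₁ n₂ : ℕ) : ℝ) := hn₁.trans_le (by exact_mod_cast le_max_left _ _)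
  simp only [trunc, indicator, mem_Iio, if_pos h1]
  exact lt_min hc (hn₂.trans_le (by exact_mod_cast le_max_right _ _))

theorem lintegral_trunc_rpow_le (ν : Measure ℝ) (f : ℝ → ℝ≥0∞) (n : ℕ) {q : ℝ} (hq : 0 < q) :
    ∫⁻ t, trunc f n t ^ q ∂ν ≤ (n : ℝ≥0∞) ^ q * ν (Iio n) := by
  rw [← setLIntegral_const, ← lintegral_indicator measurableSet_Iio]
  refine lintegral_mono fun t => ?_
  by_cases h : t < n
  · rw [indicator_of_mem (show t ∈ Iio (n : ℝ) from h)]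
    exact ENNReal.rpow_le_rpow (trunc_le_natCast f n t) hq.le
  · rw [trunc_of_le f n (not_lt.1 h), ENNReal.zero_rpow_of_pos hq]
    exact zero_le

theorem mul_rpow_inv_le_of_le {w K X : ℝ≥0∞} {p q : ℝ} (hpq : p.HolderConjugate q)
    (hX : X ≠ ∞) (h : w * X ≤ K * X ^ (1 / p)) : w * X ^ (1 / q) ≤ K := by
  have hp := hpq.pos
  have hq := hpq.symm.pos
  have hinv := hpq.inv_add_inv_eq_one
  rcases eq_or_ne X 0 with h0 | h0
  · rw [h0, ENNReal.zero_rpow_of_pos (by positivity), mul_zero]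
    exact zero_le
  · calc w * X ^ (1 / q) = w * X * X ^ (-(1 / p)) := by
          rw [mul_assoc]
          congr 1
          nth_rw 2 [← ENNReal.rpow_one X]
          rw [← ENNReal.rpow_add _ _ h0 hX]
          congr 1
          simp only [one_div]
          linarith
      _ ≤ K * X ^ (1 / p) * X ^ (-(1 / p)) := by gcongr
      _ = K := by
          rw [mul_assoc, ← ENNReal.rpow_add _ _ h0 hX, add_neg_cancel, ENNReal.rpow_zero, mul_one]

theorem measure_le_of_isLowerSet {M ν : Measure ℝ} {R : ℝ≥0∞} {q : ℝ} (hq : 0 ≤ q)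
    (h : ∀ x, M (Iic x) ≤ R * ν (Iio x) ^ q) {S : Set ℝ} (hS : IsLowerSet S) :
    M S ≤ R * ν S ^ q := by
  rcases S.eq_empty_or_nonempty with rfl | hne
  · simp
  by_cases hb : BddAbove S
  · have h1 : Iio (sSup S) ⊆ S := fun t ht => by
      obtain ⟨y, hy, hty⟩ := exists_lt_of_lt_csSup hne ht
      exact hS hty.le hy
    calc M S ≤ M (Iic (sSup S)) := measure_mono fun t ht => le_csSup hb ht
      _ ≤ R * ν (Iio (sSup S)) ^ q := h _
      _ ≤ R * ν S ^ q := by gcongr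
  · have h1 : S = univ := eq_univ_of_forall fun x => by
      obtain ⟨y, hy, hxy⟩ := not_bddAbove_iff.1 hb x
      exact hS hxy.le hy
    have h2 : univ = ⋃ n : ℕ, Iic (n : ℝ) := by
      rw [eq_comm, eq_univ_iff_forall]
      intro x
      obtain ⟨n, hn⟩ := exists_nat_ge x
      exact mem_iUnion.2 ⟨n, hn⟩
    rw [h1]
    nth_rw 1 [h2]
    rw [Monotone.measure_iUnion fun i j hij => Iic_subset_Iic.2 (by exact_mod_cast hij)]
    refine iSup_le fun n => (h n).trans ?_
    gcongr
    exact subset_univ _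

/-- An embedding of decreasing functions of `L¹(ν)` into `L^q(M)`, `q ≥ 1`. -/
theorem lintegral_rpow_le_of_antitone {M ν : Measure ℝ} {R : ℝ≥0∞} {q : ℝ} (hq : 1 ≤ q)
    (h : ∀ x, M (Iic x) ≤ R * ν (Iio x) ^ q) {f : ℝ → ℝ≥0∞} (hf : Antitone f) :
    ∫⁻ x, f x ^ q ∂M ≤ ENNReal.ofReal q * R * (∫⁻ x, f x ∂ν) ^ q := by
  have hq0 : 0 < q := by linarith
  have hfin : ∀ g : ℝ → ℝ≥0∞, Antitone g → (∀ x, g x ≠ ∞) →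
      ∫⁻ x, g x ^ q ∂M ≤ ENNReal.ofReal q * R * (∫⁻ x, g x ∂ν) ^ q := by
    intro g hg hgt
    set φ : ℝ → ℝ := fun x => (g x).toReal with hφ
    have hφm : Measurable φ := hg.measurable.ennreal_toReal
    have h0 : ∀ x, 0 ≤ φ x := fun x => ENNReal.toReal_nonneg
    have hφg : ∀ x, ENNReal.ofReal (φ x) = g x := fun x => ENNReal.ofReal_toReal (hgt x)
    have h1 : ∫⁻ x, g x ^ q ∂M = ∫⁻ x, ENNReal.ofReal (φ x ^ q) ∂M := by
      refine lintegral_congr fun x => ?_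
      rw [← ENNReal.ofReal_rpow_of_nonneg (h0 x) hq0.le, hφg]
    have h2 : ∫⁻ x, g x ∂ν = ∫⁻ t in Ioi (0 : ℝ), ν {x | t < φ x} := by
      rw [← lintegral_eq_lintegral_meas_lt ν (Filter.Eventually.of_forall h0) hφm.aemeasurable]
      exact lintegral_congr fun x => (hφg x).symm
    have hanti : Antitone φ := fun x y hxy => ENNReal.toReal_mono (hgt x) (hg hxy)
    rw [h1, lintegral_rpow_eq_lintegral_meas_lt_mul M (Filter.Eventually.of_forall h0)
      hφm.aemeasurable hq0, mul_assoc]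
    gcongr
    set I := ∫⁻ x, g x ∂ν with hI
    calc ∫⁻ t in Ioi (0 : ℝ), M {a | t < φ a} * ENNReal.ofReal (t ^ (q - 1))
        ≤ ∫⁻ t in Ioi (0 : ℝ), (R * I ^ (q - 1)) * ν {a | t < φ a} := by
          refine setLIntegral_mono' measurableSet_Ioi fun t (ht : 0 < t) => ?_
          have hmarkov : ENNReal.ofReal t * ν {a | t < φ a} ≤ I := by
            refine le_trans ?_ (mul_meas_ge_le_lintegral hg.measurable (ENNReal.ofReal t))
            gcongr
            refine fun hlt => ?_
            rw [← hφg]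
            exact ENNReal.ofReal_le_ofReal hlt.le
          calc M {a | t < φ a} * ENNReal.ofReal (t ^ (q - 1))
              ≤ R * ν {a | t < φ a} ^ q * ENNReal.ofReal t ^ (q - 1) := by
                rw [ENNReal.ofReal_rpow_of_pos ht]
                gcongr
                exact measure_le_of_isLowerSet hq0.le h
                  fun x y hyx (hx : t < φ x) => hx.trans_le (hanti hyx)
            _ = R * (ENNReal.ofReal t * ν {a | t < φ a}) ^ (q - 1) * ν {a | t < φ a} := by
                rw [ENNReal.mul_rpow_of_nonneg _ _ (by linarith)]
                have : ν {a | t < φ a} ^ q = ν {a | t < φ a} ^ (q - 1) * ν {a | t < φ a} := by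
                  conv_rhs => rw [← ENNReal.rpow_one (ν {a | t < φ a}), ← ENNReal.rpow_mul,
                    ← ENNReal.rpow_add_of_nonneg _ _ (by linarith) zero_le_one]
                  congr 1
                  ring
                rw [this]
                ring
            _ ≤ _ := by gcongr
      _ = R * I ^ (q - 1) * I := by
          rw [lintegral_const_mul, ← h2]
          exact Antitone.measurable fun x y hxy =>
            measure_mono fun a (ha : y < φ a) => lt_of_le_of_lt hxy ha
      _ = R * I ^ q := by
          rw [mul_assoc]
          congr 1
          nth_rw 2 [← ENNReal.rpow_one I]
          rw [← ENNReal.rpow_add_of_nonneg _ _ (by linarith) zero_le_one, sub_add_cancel]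
  have hsup : ∀ x, f x = ⨆ n : ℕ, min (f x) n := by
    intro x
    rw [← inf_iSup_eq, ENNReal.iSup_natCast, inf_top_eq]
  have hanti : ∀ n : ℕ, Antitone fun x => min (f x) (n : ℝ≥0∞) := fun n =>
    hf.min antitone_const
  have h1 : ∫⁻ x, f x ^ q ∂M = ⨆ n : ℕ, ∫⁻ x, min (f x) n ^ q ∂M := by
    rw [← lintegral_iSup (fun n => (hanti n).measurable.pow_const _)]
    · refine lintegral_congr fun x => ?_
      rw [← iSup_rpow _ hq0, ← hsup]
    · intro i j hij x
      beta_reduce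
      gcongr
  rw [h1]
  refine iSup_le fun n => (hfin _ (hanti n) fun x =>
    ne_top_of_le_ne_top (ENNReal.natCast_ne_top n) (min_le_right _ _)).trans ?_
  gcongr
  exact min_le_left _ _

section

variable {ν : Measure ℝ} [SFinite ν] [NullSingletonClass ν]

/-- Sawyer's upper bound for an integral functional on decreasing functions. -/
theorem IsWeight.sawyer_upper (hν : IsWeight ν) {p q : ℝ} (hpq : p.HolderConjugate q) :
    ∃ C : ℝ≥0, ∀ (M : Measure ℝ) [SFinite M], M (Iic 0) = 0 → ∀ g : ℝ → ℝ≥0∞, Antitone g →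
      ∫⁻ x, g x ∂M ≤ C * (∫⁻ t, g t ^ p ∂ν) ^ (1 / p) *
        (∫⁻ t, (M (Iio t) * (ν (Iio t))⁻¹) ^ q ∂ν) ^ (1 / q) := by
  obtain ⟨C, hC⟩ := hν.hardy_Iio hpq
  have hp := hpq.pos
  have hp' : 0 ≤ 1 / p := by positivity
  have hVm := measurable_measure_Iio ν
  refine ⟨C ^ (1 / p), fun M _ hM g hg => ?_⟩
  have hMm := measurable_measure_Iio M
  have hGm := measurable_lintegral_Iio ν g
  have key : ∀ x, 0 < x →
      g x ≤ ∫⁻ t in Ioi x, ν (Iio t) ^ (-2 : ℝ) * ∫⁻ u in Iio t, g u ∂ν ∂ν := by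
    intro x hx
    have h1 : ∀ t ∈ Ioi x, g x * ν (Iio x) ≤ ∫⁻ u in Iio t, g u ∂ν := fun t ht => by
      calc g x * ν (Iio x) = ∫⁻ _ in Iio x, g x ∂ν := by simp
        _ ≤ ∫⁻ u in Iio x, g u ∂ν := setLIntegral_mono' measurableSet_Iio
            fun u hu => hg (le_of_lt hu)
        _ ≤ _ := lintegral_mono_set (Iio_subset_Iio (le_of_lt ht))
    calc g x = (∫⁻ t in Ioi x, ν (Iio t) ^ (-2 : ℝ) ∂ν) * (g x * ν (Iio x)) := by
          rw [hν.lintegral_Ioi_rpow hx (by norm_num)]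
          norm_num
          rw [ENNReal.rpow_neg_one, mul_left_comm, ENNReal.inv_mul_cancel (hν.ne_zero hx)
            (hν.ne_top x), mul_one]
      _ = ∫⁻ t in Ioi x, ν (Iio t) ^ (-2 : ℝ) * (g x * ν (Iio x)) ∂ν := by
          rw [lintegral_mul_const _ (hVm.pow_const _)]
      _ ≤ _ := setLIntegral_mono' measurableSet_Ioi fun t ht => by gcongr; exact h1 t ht
  calc ∫⁻ x, g x ∂M
      ≤ ∫⁻ x, 1 * ∫⁻ t in Ioi x, ν (Iio t) ^ (-2 : ℝ) * ∫⁻ u in Iio t, g u ∂ν ∂ν ∂M := by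
        refine lintegral_mono_ae ?_
        filter_upwards [ae_pos_of_null hM] with x hx
        rw [one_mul]
        exact key x hx
    _ = ∫⁻ t, (ν (Iio t) ^ (-2 : ℝ) * ∫⁻ u in Iio t, g u ∂ν) * ∫⁻ _ in Iio t, 1 ∂M ∂ν :=
        (lintegral_mul_lintegral_Iio M ν ((hVm.pow_const _).fun_mul hGm) measurable_const).symm
    _ = ∫⁻ t, ((∫⁻ u in Iio t, g u ∂ν) * (ν (Iio t))⁻¹) * (M (Iio t) * (ν (Iio t))⁻¹) ∂ν := by
        refine lintegral_congr_ae ?_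
        filter_upwards [hν.ae_pos] with t ht
        rw [show (-2 : ℝ) = -1 + -1 by norm_num,
          ENNReal.rpow_add _ _ (hν.ne_zero ht) (hν.ne_top t), ENNReal.rpow_neg_one]
        simp only [lintegral_const, one_mul, Measure.restrict_apply_univ]
        ring
    _ ≤ _ := ENNReal.lintegral_mul_le_Lp_mul_Lq ν hpq (hGm.fun_mul hVm.inv).aemeasurable
        (hMm.fun_mul hVm.inv).aemeasurable
    _ ≤ _ := by
        gcongr
        rw [ENNReal.coe_rpow_of_nonneg _ hp', ← ENNReal.mul_rpow_of_nonneg _ _ hp']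
        exact ENNReal.rpow_le_rpow (hC g hg.measurable) hp'

/-- Sawyer's lower bound for an integral functional on decreasing functions. -/
theorem IsWeight.sawyer_lower (hν : IsWeight ν) {p q : ℝ} (hpq : p.HolderConjugate q) :
    ∃ C : ℝ≥0, ∀ (M : Measure ℝ) [SFinite M] (w K : ℝ≥0∞),
      (∀ g : ℝ → ℝ≥0∞, Antitone g → w * ∫⁻ x, g x ∂M ≤ K * (∫⁻ t, g t ^ p ∂ν) ^ (1 / p)) →
      w * (∫⁻ t, (M (Iio t) * (ν (Iio t))⁻¹) ^ q ∂ν) ^ (1 / q) ≤ C * K := by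
  obtain ⟨C, hC⟩ := hν.hardy_Ioi hpq
  have hp := hpq.pos
  have hq := hpq.symm.pos
  have hq1 := hpq.symm.lt
  have hmul := hpq.mul_eq_add
  have hp' : 0 ≤ 1 / p := by positivity
  have hq' : 0 < 1 / q := by positivity
  have hVm := measurable_measure_Iio ν
  refine ⟨C ^ (1 / p), fun M _ w K H => ?_⟩
  have hMm := measurable_measure_Iio M
  set k : ℕ → ℝ → ℝ≥0∞ := trunc fun t => M (Iio t) * (ν (Iio t))⁻¹ with hk
  have hkm : ∀ n, Measurable (k n) := measurable_trunc (hMm.fun_mul hVm.inv)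
  have hkle : ∀ n t, k n t ≤ M (Iio t) * (ν (Iio t))⁻¹ := trunc_le _
  have hkmono : Monotone k := trunc_mono _
  have hksup : ∀ t, ⨆ n, k n t = M (Iio t) * (ν (Iio t))⁻¹ := iSup_trunc _
  have hX : ∀ n, ∫⁻ t, k n t ^ q ∂ν ≠ ∞ := fun n =>
    ne_top_of_le_ne_top (ENNReal.mul_ne_top (ENNReal.rpow_ne_top_of_nonneg hq.le
      (ENNReal.natCast_ne_top n)) (hν.ne_top _)) (lintegral_trunc_rpow_le ν _ n hq)
  have main : ∀ n, w * (∫⁻ t, k n t ^ q ∂ν) ^ (1 / q) ≤ (C : ℝ≥0∞) ^ (1 / p) * K := by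
    intro n
    apply mul_rpow_inv_le_of_le hpq (hX n)
    set h : ℝ → ℝ≥0∞ := fun t => k n t ^ (q - 1) * (ν (Iio t))⁻¹ with hh
    have hhm : Measurable h := ((hkm n).pow_const _).fun_mul hVm.inv
    have h1 : ∫⁻ t, k n t ^ q ∂ν ≤ ∫⁻ x, ∫⁻ t in Ioi x, h t ∂ν ∂M := by
      calc ∫⁻ t, k n t ^ q ∂ν ≤ ∫⁻ t, h t * ∫⁻ _ in Iio t, 1 ∂M ∂ν := by
            refine lintegral_mono fun t => ?_
            simp only [lintegral_const, one_mul, Measure.restrict_apply_univ, hh]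
            calc k n t ^ q = k n t ^ (q - 1) * k n t := by
                  nth_rw 3 [← ENNReal.rpow_one (k n t)]
                  rw [← ENNReal.rpow_add_of_nonneg _ _ (by linarith) zero_le_one, sub_add_cancel]
              _ ≤ k n t ^ (q - 1) * (M (Iio t) * (ν (Iio t))⁻¹) := by gcongr; exact hkle n t
              _ = _ := by ring
        _ = ∫⁻ x, 1 * ∫⁻ t in Ioi x, h t ∂ν ∂M :=
            lintegral_mul_lintegral_Iio M ν hhm measurable_const
        _ = _ := by simp
    have h2 : ∫⁻ x, (∫⁻ t in Ioi x, h t ∂ν) ^ p ∂ν ≤ C * ∫⁻ t, k n t ^ q ∂ν := by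
      refine (hC h hhm).trans_eq ?_
      congr 1
      refine lintegral_congr_ae ?_
      filter_upwards [hν.ae_pos] with t ht
      rw [hh]
      beta_reduce
      rw [mul_assoc, ENNReal.inv_mul_cancel (hν.ne_zero ht) (hν.ne_top t), mul_one,
        ← ENNReal.rpow_mul]
      congr 1
      nlinarith
    calc w * ∫⁻ t, k n t ^ q ∂ν ≤ w * ∫⁻ x, ∫⁻ t in Ioi x, h t ∂ν ∂M := by gcongr
      _ ≤ K * (∫⁻ x, (∫⁻ t in Ioi x, h t ∂ν) ^ p ∂ν) ^ (1 / p) :=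
          H _ fun _ _ hxy => lintegral_mono_set (Ioi_subset_Ioi hxy)
      _ ≤ K * (C * ∫⁻ t, k n t ^ q ∂ν) ^ (1 / p) := by gcongr
      _ = _ := by
          rw [ENNReal.mul_rpow_of_nonneg _ _ hp']
          ring
  have hsup : ∫⁻ t, (M (Iio t) * (ν (Iio t))⁻¹) ^ q ∂ν = ⨆ n, ∫⁻ t, k n t ^ q ∂ν := by
    rw [← lintegral_iSup (fun n => (hkm n).pow_const _)
      (fun i j hij t => ENNReal.rpow_le_rpow (hkmono hij t) hq.le)]
    refine lintegral_congr fun t => ?_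
    rw [← hksup, iSup_rpow _ hq]
  rw [hsup, iSup_rpow _ hq', ENNReal.mul_iSup, ENNReal.coe_rpow_of_nonneg _ hp']
  exact iSup_le main

end

/-! ### The measure `dt / t` -/

/-- The measure `dt / t` on `(0, ∞)`. -/
def logMeasure : Measure ℝ := (volume.restrict (Ioi (0 : ℝ))).withDensity fun t => pw t (-1)

/-- The function `log⁺ (t / x)`. -/
def logK (x t : ℝ) : ℝ≥0∞ := ENNReal.ofReal (Real.log (t / x))

instance : SFinite logMeasure := inferInstanceAs (SFinite (Measure.withDensity _ _))

instance : NullSingletonClass logMeasure :=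
  inferInstanceAs (NullSingletonClass (Measure.withDensity _ _))

theorem measurable_pw (α : ℝ) : Measurable fun t => pw t α :=
  ENNReal.measurable_ofReal.pow_const _

theorem pw_ne_zero {t : ℝ} (ht : 0 < t) (α : ℝ) : pw t α ≠ 0 := by
  rw [pw, ENNReal.ofReal_rpow_of_pos ht]
  simpa using Real.rpow_pos_of_pos ht α

theorem pw_ne_top {t : ℝ} (ht : 0 < t) (α : ℝ) : pw t α ≠ ∞ := by
  rw [pw, ENNReal.ofReal_rpow_of_pos ht]
  exact ENNReal.ofReal_ne_top

theorem logMeasure_Iic : logMeasure (Iic 0) = 0 := by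
  refine withDensity_absolutelyContinuous _ _ ?_
  rw [Measure.restrict_apply measurableSet_Iic, Iic_inter_Ioi, Ioc_self, measure_empty]

theorem lintegral_logMeasure (g : ℝ → ℝ≥0∞) :
    ∫⁻ t, g t ∂logMeasure = ∫⁻ t in Ioi 0, pw t (-1) * g t := by
  rw [logMeasure, lintegral_withDensity_eq_lintegral_mul_non_measurable _ (measurable_pw _)]
  · rfl
  · exact (ae_restrict_iff' measurableSet_Ioi).2
      (Filter.Eventually.of_forall fun t ht => (pw_ne_top ht _).lt_top)

theorem logMeasure_restrict {s : Set ℝ} (hs : MeasurableSet s) (h0 : s ⊆ Ioi 0) :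
    logMeasure.restrict s = (volume.restrict s).withDensity fun t => pw t (-1) := by
  rw [logMeasure, restrict_withDensity hs, Measure.restrict_restrict hs, inter_eq_left.2 h0]

theorem setLIntegral_logMeasure {s : Set ℝ} (hs : MeasurableSet s) (h0 : s ⊆ Ioi 0)
    (g : ℝ → ℝ≥0∞) : ∫⁻ t in s, g t ∂logMeasure = ∫⁻ t in s, pw t (-1) * g t := by
  rw [logMeasure_restrict hs h0,
    lintegral_withDensity_eq_lintegral_mul_non_measurable _ (measurable_pw _)]
  · rfl
  · exact (ae_restrict_iff' hs).2
      (Filter.Eventually.of_forall fun t ht => (pw_ne_top (h0 ht) _).lt_top)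

theorem logMeasure_Ioo {x t : ℝ} (hx : 0 < x) (ht : 0 < t) : logMeasure (Ioo x t) = logK x t := by
  rw [← setLIntegral_one, setLIntegral_logMeasure measurableSet_Ioo fun u hu => hx.trans hu.1]
  rcases le_or_gt t x with h | h
  · rw [Ioo_eq_empty (not_lt.2 h), logK, ENNReal.ofReal_of_nonpos]
    · simp
    · exact Real.log_nonpos (by positivity) ((div_le_one hx).2 h)
  · have h1 : ∫⁻ u in Ioo x t, pw u (-1) * 1 = ∫⁻ u in Ioo x t, ENNReal.ofReal u⁻¹ := by
      refine setLIntegral_congr_fun measurableSet_Ioo fun u hu => ?_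
      rw [mul_one, pw, ENNReal.rpow_neg_one, ENNReal.ofReal_inv_of_pos (hx.trans hu.1)]
    have hint : IntegrableOn (fun u : ℝ => u⁻¹) (Ioo x t) := by
      rw [← intervalIntegrable_iff_integrableOn_Ioo_of_le h.le]
      exact intervalIntegral.intervalIntegrable_inv
        (fun u hu => by rw [uIcc_of_le h.le] at hu; exact (hx.trans_le hu.1).ne') continuousOn_id
    rw [h1, ← ofReal_integral_eq_lintegral_ofReal hint
      ((ae_restrict_iff' measurableSet_Ioo).2 (Filter.Eventually.of_forall fun u hu =>
        inv_nonneg.2 (hx.trans hu.1).le)), ← integral_Ioc_eq_integral_Ioo,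
      ← intervalIntegral.integral_of_le h.le, integral_inv_of_pos hx ht, logK]

theorem logK_mono {x t t' : ℝ} (hx : 0 < x) (ht : 0 < t) (h : t ≤ t') : logK x t ≤ logK x t' := by
  rw [← logMeasure_Ioo hx ht, ← logMeasure_Ioo hx (ht.trans_le h)]
  exact measure_mono (Ioo_subset_Ioo_right h)

theorem logK_anti {x x' t : ℝ} (hx : 0 < x) (ht : 0 < t) (h : x ≤ x') : logK x' t ≤ logK x t := by
  rw [← logMeasure_Ioo hx ht, ← logMeasure_Ioo (hx.trans_le h) ht]
  exact measure_mono (Ioo_subset_Ioo_left h)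

theorem logK_ne_top (x t : ℝ) : logK x t ≠ ∞ := ENNReal.ofReal_ne_top

theorem logK_ne_zero {x t : ℝ} (hx : 0 < x) (h : x < t) : logK x t ≠ 0 := by
  rw [logK, Ne, ENNReal.ofReal_eq_zero, not_le]
  exact Real.log_pos ((one_lt_div hx).2 h)

theorem logK_eq_zero {x t : ℝ} (ht : 0 < t) (h : t ≤ x) : logK x t = 0 := by
  rw [← logMeasure_Ioo (ht.trans_le h) ht, Ioo_eq_empty (not_lt.2 h), measure_empty]

theorem measurable_logK : Measurable fun p : ℝ × ℝ => logK p.1 p.2 :=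
  (Real.measurable_log.comp (measurable_snd.div measurable_fst)).ennreal_ofReal

/-! ### Discretization -/

theorem setLIntegral_Ioi_eq_add {m : Measure ℝ} [NullSingletonClass m] (f : ℝ → ℝ≥0∞) {x y : ℝ}
    (h : x ≤ y) : ∫⁻ u in Ioi x, f u ∂m = ∫⁻ u in Ioo x y, f u ∂m + ∫⁻ u in Ioi y, f u ∂m := by
  have h2 : ∫⁻ u in Ioo x y, f u ∂m = ∫⁻ u in Ioc x y, f u ∂m :=
    setLIntegral_congr Ioo_ae_eq_Ioc
  rw [h2, ← lintegral_union measurableSet_Ioi (by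
    rw [disjoint_left]; intro u h1 h2; exact not_lt.2 h1.2 h2), Ioc_union_Ioi_eq_Ioi h]

theorem exists_discretization {f : ℝ → ℝ≥0∞} (hf : Antitone f) {B : ℝ≥0∞} (hB : B ≠ ∞)
    (hfB : ∀ t, f t ≤ B) {N : ℝ} (hN : ∀ t, N ≤ t → f t = 0) {t₀ : ℝ} (ht₀ : 0 < t₀)
    (hft₀ : f t₀ ≠ 0) :
    ∃ (t : ℤ → ℝ) (Δ : ℤ → Set ℝ), (∀ k, 0 < t k) ∧ StrictMono t ∧ (∀ k, MeasurableSet (Δ k)) ∧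
      Pairwise (Function.onFun Disjoint Δ) ∧ (∀ k, Δ k ⊆ Ioo (t (k - 2)) (t k)) ∧
      (∀ u, 0 < u → ∫⁻ v in Ioi u, f v ∂logMeasure ≠ 0 → ∃ k, u ∈ Δ k) ∧
      ∀ k, ∀ u ∈ Δ k, ∫⁻ v in Ioi u, f v ∂logMeasure ≤
        4 * ∫⁻ v in Ioo (t k) (t (k + 1)), f v ∂logMeasure := by
  set F : ℝ → ℝ≥0∞ := fun t => ∫⁻ v in Ioi t, f v ∂logMeasure with hF
  have hFanti : Antitone F := fun x y hxy => lintegral_mono_set (Ioi_subset_Ioi hxy)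
  have hF0 : ∀ y, N ≤ y → F y = 0 := fun y hy => by
    rw [hF]
    beta_reduce
    rw [setLIntegral_congr_fun (g := fun _ => 0) measurableSet_Ioi
      fun u (hu : y < u) => hN u (hy.trans hu.le)]
    simp
  have hsplit : ∀ {x y : ℝ}, x ≤ y → F x = ∫⁻ u in Ioo x y, f u ∂logMeasure + F y :=
    fun h => setLIntegral_Ioi_eq_add f h
  have hfinI : ∀ {x y : ℝ}, 0 < x → 0 < y → ∫⁻ u in Ioo x y, f u ∂logMeasure ≠ ∞ := by
    intro x y hx hy
    refine ne_top_of_le_ne_top ?_ (setLIntegral_mono' (g := fun _ => B) measurableSet_Ioo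
      fun u _ => hfB u)
    rw [setLIntegral_const, logMeasure_Ioo hx hy]
    exact ENNReal.mul_ne_top hB (logK_ne_top _ _)
  have hFfin : ∀ x, 0 < x → F x ≠ ∞ := by
    intro x hx
    rw [hsplit (le_max_left x N), hF0 _ (le_max_right x N), add_zero]
    exact hfinI hx (hx.trans_le (le_max_left x N))
  have hlarge : ∀ c : ℝ≥0∞, c ≠ ∞ → ∃ x, 0 < x ∧ c ≤ F x := by
    intro c hc
    have hft : f t₀ ≠ ∞ := ne_top_of_le_ne_top hB (hfB t₀)
    set y := (c / f t₀).toReal with hy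
    have hx : 0 < t₀ * Real.exp (-y) := by positivity
    refine ⟨t₀ * Real.exp (-y), hx, ?_⟩
    have hy0 : 0 ≤ y := ENNReal.toReal_nonneg
    calc c = f t₀ * (c / f t₀) := (ENNReal.mul_div_cancel hft₀ hft).symm
      _ = f t₀ * logMeasure (Ioo (t₀ * Real.exp (-y)) t₀) := by
          rw [logMeasure_Ioo hx ht₀, logK, div_mul_cancel_left₀ ht₀.ne', ← Real.exp_neg, neg_neg,
            Real.log_exp, hy, ENNReal.ofReal_toReal (ENNReal.div_ne_top hc hft₀)]
      _ = ∫⁻ _ in Ioo (t₀ * Real.exp (-y)) t₀, f t₀ ∂logMeasure := by rw [setLIntegral_const]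
      _ ≤ ∫⁻ u in Ioo (t₀ * Real.exp (-y)) t₀, f u ∂logMeasure :=
          setLIntegral_mono' measurableSet_Ioo fun u hu => hf hu.2.le
      _ ≤ _ := lintegral_mono_set fun u hu => hu.1
  have hatt : ∀ c : ℝ≥0∞, c ≠ 0 → c ≠ ∞ → ∃ x, 0 < x ∧ F x = c := by
    intro c hc0 hc
    obtain ⟨α, hα, hcα⟩ := hlarge c hc
    set β := max α N with hβ
    have hαβ : α ≤ β := le_max_left _ _
    have hFα : F α = ∫⁻ u in Ioo α β, f u ∂logMeasure := by
      rw [hsplit hαβ, hF0 _ (le_max_right _ _), add_zero]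
    set m := logMeasure.withDensity f with hm
    have hmI : ∀ x y, m (Ioo x y) = ∫⁻ u in Ioo x y, f u ∂logMeasure :=
      fun x y => withDensity_apply _ measurableSet_Ioo
    obtain ⟨y, hy, hyc⟩ := exists_measure_Ioo_eq m hαβ
      (by rw [hmI]; exact hfinI hα (hα.trans_le hαβ)) (c := F α - c)
      (by rw [hmI, ← hFα]; exact tsub_le_self)
    refine ⟨y, hα.trans_le hy.1, ?_⟩
    have h1 := hsplit hy.1
    rw [← hmI, hyc] at h1
    have h2 : F α - c + c = F α := tsub_add_cancel_of_le hcα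
    have hne : F α - c ≠ ∞ := ne_top_of_le_ne_top (hFfin α hα) tsub_le_self
    exact (ENNReal.add_right_inj hne).1 (h1.symm.trans h2.symm)
  set c : ℤ → ℝ≥0∞ := fun k => (2 : ℝ≥0∞) ^ (-k) with hc
  have h2' : (2 : ℝ≥0∞) ≠ 0 := two_ne_zero
  have h2t : (2 : ℝ≥0∞) ≠ ∞ := ENNReal.ofNat_ne_top
  have hc0 : ∀ k, c k ≠ 0 := fun k => (ENNReal.zpow_pos h2' h2t _).ne'
  have hct : ∀ k, c k ≠ ∞ := fun k => (ENNReal.zpow_lt_top h2' h2t _).ne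
  have hcs : ∀ k, c k = 2 * c (k + 1) := fun k => by
    rw [hc]
    beta_reduce
    rw [show -k = 1 + -(k + 1) by ring, ENNReal.zpow_add h2' h2t, zpow_one]
  have hclt : ∀ k, c (k + 1) < c k := fun k => by
    rw [hcs k, two_mul]
    exact ENNReal.lt_add_right (hct _) (hc0 _)
  choose t ht0 htF using fun k => hatt (c k) (hc0 k) (hct k)
  have hmono : StrictMono t := strictMono_int_of_lt_succ fun k => by
    by_contra h
    have := hFanti (not_lt.1 h)
    rw [htF, htF] at this
    exact absurd (hclt k) (not_lt.2 this)
  have hcanti : ∀ {j k}, j ≤ k → c k ≤ c j := fun {j k} h => by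
    rw [← htF, ← htF]
    exact hFanti (hmono.monotone h)
  refine ⟨t, fun k => F ⁻¹' Ioc (c k) (2 * c k) ∩ Ioi 0, ht0, hmono,
    fun k => (hFanti.measurable measurableSet_Ioc).inter measurableSet_Ioi, ?_, ?_, ?_, ?_⟩
  · have key : ∀ j k, j < k → ∀ u, u ∈ F ⁻¹' Ioc (c j) (2 * c j) ∩ Ioi 0 →
        u ∉ F ⁻¹' Ioc (c k) (2 * c k) ∩ Ioi 0 := by
      intro j k hjk u hu hu'
      have h1 : c j < 2 * c k := hu.1.1.trans_le hu'.1.2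
      rw [hcs j] at h1
      exact absurd (hcanti (Int.add_one_le_iff.2 hjk)) (not_le.2 (lt_of_mul_lt_mul_left' h1))
    intro j k hjk
    refine disjoint_left.2 fun u hu hu' => ?_
    rcases lt_or_gt_of_ne hjk with h | h
    · exact key j k h u hu hu'
    · exact key k j h u hu' hu
  · intro k u hu
    constructor
    · by_contra h
      have h1 := hFanti (not_lt.1 h)
      rw [htF, hcs, show k - 2 + 1 = k - 1 by ring] at h1
      have h2 := hclt (k - 1)
      rw [sub_add_cancel] at h2
      have h3 : 2 * c k < 2 * c (k - 1) := ENNReal.mul_lt_mul_right h2' h2t h2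
      exact absurd (h1.trans hu.1.2) (not_le.2 h3)
    · by_contra h
      have h1 := hFanti (not_lt.1 h)
      rw [htF] at h1
      exact absurd hu.1.1 (not_lt.2 h1)
  · intro u hu hFu
    obtain ⟨n, hn⟩ := ENNReal.exists_mem_Ioc_zpow hFu (hFfin u hu) (y := 2) (by norm_num) h2t
    refine ⟨-n, ⟨?_, ?_⟩, hu⟩
    · simpa [hc] using hn.1
    · have := hn.2
      rw [ENNReal.zpow_add h2' h2t, zpow_one, mul_comm] at this
      simpa [hc] using this
  · intro k u hu
    have h1 := hsplit (hmono (lt_add_one k)).le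
    rw [htF, htF, hcs k, two_mul] at h1
    have h3 := (ENNReal.add_left_inj (hct (k + 1))).1 h1
    calc F u ≤ 2 * c k := hu.1.2
      _ = 4 * c (k + 1) := by rw [hcs k, ← mul_assoc]; norm_num
      _ = _ := by rw [h3]

/-! ### The inequality for `r ≤ s` -/

theorem rpow_sub_one_mul (x : ℝ≥0∞) {q : ℝ} (hq : 1 ≤ q) : x ^ (q - 1) * x = x ^ q := by
  nth_rw 2 [← ENNReal.rpow_one x]
  rw [← ENNReal.rpow_add_of_nonneg _ _ (by linarith) zero_le_one, sub_add_cancel]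

theorem tsum_rpow_le {ι : Type*} (x : ι → ℝ≥0∞) {q : ℝ} (hq : 1 ≤ q) :
    ∑' k, x k ^ q ≤ (∑' k, x k) ^ q := by
  calc ∑' k, x k ^ q ≤ ∑' k, (∑' k, x k) ^ (q - 1) * x k := by
        refine ENNReal.tsum_le_tsum fun k => ?_
        rw [← rpow_sub_one_mul _ hq]
        gcongr
        exact ENNReal.le_tsum k
    _ = _ := by rw [ENNReal.tsum_mul_left, rpow_sub_one_mul _ hq]

theorem tsum_mul_le_rpow {x y : ℤ → ℝ≥0∞} {p q : ℝ} (hpq : p.HolderConjugate q) :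
    ∑' k, x k * y k ≤ (∑' k, x k ^ p) ^ (1 / p) * (∑' k, y k ^ q) ^ (1 / q) := by
  simp only [← lintegral_count]
  exact ENNReal.lintegral_mul_le_Lp_mul_Lq Measure.count hpq (measurable_of_countable _).aemeasurable
    (measurable_of_countable _).aemeasurable

theorem tsum_pieces_le {f : ℝ → ℝ≥0∞} (hf : Antitone f) {t : ℤ → ℝ} (ht : Monotone t) (u : ℝ) :
    ∑' k, (f (max u (t k)) - f (t (k + 1))) ≤ f u := by
  set φ : ℤ → ℝ≥0∞ := fun k => f (max u (t k)) with hφ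
  set g : ℤ → ℝ≥0∞ := fun k => f (max u (t k)) - f (t (k + 1)) with hg
  have hstep : ∀ k, g k + φ (k + 1) ≤ φ k := fun k => by
    have h1 : φ (k + 1) ≤ φ k := hf (max_le_max le_rfl (ht (by linarith)))
    calc g k + φ (k + 1) ≤ (φ k - φ (k + 1)) + φ (k + 1) := by
          gcongr
          exact tsub_le_tsub le_rfl (hf (le_max_right _ _))
      _ = φ k := tsub_add_cancel_of_le h1
  have hsum : ∀ (a : ℤ) (n : ℕ), ∑ i ∈ Finset.range n, g (a + i) + φ (a + n) ≤ φ a := by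
    intro a n
    induction n with
    | zero => simp
    | succ n ih =>
      rw [Finset.sum_range_succ, add_assoc]
      refine le_trans ?_ ih
      gcongr
      have := hstep (a + n)
      push_cast
      rwa [← add_assoc]
  rw [ENNReal.tsum_eq_iSup_sum]
  refine iSup_le fun S => ?_
  obtain ⟨a, ha⟩ := S.bddBelow
  obtain ⟨b, hb⟩ := S.bddAbove
  have hsub : S ⊆ (Finset.range (b - a + 1).toNat).image fun i : ℕ => a + (i : ℤ) := by
    intro k hk
    have h1 : a ≤ k := ha hk
    have h2 : k ≤ b := hb hk
    rw [Finset.mem_image]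
    refine ⟨(k - a).toNat, ?_, ?_⟩
    · rw [Finset.mem_range]; omega
    · omega
  calc ∑ k ∈ S, g k ≤ ∑ k ∈ (Finset.range (b - a + 1).toNat).image fun i : ℕ => a + (i : ℤ), g k :=
        Finset.sum_le_sum_of_subset hsub
    _ = ∑ i ∈ Finset.range (b - a + 1).toNat, g (a + i) :=
        Finset.sum_image fun i _ j _ h => by simpa using h
    _ ≤ φ a := le_self_add.trans (hsum a _)
    _ ≤ f u := hf (le_max_left _ _)

/-- The measure of the jumps in the discretization of a decreasing function. -/
def jumpMeasure (ω : Measure ℝ) (s : ℝ) (t : ℤ → ℝ) (Δ : ℤ → Set ℝ) : Measure ℝ :=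
  Measure.sum fun k => (ω (Δ k) * logK (t k) (t (k + 1)) ^ s) • Measure.dirac (t (k + 1))

instance (ω : Measure ℝ) (s : ℝ) (t : ℤ → ℝ) (Δ : ℤ → Set ℝ) : SFinite (jumpMeasure ω s t Δ) :=
  inferInstanceAs (SFinite (Measure.sum _))

theorem lintegral_jumpMeasure (ω : Measure ℝ) (s : ℝ) (t : ℤ → ℝ) (Δ : ℤ → Set ℝ) {g : ℝ → ℝ≥0∞}
    (hg : Measurable g) : ∫⁻ u, g u ∂(jumpMeasure ω s t Δ) =
      ∑' k, ω (Δ k) * logK (t k) (t (k + 1)) ^ s * g (t (k + 1)) := by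
  rw [jumpMeasure, lintegral_sum_measure]
  congr 1
  ext k
  rw [lintegral_smul_measure, lintegral_dirac' _ hg, smul_eq_mul]

section

variable {ω : Measure ℝ} {t : ℤ → ℝ} {Δ : ℤ → Set ℝ}

theorem jumpMeasure_Iic_le {s : ℝ} (hs : 0 ≤ s) (ht0 : ∀ k, 0 < t k)
    (hΔm : ∀ k, MeasurableSet (Δ k)) (hΔd : Pairwise (Function.onFun Disjoint Δ))
    (hΔ : ∀ k, Δ k ⊆ Ioo (t (k - 2)) (t k)) (x : ℝ) :
    jumpMeasure ω s t Δ (Iic x) ≤ ∫⁻ u, logK u x ^ s ∂ω := by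
  rw [← lintegral_indicator_one measurableSet_Iic,
    lintegral_jumpMeasure _ _ _ _ (measurable_one.indicator measurableSet_Iic)]
  calc ∑' k, ω (Δ k) * logK (t k) (t (k + 1)) ^ s * (Iic x).indicator 1 (t (k + 1))
      ≤ ∑' k, ∫⁻ u in Δ k, logK u x ^ s ∂ω := by
        refine ENNReal.tsum_le_tsum fun k => ?_
        by_cases hk : t (k + 1) ≤ x
        · rw [indicator_of_mem (show t (k + 1) ∈ Iic x from hk), Pi.one_apply, mul_one, mul_comm,
            ← setLIntegral_const]
          refine setLIntegral_mono' (hΔm k) fun u hu => ?_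
          have hu' := hΔ k hu
          refine ENNReal.rpow_le_rpow ?_ hs
          exact (logK_mono (ht0 k) (ht0 _) hk).trans
            (logK_anti ((ht0 _).trans hu'.1) ((ht0 _).trans_le hk) hu'.2.le)
        · rw [indicator_of_notMem (show t (k + 1) ∉ Iic x from hk), mul_zero]
          exact zero_le
    _ = ∫⁻ u in ⋃ k, Δ k, logK u x ^ s ∂ω := (lintegral_iUnion hΔm hΔd _).symm
    _ ≤ _ := setLIntegral_le_lintegral _ _

theorem jumpMeasure_Iic_of_nonpos {s : ℝ} (ht0 : ∀ k, 0 < t k) {x : ℝ} (hx : x ≤ 0) :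
    jumpMeasure ω s t Δ (Iic x) = 0 := by
  rw [← lintegral_indicator_one measurableSet_Iic,
    lintegral_jumpMeasure _ _ _ _ (measurable_one.indicator measurableSet_Iic)]
  rw [ENNReal.tsum_eq_zero]
  intro k
  rw [indicator_of_notMem, mul_zero]
  simpa using hx.trans_lt (ht0 (k + 1))

theorem lintegral_Ioo_le_add {f : ℝ → ℝ≥0∞} (hf : Antitone f) {x y : ℝ} (hx : 0 < x) (hxy : x ≤ y) :
    ∫⁻ v in Ioo x y, f v ∂logMeasure ≤
      f y * logK x y + ∫⁻ v in Ioi x, (f (max v x) - f y) ∂logMeasure := by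
  have hm : Measurable fun v => f (max v x) - f y :=
    (hf.measurable.comp (measurable_id.max measurable_const)).sub measurable_const
  calc ∫⁻ v in Ioo x y, f v ∂logMeasure
      ≤ ∫⁻ v in Ioo x y, (f y + (f (max v x) - f y)) ∂logMeasure := by
        refine setLIntegral_mono' measurableSet_Ioo fun v hv => ?_
        rw [max_eq_left hv.1.le]
        exact le_add_tsub
    _ = f y * logK x y + ∫⁻ v in Ioo x y, (f (max v x) - f y) ∂logMeasure := by
        rw [lintegral_add_left measurable_const, setLIntegral_const,
          logMeasure_Ioo hx (hx.trans_le hxy)]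
    _ ≤ _ := by
        gcongr
        exact fun v hv => hv.1

/-- The discretized form of the left-hand side of Hardy's inequality for a decreasing function. -/
theorem exists_discrete_bound (hω : ω (Iic 0) = 0) {s : ℝ} (hs : 1 ≤ s)
    {f : ℝ → ℝ≥0∞} (hf : Antitone f) {B : ℝ≥0∞} (hB : B ≠ ∞)
    (hfB : ∀ t, f t ≤ B) {N : ℝ} (hN : ∀ t, N ≤ t → f t = 0) {t₀ : ℝ} (ht₀ : 0 < t₀)
    (hft₀ : f t₀ ≠ 0) :
    ∃ (t : ℤ → ℝ) (Δ : ℤ → Set ℝ), (∀ k, 0 < t k) ∧ StrictMono t ∧ (∀ k, MeasurableSet (Δ k)) ∧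
      Pairwise (Function.onFun Disjoint Δ) ∧ (∀ k, Δ k ⊆ Ioo (t (k - 2)) (t k)) ∧
      ∫⁻ u, (∫⁻ v in Ioi u, f v ∂logMeasure) ^ s ∂ω ≤ (4 ^ s * 2 ^ (s - 1)) *
        (∫⁻ u, f u ^ s ∂(jumpMeasure ω s t Δ) + ∑' k, ω (Δ k) *
          (∫⁻ v in Ioi (t k), (f (max v (t k)) - f (t (k + 1))) ∂logMeasure) ^ s) := by
  obtain ⟨t, Δ, ht0, ht, hΔm, hΔd, hΔ, hcov, hle⟩ := exists_discretization hf hB hfB hN ht₀ hft₀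
  refine ⟨t, Δ, ht0, ht, hΔm, hΔd, hΔ, ?_⟩
  have hs0 : 0 < s := by linarith
  set F : ℝ → ℝ≥0∞ := fun u => ∫⁻ v in Ioi u, f v ∂logMeasure with hF
  rw [lintegral_jumpMeasure _ _ _ _ (hf.measurable.pow_const _), ← ENNReal.tsum_add,
    ← ENNReal.tsum_mul_left]
  calc ∫⁻ u, F u ^ s ∂ω ≤ ∫⁻ u, (⋃ k, Δ k).indicator (fun u => F u ^ s) u ∂ω := by
        refine lintegral_mono_ae ?_
        filter_upwards [ae_pos_of_null hω] with u hu
        by_cases h : F u = 0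
        · rw [h, ENNReal.zero_rpow_of_pos hs0]
          exact zero_le
        · rw [indicator_of_mem (mem_iUnion.2 (hcov u hu h))]
    _ = ∑' k, ∫⁻ u in Δ k, F u ^ s ∂ω := by
        rw [lintegral_indicator (MeasurableSet.iUnion hΔm), lintegral_iUnion hΔm hΔd]
    _ ≤ _ := by
        refine ENNReal.tsum_le_tsum fun k => ?_
        set J := ∫⁻ v in Ioi (t k), (f (max v (t k)) - f (t (k + 1))) ∂logMeasure
        calc ∫⁻ u in Δ k, F u ^ s ∂ω
            ≤ ∫⁻ _ in Δ k, (4 * (f (t (k + 1)) * logK (t k) (t (k + 1)) + J)) ^ s ∂ω := by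
              refine setLIntegral_mono' (hΔm k) fun u hu => ENNReal.rpow_le_rpow ?_ hs0.le
              refine (hle k u hu).trans ?_
              gcongr
              exact lintegral_Ioo_le_add hf (ht0 k) (ht (lt_add_one k)).le
          _ = 4 ^ s * (f (t (k + 1)) * logK (t k) (t (k + 1)) + J) ^ s * ω (Δ k) := by
              rw [setLIntegral_const, ENNReal.mul_rpow_of_nonneg _ _ hs0.le]
          _ ≤ 4 ^ s * (2 ^ (s - 1) * ((f (t (k + 1)) * logK (t k) (t (k + 1))) ^ s + J ^ s)) *
                ω (Δ k) := by
              gcongr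
              exact ENNReal.rpow_add_le_mul_rpow_add_rpow _ _ hs
          _ = _ := by
              rw [ENNReal.mul_rpow_of_nonneg _ _ hs0.le]
              ring

/-- Reduction of Hardy's inequality to bounded functions of bounded support. -/
theorem hardy_of_bounded {ν : Measure ℝ} (hω : ω (Iic 0) = 0) {s e r : ℝ} (hs : 0 < s) (he : 0 < e)
    (hr : 0 < r) {K : ℝ≥0∞}
    (H : ∀ f : ℝ → ℝ≥0∞, Antitone f → ∀ B : ℝ≥0∞, B ≠ ∞ → (∀ t, f t ≤ B) → ∀ N : ℝ,
      (∀ t, N ≤ t → f t = 0) → ∀ t₀, 0 < t₀ → f t₀ ≠ 0 →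
      ∫⁻ u, (∫⁻ v in Ioi u, f v ∂logMeasure) ^ s ∂ω ≤ K * (∫⁻ u, f u ^ r ∂ν) ^ e)
    {f : ℝ → ℝ≥0∞} (hf : Antitone f) :
    ∫⁻ u, (∫⁻ v in Ioi u, f v ∂logMeasure) ^ s ∂ω ≤ K * (∫⁻ u, f u ^ r ∂ν) ^ e := by
  set g : ℕ → ℝ → ℝ≥0∞ := trunc f with hg
  have hganti : ∀ n, Antitone (g n) := antitone_trunc hf
  have hgle : ∀ n t, g n t ≤ f t := trunc_le f
  have hgmono : Monotone g := trunc_mono f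
  have hgsup : ∀ t, f t = ⨆ n, g n t := fun t => (iSup_trunc f t).symm
  have hFsup : ∀ u, ∫⁻ v in Ioi u, f v ∂logMeasure = ⨆ n, ∫⁻ v in Ioi u, g n v ∂logMeasure := by
    intro u
    rw [← lintegral_iSup (fun n => (hganti n).measurable) hgmono]
    exact lintegral_congr fun t => hgsup t
  have hsup : ∫⁻ u, (∫⁻ v in Ioi u, f v ∂logMeasure) ^ s ∂ω =
      ⨆ n, ∫⁻ u, (∫⁻ v in Ioi u, g n v ∂logMeasure) ^ s ∂ω := by
    rw [← lintegral_iSup]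
    · refine lintegral_congr fun u => ?_
      rw [hFsup, iSup_rpow _ hs]
    · exact fun n => (measurable_lintegral_Ioi _ _).pow_const _
    · intro i j hij u
      exact ENNReal.rpow_le_rpow (lintegral_mono (hgmono hij)) hs.le
  rw [hsup]
  refine iSup_le fun n => ?_
  have hmono : (∫⁻ u, g n u ^ r ∂ν) ^ e ≤ (∫⁻ u, f u ^ r ∂ν) ^ e :=
    ENNReal.rpow_le_rpow (lintegral_mono fun u => ENNReal.rpow_le_rpow (hgle n u) hr.le) he.le
  by_cases h0 : ∃ t₀, 0 < t₀ ∧ g n t₀ ≠ 0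
  · obtain ⟨t₀, ht₀, hne⟩ := h0
    exact (H (g n) (hganti n) n (ENNReal.natCast_ne_top n) (trunc_le_natCast f n) n
      (fun t ht => trunc_of_le f n ht) t₀ ht₀ hne).trans (by gcongr)
  · push Not at h0
    have : ∫⁻ u, (∫⁻ v in Ioi u, g n v ∂logMeasure) ^ s ∂ω = 0 := by
      rw [lintegral_congr_ae (g := fun _ => 0)]
      · simp
      · filter_upwards [ae_pos_of_null hω] with u hu
        rw [setLIntegral_congr_fun (g := fun _ => 0) measurableSet_Ioi
          fun v (hv : u < v) => h0 v (hu.trans hv)]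
        simp [ENNReal.zero_rpow_of_pos hs]
    rw [this]
    exact zero_le

end

theorem antitone_piece {f : ℝ → ℝ≥0∞} (hf : Antitone f) (x y : ℝ) :
    Antitone fun v => f (max v x) - f y :=
  fun _ _ h => tsub_le_tsub (hf (max_le_max h le_rfl)) le_rfl

theorem tsum_lintegral_pieces_le {f : ℝ → ℝ≥0∞} (hf : Antitone f) (ν : Measure ℝ) {t : ℤ → ℝ}
    (ht : Monotone t) {r : ℝ} (hr : 1 ≤ r) :
    ∑' k, ∫⁻ u, (f (max u (t k)) - f (t (k + 1))) ^ r ∂ν ≤ ∫⁻ u, f u ^ r ∂ν := by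
  rw [← lintegral_tsum fun k => ((antitone_piece hf _ _).measurable.pow_const _).aemeasurable]
  refine lintegral_mono fun u => (tsum_rpow_le _ hr).trans ?_
  exact ENNReal.rpow_le_rpow (tsum_pieces_le hf ht u) (by linarith)

/-- Hardy's inequality for decreasing functions, `r ≤ s`. -/
theorem hardy_of_le {ν ω : Measure ℝ} (hω : ω (Iic 0) = 0) {r s : ℝ} (hr : 1 ≤ r) (hrs : r ≤ s)
    {Θ : ℝ → ℝ≥0∞} {A : ℝ≥0∞}
    (hΘ : ∀ x, 0 < x → ∀ g : ℝ → ℝ≥0∞, Antitone g →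
      ∫⁻ v in Ioi x, g v ∂logMeasure ≤ Θ x * (∫⁻ u, g u ^ r ∂ν) ^ (1 / r))
    (hA : ∀ x, 0 < x → ω (Iio x) * Θ x ^ s ≤ A)
    (hA' : ∀ x, 0 < x → ∫⁻ u, logK u x ^ s ∂ω ≤ A * ν (Iio x) ^ (s / r))
    {f : ℝ → ℝ≥0∞} (hf : Antitone f) :
    ∫⁻ u, (∫⁻ v in Ioi u, f v ∂logMeasure) ^ s ∂ω ≤
      (4 ^ s * 2 ^ (s - 1) * (ENNReal.ofReal (s / r) + 1)) * A *
        (∫⁻ u, f u ^ r ∂ν) ^ (s / r) := by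
  have hr0 : 0 < r := by linarith
  have hs : 1 ≤ s := hr.trans hrs
  have hs0 : 0 < s := by linarith
  have hsr : 1 ≤ s / r := (one_le_div hr0).2 hrs
  refine hardy_of_bounded hω hs0 (by linarith) hr0 (fun f hf B hB hfB N hN t₀ ht₀ hft₀ => ?_) hf
  obtain ⟨t, Δ, ht0, ht, hΔm, hΔd, hΔ, hle⟩ := exists_discrete_bound hω hs hf hB hfB hN ht₀ hft₀
  refine hle.trans ?_
  have h1 : ∫⁻ u, f u ^ s ∂(jumpMeasure ω s t Δ) ≤
      ENNReal.ofReal (s / r) * A * (∫⁻ u, f u ^ r ∂ν) ^ (s / r) := by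
    have hM : ∀ x, jumpMeasure ω s t Δ (Iic x) ≤ A * ν (Iio x) ^ (s / r) := fun x => by
      rcases le_or_gt x 0 with hx | hx
      · rw [jumpMeasure_Iic_of_nonpos ht0 hx]
        exact zero_le
      · exact (jumpMeasure_Iic_le hs0.le ht0 hΔm hΔd hΔ x).trans (hA' x hx)
    have hfr : Antitone fun u => f u ^ r := fun x y h => ENNReal.rpow_le_rpow (hf h) hr0.le
    refine le_of_eq_of_le ?_ (lintegral_rpow_le_of_antitone hsr hM hfr)
    refine lintegral_congr fun u => ?_
    rw [← ENNReal.rpow_mul, mul_div_cancel₀ _ hr0.ne']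
  have h2 : ∑' k, ω (Δ k) *
        (∫⁻ v in Ioi (t k), (f (max v (t k)) - f (t (k + 1))) ∂logMeasure) ^ s ≤
      A * (∫⁻ u, f u ^ r ∂ν) ^ (s / r) := by
    calc _ ≤ ∑' k, A * (∫⁻ u, (f (max u (t k)) - f (t (k + 1))) ^ r ∂ν) ^ (s / r) := by
          refine ENNReal.tsum_le_tsum fun k => ?_
          calc _ ≤ ω (Iio (t k)) * (Θ (t k) *
                (∫⁻ u, (f (max u (t k)) - f (t (k + 1))) ^ r ∂ν) ^ (1 / r)) ^ s := by
                gcongr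
                · exact fun u hu => (hΔ k hu).2
                · exact hΘ _ (ht0 k) _ (antitone_piece hf _ _)
            _ = ω (Iio (t k)) * Θ (t k) ^ s *
                (∫⁻ u, (f (max u (t k)) - f (t (k + 1))) ^ r ∂ν) ^ (s / r) := by
                rw [ENNReal.mul_rpow_of_nonneg _ _ hs0.le, ← ENNReal.rpow_mul, mul_assoc]
                congr 3
                ring
            _ ≤ _ := by
                gcongr
                exact hA _ (ht0 k)
      _ ≤ A * (∑' k, ∫⁻ u, (f (max u (t k)) - f (t (k + 1))) ^ r ∂ν) ^ (s / r) := by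
          rw [ENNReal.tsum_mul_left]
          gcongr
          exact tsum_rpow_le _ hsr
      _ ≤ _ := by
          gcongr
          exact tsum_lintegral_pieces_le hf ν ht.monotone hr
  calc _ ≤ (4 ^ s * 2 ^ (s - 1) : ℝ≥0∞) * (ENNReal.ofReal (s / r) * A *
        (∫⁻ u, f u ^ r ∂ν) ^ (s / r) + A * (∫⁻ u, f u ^ r ∂ν) ^ (s / r)) := by gcongr
    _ = _ := by ring

/-! ### The inequality for `s < r` -/

theorem measure_rpow_le_lintegral {ω : Measure ℝ} [NullSingletonClass ω] {Δ : Set ℝ}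
    (hΔm : MeasurableSet Δ) {α β : ℝ} (hΔ : Δ ⊆ Ioo α β) (hfin : ω (Ioo α β) ≠ ∞) {γ : ℝ}
    (hγ : 0 ≤ γ) :
    ω Δ ^ (γ + 1) ≤ 2 ^ (γ + 1) * ∫⁻ t in Δ, ω (Iio t) ^ γ ∂ω := by
  rcases Δ.eq_empty_or_nonempty with rfl | ⟨z, hz⟩
  · rw [measure_empty, ENNReal.zero_rpow_of_pos (by linarith)]
    exact zero_le
  have hαβ : α < β := (hΔ hz).1.trans (hΔ hz).2
  set m := ω.restrict Δ with hm
  have hmuniv : m univ = ω Δ := Measure.restrict_apply_univ _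
  have hmI : m (Ioo α β) = ω Δ := by
    rw [hm, Measure.restrict_apply measurableSet_Ioo, inter_eq_right.2 hΔ]
  have hΔfin : ω Δ ≠ ∞ := measure_ne_top_of_subset hΔ hfin
  obtain ⟨y, hy, hyc⟩ := exists_measure_Ioo_eq m hαβ.le (by rw [hmI]; exact hΔfin)
    (c := ω Δ / 2) (by rw [hmI]; exact ENNReal.half_le_self)
  have hmIic : m (Iic α) = 0 := by
    rw [hm, Measure.restrict_apply measurableSet_Iic]
    refine measure_mono_null (t := ∅) (fun u hu => ?_) measure_empty
    exact absurd hu.1 (not_le.2 (hΔ hu.2).1)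
  have hlow : m (Iio y) ≤ ω Δ / 2 := by
    calc m (Iio y) ≤ m (Iic α ∪ Ioo α y) := measure_mono fun u hu => by
          rcases le_or_gt u α with h | h
          · exact Or.inl h
          · exact Or.inr ⟨h, hu⟩
      _ ≤ m (Iic α) + m (Ioo α y) := measure_union_le _ _
      _ = _ := by rw [hmIic, zero_add, hyc]
  have hup : ω Δ / 2 ≤ m (Ici y) := by
    have h1 : ω Δ ≤ ω Δ / 2 + m (Ici y) := by
      rw [← hmuniv, ← Iio_union_Ici (a := y), ← hmuniv] at *
      exact (measure_union_le _ _).trans (by gcongr)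
    have h2 : ω Δ / 2 + ω Δ / 2 ≤ ω Δ / 2 + m (Ici y) := by rwa [ENNReal.add_halves]
    exact (ENNReal.add_le_add_iff_left (ENNReal.div_ne_top hΔfin two_ne_zero)).1 h2
  have key : (ω Δ / 2) ^ (γ + 1) ≤ ∫⁻ t in Δ, ω (Iio t) ^ γ ∂ω := by
    calc (ω Δ / 2) ^ (γ + 1) = (ω Δ / 2) ^ γ * (ω Δ / 2) := by
          have := rpow_sub_one_mul (ω Δ / 2) (q := γ + 1) (by linarith)
          rw [add_sub_cancel_right] at this
          exact this.symm
      _ ≤ (ω Δ / 2) ^ γ * m (Ici y) := by gcongr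
      _ = ∫⁻ _ in Ici y, (ω Δ / 2) ^ γ ∂m := by rw [setLIntegral_const]
      _ ≤ ∫⁻ t in Ici y, ω (Iio t) ^ γ ∂m := by
          refine setLIntegral_mono' measurableSet_Ici fun t ht => ENNReal.rpow_le_rpow ?_ hγ
          calc ω Δ / 2 = m (Ioo α y) := hyc.symm
            _ ≤ m (Iio t) := measure_mono fun u hu => hu.2.trans_le ht
            _ ≤ ω (Iio t) := Measure.restrict_apply_le _ _
      _ ≤ _ := setLIntegral_le_lintegral _ _
  calc ω Δ ^ (γ + 1) = 2 ^ (γ + 1) * (ω Δ / 2) ^ (γ + 1) := by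
        rw [← ENNReal.mul_rpow_of_nonneg _ _ (by linarith),
          ENNReal.mul_div_cancel two_ne_zero ENNReal.ofNat_ne_top]
    _ ≤ _ := by gcongr

/-- The function `∫_x^∞ (log (t / x) / V(t))^q dν(t)`. -/
def tail (ν : Measure ℝ) (q x : ℝ) : ℝ≥0∞ :=
  ∫⁻ t in Ioi x, (logK x t * (ν (Iio t))⁻¹) ^ q ∂ν

theorem logMeasure_restrict_Ioi_Iio {x t : ℝ} (hx : 0 < x) (ht : 0 < t) :
    logMeasure.restrict (Ioi x) (Iio t) = logK x t := by
  rw [Measure.restrict_apply measurableSet_Iio, inter_comm, Ioi_inter_Iio, logMeasure_Ioo hx ht]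

theorem lintegral_tail {ν : Measure ℝ} (h0 : ν (Iic 0) = 0) {q x : ℝ} (hq : 0 < q) (hx : 0 < x) :
    ∫⁻ t, (logMeasure.restrict (Ioi x) (Iio t) * (ν (Iio t))⁻¹) ^ q ∂ν = tail ν q x := by
  rw [tail, ← lintegral_indicator measurableSet_Ioi]
  refine lintegral_congr_ae ?_
  filter_upwards [ae_pos_of_null h0] with t ht
  rw [logMeasure_restrict_Ioi_Iio hx ht]
  by_cases h : x < t
  · rw [indicator_of_mem (show t ∈ Ioi x from h)]
  · rw [indicator_of_notMem (show t ∉ Ioi x from h), logK_eq_zero ht (not_lt.1 h), zero_mul,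
      ENNReal.zero_rpow_of_pos hq]

theorem tail_anti (ν : Measure ℝ) {q x y : ℝ} (hq : 0 ≤ q) (hx : 0 < x) (hxy : x ≤ y) :
    tail ν q y ≤ tail ν q x := by
  calc tail ν q y ≤ ∫⁻ t in Ioi y, (logK x t * (ν (Iio t))⁻¹) ^ q ∂ν := by
        refine setLIntegral_mono' measurableSet_Ioi fun t ht => ENNReal.rpow_le_rpow ?_ hq
        gcongr
        exact logK_anti hx (hx.trans (hxy.trans_lt ht)) hxy
    _ ≤ _ := lintegral_mono_set (Ioi_subset_Ioi hxy)

section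

variable {ν : Measure ℝ} [SFinite ν] [NullSingletonClass ν]

theorem IsWeight.lintegral_Ioi_le_tail (hν : IsWeight ν) {p q : ℝ} (hpq : p.HolderConjugate q) :
    ∃ C : ℝ≥0, ∀ x, 0 < x → ∀ g : ℝ → ℝ≥0∞, Antitone g →
      ∫⁻ v in Ioi x, g v ∂logMeasure ≤
        C * tail ν q x ^ (1 / q) * (∫⁻ t, g t ^ p ∂ν) ^ (1 / p) := by
  obtain ⟨C, hC⟩ := hν.sawyer_upper hpq
  refine ⟨C, fun x hx g hg => ?_⟩
  have h0 : logMeasure.restrict (Ioi x) (Iic 0) = 0 :=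
    le_antisymm ((Measure.restrict_apply_le _ _).trans_eq logMeasure_Iic) zero_le
  refine (hC _ h0 g hg).trans_eq ?_
  rw [lintegral_tail hν.null hpq.symm.pos hx]
  ring

theorem IsWeight.tail_le (hν : IsWeight ν) {p q : ℝ} (hpq : p.HolderConjugate q) :
    ∃ C : ℝ≥0, ∀ x, 0 < x → ∀ w K : ℝ≥0∞, (∀ g : ℝ → ℝ≥0∞, Antitone g →
      w * ∫⁻ v in Ioi x, g v ∂logMeasure ≤ K * (∫⁻ t, g t ^ p ∂ν) ^ (1 / p)) →
      w * tail ν q x ^ (1 / q) ≤ C * K := by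
  obtain ⟨C, hC⟩ := hν.sawyer_lower hpq
  refine ⟨C, fun x hx w K h => ?_⟩
  rw [← lintegral_tail hν.null hpq.symm.pos hx]
  exact hC _ w K h

/-- Hardy's inequality for decreasing functions, `s < r`. -/
theorem IsWeight.hardy_of_lt (hν : IsWeight ν) {ω : Measure ℝ} [NullSingletonClass ω]
    (hω : ω (Iic 0) = 0) (hωfin : ∀ x y, 0 < x → ω (Ioo x y) ≠ ∞) {r s p q r' : ℝ} (hs : 1 ≤ s)
    (hr : r.HolderConjugate r') (hp : r = s * p) (hpq : p.HolderConjugate q) :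
    ∃ C : ℝ≥0, ∀ f : ℝ → ℝ≥0∞, Antitone f →
      ∫⁻ u, (∫⁻ v in Ioi u, f v ∂logMeasure) ^ s ∂ω ≤
        C * ((∫⁻ t, ((∫⁻ u, logK u t ^ s ∂ω) * (ν (Iio t))⁻¹) ^ q ∂ν) ^ (1 / q) +
          (∫⁻ u, ω (Iio u) ^ (q - 1) * tail ν r' u ^ (s * q / r') ∂ω) ^ (1 / q)) *
        (∫⁻ u, f u ^ r ∂ν) ^ (1 / p) := by
  obtain ⟨C₁, hC₁⟩ := hν.sawyer_upper hpq
  obtain ⟨C₂, hC₂⟩ := hν.lintegral_Ioi_le_tail hr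
  have hr0 := hr.pos
  have hr'0 := hr.symm.pos
  have hp0 := hpq.pos
  have hq0 := hpq.symm.pos
  have hq1 := hpq.symm.lt
  have hs0 : 0 < s := by linarith
  have hp1 : 0 < 1 / p := by positivity
  have hq1' : 0 < 1 / q := by positivity
  have hsr : s / r = 1 / p := by rw [hp]; field_simp
  set B₁ := ∫⁻ t, ((∫⁻ u, logK u t ^ s ∂ω) * (ν (Iio t))⁻¹) ^ q ∂ν with hB₁
  set B₂ := ∫⁻ u, ω (Iio u) ^ (q - 1) * tail ν r' u ^ (s * q / r') ∂ω with hB₂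
  have h4 : ((4 : ℝ≥0) : ℝ≥0∞) = 4 := rfl
  have h2c : ((2 : ℝ≥0) : ℝ≥0∞) = 2 := rfl
  refine ⟨4 ^ s * 2 ^ (s - 1) * (C₁ + C₂ ^ s * 2), fun f hf => ?_⟩
  refine hardy_of_bounded hω hs0 hp1 hr0 (fun f hf B hB hfB N hN t₀ ht₀ hft₀ => ?_) hf
  obtain ⟨t, Δ, ht0, ht, hΔm, hΔd, hΔ, hle⟩ := exists_discrete_bound hω hs hf hB hfB hN ht₀ hft₀
  refine hle.trans ?_
  have h1 : ∫⁻ u, f u ^ s ∂(jumpMeasure ω s t Δ) ≤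
      C₁ * (∫⁻ u, f u ^ r ∂ν) ^ (1 / p) * B₁ ^ (1 / q) := by
    have hfs : Antitone fun u => f u ^ s := fun x y h => ENNReal.rpow_le_rpow (hf h) hs0.le
    refine (hC₁ _ (jumpMeasure_Iic_of_nonpos ht0 le_rfl) _ hfs).trans ?_
    have e1 : ∫⁻ u, (f u ^ s) ^ p ∂ν = ∫⁻ u, f u ^ r ∂ν :=
      lintegral_congr fun u => by rw [← ENNReal.rpow_mul, hp]
    rw [e1]
    gcongr
    refine lintegral_mono fun x => ENNReal.rpow_le_rpow (mul_le_mul_left ?_ _) hq0.le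
    exact (measure_mono Iio_subset_Iic_self).trans
      (jumpMeasure_Iic_le hs0.le ht0 hΔm hΔd hΔ _)
  have h3 : ∑' k, (ω (Δ k) * tail ν r' (t k) ^ (s / r')) ^ q ≤ 2 ^ q * B₂ := by
    calc _ ≤ ∑' k, 2 ^ q * ∫⁻ u in Δ k, ω (Iio u) ^ (q - 1) * tail ν r' u ^ (s * q / r') ∂ω := by
          refine ENNReal.tsum_le_tsum fun k => ?_
          have h5 := measure_rpow_le_lintegral (ω := ω) (hΔm k) (hΔ k) (hωfin _ _ (ht0 _))
            (γ := q - 1) (by linarith)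
          rw [sub_add_cancel] at h5
          rw [ENNReal.mul_rpow_of_nonneg _ _ hq0.le, ← ENNReal.rpow_mul, div_mul_eq_mul_div]
          calc _ ≤ 2 ^ q * (∫⁻ u in Δ k, ω (Iio u) ^ (q - 1) ∂ω) *
                tail ν r' (t k) ^ (s * q / r') := by gcongr
            _ = 2 ^ q * ∫⁻ u in Δ k, ω (Iio u) ^ (q - 1) * tail ν r' (t k) ^ (s * q / r') ∂ω := by
                rw [lintegral_mul_const _ ((measurable_measure_Iio ω).pow_const _), mul_assoc]
            _ ≤ _ := by
                gcongr 2 ^ q * ?_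
                refine setLIntegral_mono' (hΔm k) fun u hu => ?_
                gcongr
                exact tail_anti ν hr'0.le ((ht0 _).trans (hΔ k hu).1) (hΔ k hu).2.le
      _ = 2 ^ q * ∫⁻ u in ⋃ k, Δ k, ω (Iio u) ^ (q - 1) * tail ν r' u ^ (s * q / r') ∂ω := by
          rw [ENNReal.tsum_mul_left, lintegral_iUnion hΔm hΔd]
      _ ≤ _ := by
          gcongr
          exact setLIntegral_le_lintegral _ _
  have h2 : ∑' k, ω (Δ k) *
        (∫⁻ v in Ioi (t k), (f (max v (t k)) - f (t (k + 1))) ∂logMeasure) ^ s ≤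
      C₂ ^ s * 2 * B₂ ^ (1 / q) * (∫⁻ u, f u ^ r ∂ν) ^ (1 / p) := by
    set n : ℤ → ℝ≥0∞ := fun k => ∫⁻ u, (f (max u (t k)) - f (t (k + 1))) ^ r ∂ν with hn
    calc _ ≤ ∑' k, C₂ ^ s * (n k ^ (1 / p) * (ω (Δ k) * tail ν r' (t k) ^ (s / r'))) := by
          refine ENNReal.tsum_le_tsum fun k => ?_
          calc _ ≤ ω (Δ k) * (C₂ * tail ν r' (t k) ^ (1 / r') * n k ^ (1 / r)) ^ s := by
                gcongr
                exact hC₂ _ (ht0 k) _ (antitone_piece hf _ _)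
            _ = _ := by
                rw [ENNReal.mul_rpow_of_nonneg _ _ hs0.le, ENNReal.mul_rpow_of_nonneg _ _ hs0.le,
                  ← ENNReal.rpow_mul, ← ENNReal.rpow_mul, one_div_mul_eq_div, one_div_mul_eq_div,
                  hsr]
                ring
      _ ≤ C₂ ^ s * ((∑' k, (n k ^ (1 / p)) ^ p) ^ (1 / p) *
            (∑' k, (ω (Δ k) * tail ν r' (t k) ^ (s / r')) ^ q) ^ (1 / q)) := by
          rw [ENNReal.tsum_mul_left]
          gcongr
          exact tsum_mul_le_rpow hpq
      _ ≤ C₂ ^ s * ((∫⁻ u, f u ^ r ∂ν) ^ (1 / p) * (2 ^ q * B₂) ^ (1 / q)) := by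
          have e1 : ∑' k, (n k ^ (1 / p)) ^ p = ∑' k, n k := by
            congr 1
            ext k
            rw [← ENNReal.rpow_mul, one_div_mul_cancel hp0.ne', ENNReal.rpow_one]
          rw [e1]
          gcongr
          exact tsum_lintegral_pieces_le hf ν ht.monotone hr.lt.le
      _ = _ := by
          rw [ENNReal.mul_rpow_of_nonneg _ _ hq1'.le, ← ENNReal.rpow_mul,
            mul_one_div_cancel hq0.ne', ENNReal.rpow_one]
          ring
  calc _ ≤ (4 ^ s * 2 ^ (s - 1) : ℝ≥0∞) * (C₁ * (∫⁻ u, f u ^ r ∂ν) ^ (1 / p) * B₁ ^ (1 / q) +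
        C₂ ^ s * 2 * B₂ ^ (1 / q) * (∫⁻ u, f u ^ r ∂ν) ^ (1 / p)) := by gcongr
    _ ≤ (4 ^ s * 2 ^ (s - 1) : ℝ≥0∞) * ((C₁ + C₂ ^ s * 2) * (∫⁻ u, f u ^ r ∂ν) ^ (1 / p) *
        B₁ ^ (1 / q) + (C₁ + C₂ ^ s * 2) * B₂ ^ (1 / q) * (∫⁻ u, f u ^ r ∂ν) ^ (1 / p)) := by
        gcongr
        · exact le_self_add
        · exact le_add_self
    _ = _ := by
        rw [ENNReal.coe_mul, ENNReal.coe_mul, ENNReal.coe_add, ENNReal.coe_mul,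
          ENNReal.coe_rpow_of_nonneg _ hs0.le, ENNReal.coe_rpow_of_nonneg _ hs0.le,
          ENNReal.coe_rpow_of_nonneg _ (by linarith : 0 ≤ s - 1), h4, h2c]
        ring

/-- Hardy's inequality for decreasing functions, `1 = s < r`. -/
theorem IsWeight.hardy_one (hν : IsWeight ν) {ω : Measure ℝ} [SFinite ω] (hω : ω (Iic 0) = 0)
    {r r' : ℝ} (hr : r.HolderConjugate r') :
    ∃ C : ℝ≥0, ∀ f : ℝ → ℝ≥0∞, Antitone f →
      ∫⁻ u, ∫⁻ v in Ioi u, f v ∂logMeasure ∂ω ≤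
        C * (∫⁻ t, ((∫⁻ u, logK u t ∂ω) * (ν (Iio t))⁻¹) ^ r' ∂ν) ^ (1 / r') *
        (∫⁻ u, f u ^ r ∂ν) ^ (1 / r) := by
  obtain ⟨C, hC⟩ := hν.sawyer_upper hr
  refine ⟨C, fun f hf => ?_⟩
  have hWm := measurable_measure_Iio ω
  have hM : ∀ g : ℝ → ℝ≥0∞, Measurable g →
      ∫⁻ t, g t ∂(logMeasure.withDensity fun t => ω (Iio t)) =
        ∫⁻ u, ∫⁻ v in Ioi u, g v ∂logMeasure ∂ω := by
    intro g hg
    rw [lintegral_withDensity_eq_lintegral_mul _ hWm hg]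
    have := lintegral_mul_lintegral_Iio ω logMeasure hg (measurable_const (a := (1 : ℝ≥0∞)))
    simp only [setLIntegral_one, one_mul] at this
    rw [← this]
    exact lintegral_congr fun t => mul_comm _ _
  have hM0 : logMeasure.withDensity (fun t => ω (Iio t)) (Iic 0) = 0 :=
    withDensity_absolutelyContinuous _ _ logMeasure_Iic
  rw [← hM f hf.measurable]
  refine (hC _ hM0 f hf).trans_eq ?_
  rw [mul_right_comm]
  congr 3
  refine lintegral_congr_ae ?_
  filter_upwards [hν.ae_pos] with t ht
  congr 2
  rw [← lintegral_indicator_one measurableSet_Iio,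
    hM _ (measurable_one.indicator measurableSet_Iio)]
  refine lintegral_congr_ae ?_
  filter_upwards [ae_pos_of_null hω] with u hu
  rw [lintegral_indicator_one measurableSet_Iio, logMeasure_restrict_Ioi_Iio hu ht]

end

/-! ### Necessity of the conditions -/

theorem rpow_logK_le {u t : ℝ} (hu : 0 < u) (ht : 0 < t) {s : ℝ} (hs : 1 ≤ s) :
    logK u t ^ s ≤ 2 ^ s * ∫⁻ v in Ioo u t, logK u v ^ (s - 1) ∂logMeasure := by
  have hfin : logMeasure.restrict (Ioo u t) (Ioo u t) ≠ ∞ := by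
    rw [Measure.restrict_apply measurableSet_Ioo, inter_self, logMeasure_Ioo hu ht]
    exact logK_ne_top _ _
  have h := measure_rpow_le_lintegral (ω := logMeasure.restrict (Ioo u t)) measurableSet_Ioo
    (Subset.refl (Ioo u t)) hfin (γ := s - 1) (by linarith)
  rw [sub_add_cancel, Measure.restrict_apply measurableSet_Ioo, inter_self, logMeasure_Ioo hu ht,
    Measure.restrict_restrict measurableSet_Ioo, inter_self] at h
  refine h.trans_eq ?_
  congr 1
  refine setLIntegral_congr_fun measurableSet_Ioo fun v hv => ?_
  have : Iio v ∩ Ioo u t = Ioo u v := by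
    ext z
    simp only [mem_inter_iff, mem_Iio, mem_Ioo]
    exact ⟨fun h => ⟨h.2.1, h.1⟩, fun h => ⟨h.2, h.1, h.2.trans hv.2⟩⟩
  rw [Measure.restrict_apply measurableSet_Iio, this, logMeasure_Ioo hu (hu.trans hv.1)]

theorem lintegral_rpow_mul_logK_le {f : ℝ → ℝ≥0∞} (hf : Antitone f) {s u : ℝ} (hs : 1 ≤ s)
    (hu : 0 < u) :
    ∫⁻ v in Ioi u, logK u v ^ (s - 1) * f v ^ s ∂logMeasure ≤
      (∫⁻ v in Ioi u, f v ∂logMeasure) ^ s := by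
  set F := ∫⁻ v in Ioi u, f v ∂logMeasure with hF
  rw [← rpow_sub_one_mul F hs]
  calc _ ≤ ∫⁻ v in Ioi u, F ^ (s - 1) * f v ∂logMeasure := by
        refine setLIntegral_mono' measurableSet_Ioi fun v hv => ?_
        have h1 : f v * logK u v ≤ F := by
          rw [← logMeasure_Ioo hu (hu.trans hv), ← setLIntegral_const]
          calc _ ≤ ∫⁻ z in Ioo u v, f z ∂logMeasure :=
                setLIntegral_mono' measurableSet_Ioo fun z hz => hf hz.2.le
            _ ≤ F := lintegral_mono_set fun z hz => hz.1
        rw [← rpow_sub_one_mul (f v) hs, ← mul_assoc,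
          ← ENNReal.mul_rpow_of_nonneg _ _ (by linarith), mul_comm (logK u v)]
        gcongr
    _ = _ := by rw [lintegral_const_mul _ hf.measurable]

section

variable {ν : Measure ℝ} [SFinite ν] [NullSingletonClass ν]

theorem IsWeight.lintegral_logK_div_rpow_le (hν : IsWeight ν) {p q : ℝ}
    (hpq : p.HolderConjugate q) {s : ℝ} (hs : 1 ≤ s) :
    ∃ C : ℝ≥0, ∀ (ω : Measure ℝ) [SFinite ω], ω (Iic 0) = 0 → ∀ K : ℝ≥0∞,
      (∀ f : ℝ → ℝ≥0∞, Antitone f →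
        ∫⁻ u, (∫⁻ v in Ioi u, f v ∂logMeasure) ^ s ∂ω ≤ K * (∫⁻ u, f u ^ (s * p) ∂ν) ^ (1 / p)) →
      (∫⁻ t, ((∫⁻ u, logK u t ^ s ∂ω) * (ν (Iio t))⁻¹) ^ q ∂ν) ^ (1 / q) ≤ C * K := by
  obtain ⟨C, hC⟩ := hν.sawyer_lower hpq
  have hs0 : 0 < s := by linarith
  have hq := hpq.symm.pos
  refine ⟨2 ^ s * C, fun ω _ hω K H => ?_⟩
  set k : ℝ → ℝ → ℝ≥0∞ := fun v u => {z : ℝ × ℝ | z.2 < z.1}.indicator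
    (fun z => logK z.2 z.1 ^ (s - 1)) (v, u) with hk
  have hkm : Measurable (Function.uncurry k) :=
    ((measurable_logK.comp measurable_swap).pow_const _).indicator
      (measurableSet_lt measurable_snd measurable_fst)
  have hk2 : ∀ v, Measurable (k v) := fun v => hkm.comp measurable_prodMk_left
  have hDm : Measurable fun v => ∫⁻ u, k v u ∂ω := hkm.lintegral_prod_right
  have hM : ∀ g : ℝ → ℝ≥0∞, Measurable g →
      ∫⁻ v, g v ∂(logMeasure.withDensity fun v => ∫⁻ u, k v u ∂ω) =
        ∫⁻ u, ∫⁻ v in Ioi u, logK u v ^ (s - 1) * g v ∂logMeasure ∂ω := by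
    intro g hg
    rw [lintegral_withDensity_eq_lintegral_mul _ hDm hg]
    calc _ = ∫⁻ v, ∫⁻ u, k v u * g v ∂ω ∂logMeasure := by
          refine lintegral_congr fun v => ?_
          rw [lintegral_mul_const _ (hk2 v)]
          rfl
      _ = ∫⁻ u, ∫⁻ v, k v u * g v ∂logMeasure ∂ω :=
          lintegral_lintegral_swap (hkm.mul (hg.comp measurable_fst)).aemeasurable
      _ = _ := by
          refine lintegral_congr fun u => ?_
          rw [← lintegral_indicator measurableSet_Ioi]
          refine lintegral_congr fun v => ?_
          simp only [hk, indicator, mem_ofPred_eq, mem_Ioi]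
          split_ifs
          · rfl
          · rw [zero_mul]
  have h1 := hC (logMeasure.withDensity fun v => ∫⁻ u, k v u ∂ω) 1 K fun g hg => by
    rw [one_mul, hM g hg.measurable]
    have hgs : Antitone fun v => g v ^ (1 / s) := fun x y h =>
      ENNReal.rpow_le_rpow (hg h) (by positivity)
    have e1 : ∀ v, (g v ^ (1 / s)) ^ s = g v := fun v => by
      rw [← ENNReal.rpow_mul, one_div_mul_cancel hs0.ne', ENNReal.rpow_one]
    calc _ ≤ ∫⁻ u, (∫⁻ v in Ioi u, g v ^ (1 / s) ∂logMeasure) ^ s ∂ω := by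
          refine lintegral_mono_ae ?_
          filter_upwards [ae_pos_of_null hω] with u hu
          refine le_of_eq_of_le ?_ (lintegral_rpow_mul_logK_le hgs hs hu)
          simp only [e1]
      _ ≤ K * (∫⁻ u, (g u ^ (1 / s)) ^ (s * p) ∂ν) ^ (1 / p) := H _ hgs
      _ = _ := by
          congr 3
          ext u
          rw [ENNReal.rpow_mul, e1]
  rw [one_mul] at h1
  have h2 : ∀ t, 0 < t → ∫⁻ u, logK u t ^ s ∂ω ≤
      2 ^ s * (logMeasure.withDensity fun v => ∫⁻ u, k v u ∂ω) (Iio t) := by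
    intro t ht
    rw [← lintegral_indicator_one measurableSet_Iio,
      hM _ (measurable_one.indicator measurableSet_Iio),
      ← lintegral_const_mul' _ _ (ENNReal.rpow_ne_top_of_nonneg hs0.le ENNReal.ofNat_ne_top)]
    refine lintegral_mono_ae ?_
    filter_upwards [ae_pos_of_null hω] with u hu
    refine (rpow_logK_le hu ht hs).trans ?_
    gcongr 2 ^ s * ?_
    rw [← Ioi_inter_Iio, inter_comm, ← Measure.restrict_restrict measurableSet_Iio,
      ← lintegral_indicator measurableSet_Iio]
    refine lintegral_mono fun v => ?_
    by_cases hv : v ∈ Iio t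
    · simp [hv]
    · simp [hv]
  calc _ ≤ (∫⁻ t, (2 ^ s * ((logMeasure.withDensity fun v => ∫⁻ u, k v u ∂ω) (Iio t) *
        (ν (Iio t))⁻¹)) ^ q ∂ν) ^ (1 / q) := by
        refine ENNReal.rpow_le_rpow (lintegral_mono_ae ?_) (by positivity)
        filter_upwards [hν.ae_pos] with t ht
        rw [← mul_assoc]
        gcongr
        exact h2 t ht
    _ = 2 ^ s * (∫⁻ t, ((logMeasure.withDensity fun v => ∫⁻ u, k v u ∂ω) (Iio t) *
        (ν (Iio t))⁻¹) ^ q ∂ν) ^ (1 / q) := by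
        simp only [ENNReal.mul_rpow_of_nonneg (2 ^ s : ℝ≥0∞) _ hq.le]
        rw [lintegral_const_mul' _ _ (ENNReal.rpow_ne_top_of_nonneg hq.le
            (ENNReal.rpow_ne_top_of_nonneg hs0.le ENNReal.ofNat_ne_top)),
          ENNReal.mul_rpow_of_nonneg _ _ (by positivity), ← ENNReal.rpow_mul (2 ^ s),
          mul_one_div_cancel hq.ne', ENNReal.rpow_one]
    _ ≤ 2 ^ s * (C * K) := by gcongr
    _ = _ := by
        rw [ENNReal.coe_mul, ENNReal.coe_rpow_of_nonneg _ hs0.le, mul_assoc]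
        rfl

/-- The lower estimate behind the necessity of the second condition when `s < r`, for a truncation
`k` of the kernel `log (t / x) / V(t)`. -/
theorem IsWeight.lintegral_kernel_rpow_le (hν : IsWeight ν) {r r' p q s : ℝ} (hs : 1 ≤ s)
    (hr : r.HolderConjugate r') (hp : r = s * p) (hpq : p.HolderConjugate q) :
    ∃ C : ℝ≥0, ∀ (ω : Measure ℝ) [IsFiniteMeasure ω] [NullSingletonClass ω] (α β : ℝ), 0 < α →
      ω (Ioo α β)ᶜ = 0 → ∀ K : ℝ≥0∞,
      (∀ f : ℝ → ℝ≥0∞, Antitone f →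
        ∫⁻ u, (∫⁻ v in Ioi u, f v ∂logMeasure) ^ s ∂ω ≤ K * (∫⁻ u, f u ^ r ∂ν) ^ (1 / p)) →
      ∀ k : ℝ → ℝ → ℝ≥0∞, Measurable (Function.uncurry k) →
      (∀ x t, k x t ≤ logK x t * (ν (Iio t))⁻¹) → (∀ x y t, 0 < x → x ≤ y → 0 < t → k y t ≤ k x t) →
      ∀ B : ℝ≥0∞, B ≠ ∞ → (∀ x, ∫⁻ t, k x t ^ r' ∂ν ≤ B) →
      (∫⁻ x, ω (Iio x) ^ (q - 1) * (∫⁻ t, k x t ^ r' ∂ν) ^ (s * q / r') ∂ω) ^ (1 / q) ≤ C * K := by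
  obtain ⟨C, hC⟩ := hν.hardy_Ioi hr
  have hs0 : 0 < s := by linarith
  have hp0 := hpq.pos
  have hq := hpq.symm.pos
  have hq1 := hpq.symm.lt
  have hr0 := hr.pos
  have hr'0 := hr.symm.pos
  have hp1 : 0 ≤ 1 / p := by positivity
  have hr1 : 0 < 1 / r := by positivity
  have hsr : s / r = 1 / p := by rw [hp]; field_simp
  have hqp : q / p = q - 1 := by
    rw [div_eq_iff hp0.ne']; have := hpq.mul_eq_add; linarith
  have hr'r : r' / r = r' - 1 := by
    rw [div_eq_iff hr0.ne']; have := hr.mul_eq_add; linarith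
  have he : s * q / r' = (s - 1) * q + 1 := by
    have h1 : 1 / r' = 1 - 1 / r := by
      have := hr.inv_add_inv_eq_one; simp only [one_div]; linarith
    have h2 : s * q * (1 / r) = q - 1 := by
      rw [← hqp, hp]; field_simp
    calc s * q / r' = s * q * (1 / r') := by ring
      _ = s * q - s * q * (1 / r) := by rw [h1]; ring
      _ = _ := by rw [h2]; ring
  refine ⟨2 ^ (q - 1) * C ^ (1 / p), fun ω _ _ α β hα hωsupp K H k hkm hkle hkanti B hB hkB => ?_⟩
  have hωae : ∀ᵐ x ∂ω, x ∈ Ioo α β := by rw [ae_iff]; exact hωsupp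
  have hVm := measurable_measure_Iio ν
  have hWm := measurable_measure_Iio ω
  have hk2 : ∀ x, Measurable (k x) := fun x => hkm.comp measurable_prodMk_left
  set Ψ : ℝ → ℝ≥0∞ := fun x => ∫⁻ t, k x t ^ r' ∂ν with hΨ
  have hΨm : Measurable Ψ := (hkm.pow_const _).lintegral_prod_right
  set lam : ℝ → ℝ≥0∞ := fun x => ω (Iio x) ^ (q - 1) * Ψ x ^ ((s - 1) * q) with hlam
  have hlamm : Measurable lam := (hWm.pow_const _).fun_mul (hΨm.pow_const _)
  have hsq : 0 ≤ (s - 1) * q := mul_nonneg (by linarith) hq.le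
  set Q := ∫⁻ x, ω (Iio x) ^ (q - 1) * Ψ x ^ (s * q / r') ∂ω with hQ
  have hQfin : Q ≠ ∞ := by
    have h1 : Q ≤ ∫⁻ _, ω univ ^ (q - 1) * B ^ (s * q / r') ∂ω := by
      refine lintegral_mono fun x => ?_
      gcongr
      · exact subset_univ _
      · exact hkB x
    refine ne_top_of_le_ne_top ?_ h1
    rw [lintegral_const]
    exact ENNReal.mul_ne_top (ENNReal.mul_ne_top
      (ENNReal.rpow_ne_top_of_nonneg (by linarith) (measure_ne_top _ _))
      (ENNReal.rpow_ne_top_of_nonneg (by positivity) hB)) (measure_ne_top _ _)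
  set G : ℝ → ℝ≥0∞ := fun t => ∫⁻ x in Iio t, k x t ^ r' * lam x ∂ω with hG
  have hGm : Measurable G := by
    have : G = fun t => ∫⁻ x, {z : ℝ × ℝ | z.2 < z.1}.indicator
        (fun z => k z.2 z.1 ^ r' * lam z.2) (t, x) ∂ω := by
      ext t
      rw [hG]
      beta_reduce
      rw [← lintegral_indicator measurableSet_Iio]
      rfl
    rw [this]
    refine Measurable.lintegral_prod_right' (f := {z : ℝ × ℝ | z.2 < z.1}.indicator
        (fun z => k z.2 z.1 ^ r' * lam z.2)) ?_
    exact (((hkm.comp measurable_swap).pow_const _).mul (hlamm.comp measurable_snd)).indicator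
      (measurableSet_lt measurable_snd measurable_fst)
  set h : ℝ → ℝ≥0∞ := fun t => (ν (Iio t))⁻¹ * G t ^ (1 / r) with hh
  have hhm : Measurable h := hVm.inv.fun_mul (hGm.pow_const _)
  set f : ℝ → ℝ≥0∞ := fun y => ∫⁻ t in Ioi y, h t ∂ν with hf
  have hfanti : Antitone f := fun _ _ hxy => lintegral_mono_set (Ioi_subset_Ioi hxy)
  have hupper : ∫⁻ u, f u ^ r ∂ν ≤ C * Q := by
    refine (hC h hhm).trans ?_
    gcongr
    calc ∫⁻ t, (h t * ν (Iio t)) ^ r ∂ν ≤ ∫⁻ t, ∫⁻ x, k x t ^ r' * lam x ∂ω ∂ν := by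
          refine lintegral_mono_ae ?_
          filter_upwards [hν.ae_pos] with t ht
          rw [hh]
          beta_reduce
          rw [mul_right_comm, ENNReal.inv_mul_cancel (hν.ne_zero ht) (hν.ne_top t), one_mul,
            ← ENNReal.rpow_mul, one_div_mul_cancel hr0.ne', ENNReal.rpow_one]
          exact setLIntegral_le_lintegral _ _
      _ = ∫⁻ x, ∫⁻ t, k x t ^ r' * lam x ∂ν ∂ω :=
          lintegral_lintegral_swap ((((hkm.comp measurable_swap).pow_const _).mul
            (hlamm.comp measurable_snd)).aemeasurable)
      _ = Q := by
          refine lintegral_congr fun x => ?_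
          rw [lintegral_mul_const _ ((hk2 _).pow_const _), he,
            ENNReal.rpow_add_of_nonneg _ _ hsq zero_le_one, ENNReal.rpow_one]
          simp only [hlam, hΨ]
          ring
  have hlower : ∀ y, 0 < y → Ψ y ^ (s * q / r') * ω (Iio y) ^ (q - 1) ≤
      2 ^ (q - 1) * (∫⁻ v in Ioi y, f v ∂logMeasure) ^ s := by
    intro y hy
    set Λ := ∫⁻ x in Iio y, lam x ∂ω with hΛ
    have hΛle : Ψ y ^ ((s - 1) * q) * ω (Iio y) ^ q ≤ 2 ^ q * Λ := by
      have h1 := measure_rpow_le_lintegral (ω := ω) (Δ := Iio y ∩ Ioo α β)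
        (measurableSet_Iio.inter measurableSet_Ioo) inter_subset_right (measure_ne_top _ _)
        (γ := q - 1) (by linarith)
      have h2 : ω (Iio y ∩ Ioo α β) = ω (Iio y) :=
        measure_inter_conull hωsupp
      rw [sub_add_cancel, h2] at h1
      calc _ ≤ Ψ y ^ ((s - 1) * q) * (2 ^ q * ∫⁻ x in Iio y, ω (Iio x) ^ (q - 1) ∂ω) := by
            gcongr
            exact h1.trans (by gcongr; exact inter_subset_left)
        _ = 2 ^ q * ∫⁻ x in Iio y, ω (Iio x) ^ (q - 1) * Ψ y ^ ((s - 1) * q) ∂ω := by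
            rw [lintegral_mul_const _ (hWm.pow_const _)]
            ring
        _ ≤ 2 ^ q * Λ := by
            gcongr 2 ^ q * ?_
            refine setLIntegral_mono_ae' measurableSet_Iio ?_
            filter_upwards [hωae] with x hx hxy
            rw [hlam]
            beta_reduce
            gcongr
            refine lintegral_mono_ae ?_
            filter_upwards [hν.ae_pos] with t ht
            exact ENNReal.rpow_le_rpow (hkanti x y t (hα.trans hx.1) (le_of_lt hxy) ht) hr'0.le
    have hFle : Ψ y * Λ ^ (1 / r) ≤ ∫⁻ v in Ioi y, f v ∂logMeasure := by
      calc Ψ y * Λ ^ (1 / r) = ∫⁻ t, k y t ^ r' * Λ ^ (1 / r) ∂ν := by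
            rw [lintegral_mul_const _ ((hk2 _).pow_const _)]
        _ ≤ ∫⁻ t, h t * ∫⁻ _ in Iio t, 1 ∂(logMeasure.restrict (Ioi y)) ∂ν := by
            refine lintegral_mono_ae ?_
            filter_upwards [hν.ae_pos] with t ht
            rw [setLIntegral_one, logMeasure_restrict_Ioi_Iio hy ht]
            rcases le_or_gt t y with hty | hty
            · have : k y t = 0 := le_antisymm
                ((hkle y t).trans_eq (by rw [logK_eq_zero ht hty, zero_mul])) zero_le
              rw [this, ENNReal.zero_rpow_of_pos hr'0, zero_mul]
              exact zero_le
            · have h3 : k y t ^ r' * Λ ≤ G t := by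
                calc k y t ^ r' * Λ = ∫⁻ x in Iio y, k y t ^ r' * lam x ∂ω := by
                      rw [lintegral_const_mul _ hlamm]
                  _ ≤ ∫⁻ x in Iio y, k x t ^ r' * lam x ∂ω := by
                      refine setLIntegral_mono_ae' measurableSet_Iio ?_
                      filter_upwards [hωae] with x hx hxy
                      gcongr
                      exact hkanti x y t (hα.trans hx.1) (le_of_lt hxy) ht
                  _ ≤ G t := lintegral_mono_set (Iio_subset_Iio hty.le)
              calc k y t ^ r' * Λ ^ (1 / r)
                  = k y t * (k y t ^ r' * Λ) ^ (1 / r) := by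
                    rw [ENNReal.mul_rpow_of_nonneg _ _ hr1.le, ← ENNReal.rpow_mul,
                      mul_one_div, hr'r, ← mul_assoc, mul_comm (k y t),
                      rpow_sub_one_mul _ hr.symm.lt.le]
                _ ≤ (logK y t * (ν (Iio t))⁻¹) * G t ^ (1 / r) := by
                    gcongr
                    exact hkle y t
                _ = _ := by rw [hh]; ring
        _ = ∫⁻ v in Ioi y, 1 * ∫⁻ t in Ioi v, h t ∂ν ∂logMeasure :=
            lintegral_mul_lintegral_Iio _ _ hhm measurable_const
        _ = _ := by simp only [one_mul, hf]
    calc Ψ y ^ (s * q / r') * ω (Iio y) ^ (q - 1)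
        = Ψ y ^ s * (Ψ y ^ ((s - 1) * q) * ω (Iio y) ^ q) ^ (1 / p) := by
          rw [ENNReal.mul_rpow_of_nonneg _ _ hp1, ← ENNReal.rpow_mul, ← ENNReal.rpow_mul,
            mul_one_div q, hqp, ← mul_assoc,
            ← ENNReal.rpow_add_of_nonneg _ _ hs0.le (mul_nonneg hsq hp1), mul_assoc (s - 1),
            mul_one_div q, hqp, he]
          congr 2
          ring
      _ ≤ Ψ y ^ s * (2 ^ q * Λ) ^ (1 / p) := by gcongr
      _ = 2 ^ (q - 1) * (Ψ y * Λ ^ (1 / r)) ^ s := by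
          rw [ENNReal.mul_rpow_of_nonneg _ _ hp1, ENNReal.mul_rpow_of_nonneg _ _ hs0.le,
            ← ENNReal.rpow_mul, ← ENNReal.rpow_mul, mul_one_div q, hqp, one_div_mul_eq_div, hsr]
          ring
      _ ≤ _ := by gcongr
  have h2f : (2 : ℝ≥0∞) ^ (q - 1) ≠ ∞ :=
    ENNReal.rpow_ne_top_of_nonneg (by linarith) ENNReal.ofNat_ne_top
  have hfinal : 1 * Q ≤ (2 ^ (q - 1) * C ^ (1 / p) * K) * Q ^ (1 / p) := by
    calc 1 * Q ≤ ∫⁻ y, 2 ^ (q - 1) * (∫⁻ v in Ioi y, f v ∂logMeasure) ^ s ∂ω := by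
          rw [one_mul]
          refine lintegral_mono_ae ?_
          filter_upwards [hωae] with y hy
          rw [mul_comm]
          exact hlower y (hα.trans hy.1)
      _ = 2 ^ (q - 1) * ∫⁻ y, (∫⁻ v in Ioi y, f v ∂logMeasure) ^ s ∂ω :=
          lintegral_const_mul' _ _ h2f
      _ ≤ 2 ^ (q - 1) * (K * (C * Q) ^ (1 / p)) := by
          gcongr
          exact (H f hfanti).trans (by gcongr)
      _ = _ := by
          rw [ENNReal.mul_rpow_of_nonneg _ _ hp1]
          ring
  have h5 := mul_rpow_inv_le_of_le hpq hQfin hfinal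
  rw [one_mul] at h5
  refine h5.trans_eq ?_
  rw [ENNReal.coe_mul, ENNReal.coe_rpow_of_nonneg _ (by linarith : 0 ≤ q - 1),
    ENNReal.coe_rpow_of_nonneg _ hp1]
  rfl

end

theorem iUnion_Ioo_nat : ⋃ n : ℕ, Ioo (1 / ((n : ℝ) + 1)) (n : ℝ) = Ioi 0 := by
  ext x
  simp only [mem_iUnion, mem_Ioo, mem_Ioi]
  constructor
  · rintro ⟨n, hn, -⟩
    exact lt_trans (by positivity) hn
  · intro hx
    obtain ⟨n₁, hn₁⟩ := exists_nat_one_div_lt hx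
    obtain ⟨n₂, hn₂⟩ := exists_nat_gt x
    refine ⟨max n₁ n₂, ?_, hn₂.trans_le (by exact_mod_cast le_max_right _ _)⟩
    refine lt_of_le_of_lt ?_ hn₁
    have : (n₁ : ℝ) ≤ ((max n₁ n₂ : ℕ) : ℝ) := by exact_mod_cast le_max_left _ _
    gcongr

theorem monotone_Ioo_nat : Monotone fun n : ℕ => Ioo (1 / ((n : ℝ) + 1)) (n : ℝ) := by
  intro i j hij
  have : (i : ℝ) ≤ j := by exact_mod_cast hij
  refine Ioo_subset_Ioo ?_ this
  gcongr

theorem iSup_mul_of_monotone {f g : ℕ → ℝ≥0∞} (hf : Monotone f) (hg : Monotone g) :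
    (⨆ n, f n) * ⨆ n, g n = ⨆ n, f n * g n := by
  refine le_antisymm ?_ (iSup_le fun n => mul_le_mul' (le_iSup f n) (le_iSup g n))
  rw [ENNReal.iSup_mul]
  refine iSup_le fun i => ?_
  rw [ENNReal.mul_iSup]
  refine iSup_le fun j => le_trans ?_ (le_iSup _ (max i j))
  exact mul_le_mul' (hf (le_max_left _ _)) (hg (le_max_right _ _))

section

variable {ν : Measure ℝ} [SFinite ν] [NullSingletonClass ν]

theorem IsWeight.lintegral_tail_rpow_le (hν : IsWeight ν) {r r' p q s : ℝ} (hs : 1 ≤ s)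
    (hr : r.HolderConjugate r') (hp : r = s * p) (hpq : p.HolderConjugate q) :
    ∃ C : ℝ≥0, ∀ (ω : Measure ℝ) [NullSingletonClass ω], ω (Iic 0) = 0 →
      (∀ x y, 0 < x → ω (Ioo x y) ≠ ∞) → ∀ K : ℝ≥0∞,
      (∀ f : ℝ → ℝ≥0∞, Antitone f →
        ∫⁻ u, (∫⁻ v in Ioi u, f v ∂logMeasure) ^ s ∂ω ≤ K * (∫⁻ u, f u ^ r ∂ν) ^ (1 / p)) →
      (∫⁻ x, ω (Iio x) ^ (q - 1) * tail ν r' x ^ (s * q / r') ∂ω) ^ (1 / q) ≤ C * K := by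
  obtain ⟨C, hC⟩ := hν.lintegral_kernel_rpow_le hs hr hp hpq
  refine ⟨C, fun ω _ hω hωfin K H => ?_⟩
  have hs0 : 0 < s := by linarith
  have hq := hpq.symm.pos
  have hq1 := hpq.symm.lt
  have hr'0 := hr.symm.pos
  have hq1' : 0 < 1 / q := by positivity
  have he : 0 < s * q / r' := by positivity
  have hVm := measurable_measure_Iio ν
  set I : ℕ → Set ℝ := fun n => Ioo (1 / ((n : ℝ) + 1)) n with hI
  have hIm : ∀ n, MeasurableSet (I n) := fun n => measurableSet_Ioo
  set k : ℕ → ℝ → ℝ → ℝ≥0∞ := fun n x => trunc (fun t => logK x t * (ν (Iio t))⁻¹) n with hk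
  have hkm : ∀ n, Measurable (Function.uncurry (k n)) := fun n => by
    have h1 : Measurable fun z : ℝ × ℝ => min (logK z.1 z.2 * (ν (Iio z.2))⁻¹) (n : ℝ≥0∞) :=
      (measurable_logK.mul (hVm.inv.comp measurable_snd)).min measurable_const
    exact h1.indicator (s := {z : ℝ × ℝ | z.2 < n}) (measurableSet_lt measurable_snd measurable_const)
  have hk2 : ∀ n x, Measurable (k n x) := fun n x => (hkm n).comp measurable_prodMk_left
  have hkmono : ∀ x t, Monotone fun n => k n x t := fun x t i j hij => trunc_mono _ hij t
  set Ψ : ℕ → ℝ → ℝ≥0∞ := fun n x => ∫⁻ t, k n x t ^ r' ∂ν with hΨ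
  have hΨm : ∀ n, Measurable (Ψ n) := fun n => ((hkm n).pow_const _).lintegral_prod_right
  have hΨmono : ∀ x, Monotone fun n => Ψ n x := fun x i j hij =>
    lintegral_mono fun t => ENNReal.rpow_le_rpow (hkmono x t hij) hr'0.le
  have hΨsup : ∀ x, 0 < x → ⨆ n, Ψ n x = tail ν r' x := by
    intro x hx
    rw [hΨ]
    beta_reduce
    rw [← lintegral_iSup (fun n => (hk2 n x).pow_const _)
      (fun i j hij t => ENNReal.rpow_le_rpow (hkmono x t hij) hr'0.le),
      ← lintegral_tail hν.null hr'0 hx]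
    refine lintegral_congr_ae ?_
    filter_upwards [hν.ae_pos] with t ht
    rw [← iSup_rpow _ hr'0, logMeasure_restrict_Ioi_Iio hx ht]
    congr 1
    exact iSup_trunc _ t
  set W : ℕ → ℝ → ℝ≥0∞ := fun n x => ω.restrict (I n) (Iio x) with hW
  have hWmono : ∀ x, Monotone fun n => W n x := fun x i j hij =>
    Measure.restrict_mono (monotone_Ioo_nat hij) le_rfl _
  have hWsup : ∀ x, ⨆ n, W n x = ω (Iio x) := by
    intro x
    simp only [hW, Measure.restrict_apply measurableSet_Iio]
    rw [← Monotone.measure_iUnion fun i j hij => inter_subset_inter_right _ (monotone_Ioo_nat hij),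
      ← inter_iUnion, iUnion_Ioo_nat]
    refine measure_inter_conull ?_
    rwa [compl_Ioi]
  have hfin : ∀ n, IsFiniteMeasure (ω.restrict (I n)) := fun n =>
    ⟨by rw [Measure.restrict_apply_univ]; exact (hωfin _ _ (by positivity)).lt_top⟩
  have main : ∀ n, (∫⁻ x, W n x ^ (q - 1) * Ψ n x ^ (s * q / r') ∂(ω.restrict (I n))) ^ (1 / q) ≤
      C * K := by
    intro n
    have := hfin n
    refine hC (ω.restrict (I n)) (1 / ((n : ℝ) + 1)) n (by positivity) ?_ K (fun f hf => ?_) (k n)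
      (hkm n) (fun x t => trunc_le _ n t) (fun x y t hx hxy ht => ?_) (n ^ r' * ν (Iio n))
      (ENNReal.mul_ne_top (ENNReal.rpow_ne_top_of_nonneg hr'0.le (ENNReal.natCast_ne_top n))
        (hν.ne_top _)) (fun x => lintegral_trunc_rpow_le ν _ n hr'0)
    · rw [Measure.restrict_apply (hIm n).compl, compl_inter_self, measure_empty]
    · exact (setLIntegral_le_lintegral _ _).trans (H f hf)
    · refine trunc_le_trunc n ?_
      gcongr
      exact logK_anti hx ht hxy
  set c : ℕ → ℝ → ℝ≥0∞ := fun n => (I n).indicator 1 with hc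
  have hcmono : ∀ x, Monotone fun n => c n x := fun x i j hij =>
    indicator_le_indicator_of_subset (monotone_Ioo_nat hij) (fun _ => zero_le) x
  have hcsup : ∀ x, 0 < x → ⨆ n, c n x = 1 := by
    intro x hx
    refine le_antisymm (iSup_le fun n => indicator_le_self' (fun _ _ => zero_le) x) ?_
    rw [← mem_Ioi, ← iUnion_Ioo_nat] at hx
    obtain ⟨n, hn⟩ := mem_iUnion.1 hx
    refine le_trans ?_ (le_iSup (fun n => c n x) n)
    rw [hc]
    beta_reduce
    rw [indicator_of_mem (show x ∈ I n from hn)]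
    rfl
  have hAmono : ∀ x, Monotone fun n => W n x ^ (q - 1) := fun x i j hij =>
    ENNReal.rpow_le_rpow (hWmono x hij) (by linarith)
  have hBmono : ∀ x, Monotone fun n => Ψ n x ^ (s * q / r') := fun x i j hij =>
    ENNReal.rpow_le_rpow (hΨmono x hij) he.le
  have hABmono : ∀ x, Monotone fun n => W n x ^ (q - 1) * Ψ n x ^ (s * q / r') :=
    fun x i j hij => mul_le_mul' (hAmono x hij) (hBmono x hij)
  have hsup : ∫⁻ x, ω (Iio x) ^ (q - 1) * tail ν r' x ^ (s * q / r') ∂ω =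
      ⨆ n, ∫⁻ x, W n x ^ (q - 1) * Ψ n x ^ (s * q / r') ∂(ω.restrict (I n)) := by
    have h1 : ∀ n, ∫⁻ x, W n x ^ (q - 1) * Ψ n x ^ (s * q / r') ∂(ω.restrict (I n)) =
        ∫⁻ x, c n x * (W n x ^ (q - 1) * Ψ n x ^ (s * q / r')) ∂ω := fun n => by
      rw [← lintegral_indicator (hIm n)]
      refine lintegral_congr fun x => ?_
      by_cases hx : x ∈ I n
      · simp only [hc, indicator_of_mem hx, Pi.one_apply, one_mul]
      · simp only [hc, indicator_of_notMem hx, zero_mul]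
    simp only [h1]
    rw [← lintegral_iSup]
    · refine lintegral_congr_ae ?_
      filter_upwards [ae_pos_of_null hω] with x hx
      rw [← iSup_mul_of_monotone (hcmono x) (hABmono x), hcsup x hx, one_mul,
        ← iSup_mul_of_monotone (hAmono x) (hBmono x), ← iSup_rpow _ (by linarith), hWsup,
        ← iSup_rpow _ he, hΨsup x hx]
    · exact fun n => (measurable_one.indicator (hIm n)).mul
        (((measurable_measure_Iio _).pow_const _).mul ((hΨm n).pow_const _))
    · exact fun i j hij x => mul_le_mul' (hcmono x hij) (hABmono x hij)
  rw [hsup, iSup_rpow _ hq1']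
  exact iSup_le main

end

/-! ### Slowly varying functions -/

theorem pw_mul {t : ℝ} (ht : 0 < t) (α β : ℝ) : pw t α * pw t β = pw t (α + β) :=
  (ENNReal.rpow_add _ _ (by simpa using ht) ENNReal.ofReal_ne_top).symm

theorem pw_mul_left {t u : ℝ} (ht : 0 ≤ t) (α : ℝ) (hα : 0 ≤ α) : pw (t * u) α = pw t α * pw u α := by
  rw [pw, ENNReal.ofReal_mul ht, ENNReal.mul_rpow_of_nonneg _ _ hα, pw, pw]

theorem pw_zero (t : ℝ) : pw t 0 = 1 := ENNReal.rpow_zero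

theorem pw_mono {t u : ℝ} (h : t ≤ u) {α : ℝ} (hα : 0 ≤ α) : pw t α ≤ pw u α :=
  ENNReal.rpow_le_rpow (ENNReal.ofReal_le_ofReal h) hα

theorem pw_rpow {t : ℝ} (α β : ℝ) : pw t α ^ β = pw t (α * β) := (ENNReal.rpow_mul _ _ _).symm

theorem pw_of_rpow {t : ℝ} (ht : 0 < t) (α β : ℝ) : pw (t ^ α) β = pw t (α * β) := by
  rw [pw, ← ENNReal.ofReal_rpow_of_pos ht, ← ENNReal.rpow_mul, pw]

/-- The quantitative consequences of slow variation on `(0, ∞)`. -/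
structure HasSlowBound (a : ℝ → ℝ≥0∞) : Prop where
  aemeasurable : AEMeasurable a logMeasure
  ne_zero : ∀ t, 0 < t → a t ≠ 0
  ne_top : ∀ t, 0 < t → a t ≠ ∞
  bound : ∀ ε : ℝ, 0 < ε → ∃ C : ℝ≥0, ∀ t u, 0 < t → 0 < u →
    a t ≤ C * max (pw (t / u) ε) (pw (u / t) ε) * a u

theorem SlowlyVarying.bound_of_le {a : ℝ → ℝ≥0∞} (ha : SlowlyVarying (Ioi 0) a) {ε : ℝ}
    (hε : 0 < ε) : ∃ C : ℝ≥0, ∀ t u, 0 < t → t ≤ u →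
      a t ≤ C * pw (u / t) ε * a u ∧ a u ≤ C * pw (u / t) ε * a t := by
  obtain ⟨g, hg, c, hc, hcg⟩ := ha.equiv_mono ε hε
  obtain ⟨g', hg', c', hc', hcg'⟩ := ha.equiv_anti ε hε
  refine ⟨max (c * c) (c' * c'), fun t u ht htu => ?_⟩
  have hu : 0 < u := ht.trans_le htu
  have key1 : pw t ε * a t ≤ c * c * (pw u ε * a u) := by
    calc pw t ε * a t ≤ c * g t := (hcg t ht).1
      _ ≤ c * g u := by gcongr; exact hg ht hu htu
      _ ≤ c * (c * (pw u ε * a u)) := by gcongr; exact (hcg u hu).2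
      _ = _ := by ring
  have key2 : pw u (-ε) * a u ≤ c' * c' * (pw t (-ε) * a t) := by
    calc pw u (-ε) * a u ≤ c' * g' u := (hcg' u hu).1
      _ ≤ c' * g' t := by gcongr; exact hg' ht hu htu
      _ ≤ c' * (c' * (pw t (-ε) * a t)) := by gcongr; exact (hcg' t ht).2
      _ = _ := by ring
  have hdiv : pw (u / t) ε = pw t (-ε) * pw u ε := by
    rw [pw, pw, pw, ENNReal.ofReal_div_of_pos ht, div_eq_mul_inv,
      ENNReal.mul_rpow_of_nonneg _ _ hε.le, ENNReal.inv_rpow, ENNReal.rpow_neg, mul_comm]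
  have hone : ∀ {z : ℝ}, 0 < z → pw z ε * pw z (-ε) = 1 := fun hz => by
    rw [pw_mul hz, add_neg_cancel, pw_zero]
  constructor
  · calc a t = pw t (-ε) * (pw t ε * a t) := by
          rw [← mul_assoc, mul_comm (pw t (-ε)), hone ht, one_mul]
      _ ≤ pw t (-ε) * (c * c * (pw u ε * a u)) := by gcongr
      _ = ((c * c : ℝ≥0) : ℝ≥0∞) * pw (u / t) ε * a u := by
          rw [hdiv]; push_cast; ring
      _ ≤ _ := by
          gcongr
          exact le_max_left _ _
  · calc a u = pw u ε * (pw u (-ε) * a u) := by rw [← mul_assoc, hone hu, one_mul]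
      _ ≤ pw u ε * (c' * c' * (pw t (-ε) * a t)) := by gcongr
      _ = ((c' * c' : ℝ≥0) : ℝ≥0∞) * pw (u / t) ε * a t := by
          rw [hdiv]; push_cast; ring
      _ ≤ _ := by
          gcongr
          exact le_max_right _ _

theorem SlowlyVarying.hasSlowBound {a : ℝ → ℝ≥0∞} (ha : SlowlyVarying (Ioi 0) a) :
    HasSlowBound a := by
  have hb : ∀ ε : ℝ, 0 < ε → ∃ C : ℝ≥0, ∀ t u, 0 < t → 0 < u →
      a t ≤ C * max (pw (t / u) ε) (pw (u / t) ε) * a u := by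
    intro ε hε
    obtain ⟨C, hC⟩ := ha.bound_of_le hε
    refine ⟨C, fun t u ht hu => ?_⟩
    rcases le_total t u with h | h
    · refine (hC t u ht h).1.trans ?_
      gcongr
      exact le_max_right _ _
    · refine (hC u t hu h).2.trans ?_
      gcongr
      exact le_max_left _ _
  obtain ⟨C, hC⟩ := hb 1 one_pos
  have hmax : ∀ t u, 0 < t → 0 < u → max (pw (t / u) 1) (pw (u / t) 1) ≠ ∞ := fun t u ht hu =>
    (max_lt (pw_ne_top (by positivity) _).lt_top (pw_ne_top (by positivity) _).lt_top).ne
  refine ⟨ha.measurable.mono_ac (withDensity_absolutelyContinuous _ _), fun t ht h => ?_,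
    fun t ht h => ?_, hb⟩
  · obtain ⟨u, hu, hu0⟩ := ha.not_zero
    have := hC u t hu ht
    rw [h, mul_zero] at this
    exact hu0 (le_antisymm this zero_le)
  · obtain ⟨u, hu, hut⟩ := ha.not_top
    have := hC t u ht hu
    rw [h, top_le_iff] at this
    exact ENNReal.mul_ne_top (ENNReal.mul_ne_top ENNReal.coe_ne_top (hmax t u ht hu)) hut this

theorem HasSlowBound.bounded {a : ℝ → ℝ≥0∞} (ha : HasSlowBound a) {x y : ℝ} (hx : 0 < x) :
    ∃ B : ℝ≥0∞, B ≠ ∞ ∧ ∀ t ∈ Ioo x y, a t ≤ B := by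
  rcases le_or_gt y x with h | hxy
  · exact ⟨0, ENNReal.zero_ne_top, fun t ht => absurd (ht.1.trans ht.2) (not_lt.2 h)⟩
  have hy : 0 < y := hx.trans hxy
  obtain ⟨C, hC⟩ := ha.bound 1 one_pos
  refine ⟨C * pw (y / x) 1 * a y, ENNReal.mul_ne_top (ENNReal.mul_ne_top ENNReal.coe_ne_top
    (pw_ne_top (by positivity) _)) (ha.ne_top y hy), fun t ht => ?_⟩
  have ht0 : 0 < t := hx.trans ht.1
  refine (hC t y ht0 hy).trans ?_
  gcongr
  refine max_le (pw_mono ?_ zero_le_one) (pw_mono ?_ zero_le_one)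
  · calc t / y ≤ 1 := (div_le_one hy).2 ht.2.le
      _ ≤ y / x := (one_le_div hx).2 hxy.le
  · gcongr
    exact ht.1.le

/-! ### Changes of variables -/

theorem logMeasure_eq_smul_map {f f' : ℝ → ℝ} (hf : Measurable f) {κ : ℝ} (hκ : 0 ≤ κ)
    (hderiv : ∀ x ∈ Ioi (0 : ℝ), HasDerivWithinAt f (f' x) (Ioi 0) x)
    (hinj : InjOn f (Ioi 0)) (himg : f '' Ioi 0 = Ioi 0)
    (heq : ∀ x, 0 < x → |f' x| * (f x)⁻¹ = κ * x⁻¹) :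
    logMeasure = ENNReal.ofReal κ • logMeasure.map f := by
  have hpos : ∀ x, 0 < x → 0 < f x := fun x hx => by
    have : f x ∈ f '' Ioi 0 := mem_image_of_mem f hx
    rwa [himg] at this
  have hpw : ∀ {z : ℝ}, 0 < z → pw z (-1) = ENNReal.ofReal z⁻¹ := fun hz => by
    rw [pw, ENNReal.rpow_neg_one, ENNReal.ofReal_inv_of_pos hz]
  ext S hS
  rw [Measure.smul_apply, Measure.map_apply hf hS, smul_eq_mul, ← lintegral_indicator_one hS,
    ← lintegral_indicator_one (hf hS), lintegral_logMeasure, lintegral_logMeasure]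
  nth_rw 1 [← himg]
  rw [lintegral_image_eq_lintegral_abs_deriv_mul measurableSet_Ioi hderiv hinj,
    ← lintegral_const_mul' _ _ ENNReal.ofReal_ne_top]
  refine setLIntegral_congr_fun measurableSet_Ioi fun x hx => ?_
  have hx' : 0 < x := hx
  rw [hpw (hpos x hx), hpw hx', ← mul_assoc, ← mul_assoc, ← ENNReal.ofReal_mul (abs_nonneg _),
    ← ENNReal.ofReal_mul hκ, heq x hx]
  rfl

theorem rpow_image_Ioi {m : ℝ} (hm : m ≠ 0) : (fun x : ℝ => x ^ m) '' Ioi 0 = Ioi 0 := by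
  ext y
  constructor
  · rintro ⟨x, hx, rfl⟩
    exact Real.rpow_pos_of_pos hx m
  · intro hy
    exact ⟨y ^ m⁻¹, Real.rpow_pos_of_pos hy _, Real.rpow_inv_rpow (le_of_lt hy) hm⟩

theorem logMeasure_eq_smul_map_rpow {m : ℝ} (hm : m ≠ 0) :
    logMeasure = ENNReal.ofReal |m| • logMeasure.map fun x => x ^ m := by
  refine logMeasure_eq_smul_map (f' := fun x => m * x ^ (m - 1))
    (by fun_prop) (abs_nonneg m) (fun x hx => ?_) (fun x hx y hy h => ?_)
    (rpow_image_Ioi hm) (fun x hx => ?_)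
  · exact (Real.hasDerivAt_rpow_const (Or.inl (ne_of_gt hx))).hasDerivWithinAt
  · exact (Real.rpow_left_inj (le_of_lt hx) (le_of_lt hy) hm).1 h
  · rw [abs_mul, abs_of_pos (Real.rpow_pos_of_pos hx _), mul_assoc, ← Real.rpow_neg hx.le,
      ← Real.rpow_add hx, show m - 1 + -m = -1 by ring, Real.rpow_neg_one]

theorem logMeasure_map_mul {c : ℝ} (hc : 0 < c) : logMeasure.map (fun x => c * x) = logMeasure := by
  have h := logMeasure_eq_smul_map (f := fun x => c * x) (f' := fun _ => c) (κ := 1)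
    (by fun_prop) zero_le_one (fun x _ => by simpa using ((hasDerivAt_id x).const_mul c).hasDerivWithinAt)
    (fun x _ y _ h => mul_left_cancel₀ hc.ne' h) ?_ (fun x hx => ?_)
  · rw [ENNReal.ofReal_one, one_smul] at h
    exact h.symm
  · ext y
    constructor
    · rintro ⟨x, hx, rfl⟩
      exact mul_pos hc hx
    · intro hy
      exact ⟨y / c, div_pos hy hc, mul_div_cancel₀ _ hc.ne'⟩
  · rw [abs_of_pos hc]
    field_simp

theorem logMeasure_map_rpow {m : ℝ} (hm : m ≠ 0) :
    logMeasure.map (fun x => x ^ m) = (ENNReal.ofReal |m|)⁻¹ • logMeasure := by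
  have h0 : ENNReal.ofReal |m| ≠ 0 := by simpa using hm
  nth_rw 2 [logMeasure_eq_smul_map_rpow hm]
  rw [smul_smul, ENNReal.inv_mul_cancel h0 ENNReal.ofReal_ne_top, one_smul]

theorem aemeasurable_comp_rpow {m : ℝ} (hm : m ≠ 0) {g : ℝ → ℝ≥0∞} (hg : AEMeasurable g logMeasure) :
    AEMeasurable (fun x => g (x ^ m)) logMeasure := by
  refine AEMeasurable.comp_measurable (f := fun x : ℝ => x ^ m) ?_ (by fun_prop)
  rw [logMeasure_map_rpow hm]
  exact hg.mono_ac Measure.smul_absolutelyContinuous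

theorem exists_eLpNorm_comp_rpow {m : ℝ} (hm : m ≠ 0) (s : ℝ≥0∞) :
    ∃ κ : ℝ≥0∞, κ ≠ 0 ∧ κ ≠ ∞ ∧ ∀ g : ℝ → ℝ≥0∞, AEMeasurable g logMeasure →
      eLpNorm (fun x => g (x ^ m)) s logMeasure = κ * eLpNorm g s logMeasure := by
  have h0 : ENNReal.ofReal |m| ≠ 0 := by simpa using hm
  have h1 : (ENNReal.ofReal |m|)⁻¹ ≠ 0 := ENNReal.inv_ne_zero.2 ENNReal.ofReal_ne_top
  have h2 : (ENNReal.ofReal |m|)⁻¹ ≠ ∞ := ENNReal.inv_ne_top.2 h0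
  refine ⟨(ENNReal.ofReal |m|)⁻¹ ^ (1 / s).toReal, (ENNReal.rpow_pos (pos_iff_ne_zero.2 h1) h2).ne',
    ENNReal.rpow_ne_top_of_nonneg ENNReal.toReal_nonneg h2, fun g hg => ?_⟩
  rw [← smul_eq_mul, ← eLpNorm_smul_measure_of_ne_zero h1, ← logMeasure_map_rpow hm,
    eLpNorm_map_measure _ (by fun_prop)]
  · rfl
  · rw [logMeasure_map_rpow hm]
    exact (hg.mono_ac Measure.smul_absolutelyContinuous).aestronglyMeasurable

theorem eLpNorm_comp_mul {c : ℝ} (hc : 0 < c) (s : ℝ≥0∞) {g : ℝ → ℝ≥0∞}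
    (hg : AEMeasurable g logMeasure) :
    eLpNorm (fun x => g (c * x)) s logMeasure = eLpNorm g s logMeasure := by
  nth_rw 2 [← logMeasure_map_mul hc]
  rw [eLpNorm_map_measure _ (by fun_prop)]
  · rfl
  · rw [logMeasure_map_mul hc]
    exact hg.aestronglyMeasurable

theorem HasSlowBound.lowerStar {b : ℝ → ℝ≥0∞} (hb : HasSlowBound b) {m : ℝ} (hm : m ≠ 0) :
    HasSlowBound (lowerStar m b) := by
  refine ⟨aemeasurable_comp_rpow (one_div_ne_zero hm) hb.aemeasurable,
    fun t ht => hb.ne_zero _ (Real.rpow_pos_of_pos ht _),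
    fun t ht => hb.ne_top _ (Real.rpow_pos_of_pos ht _), fun ε hε => ?_⟩
  obtain ⟨C, hC⟩ := hb.bound (ε * |m|) (by positivity)
  refine ⟨C, fun t u ht hu => ?_⟩
  refine (hC _ _ (Real.rpow_pos_of_pos ht (1 / m)) (Real.rpow_pos_of_pos hu (1 / m))).trans ?_
  change _ ≤ C * max (pw (t / u) ε) (pw (u / t) ε) * b (u ^ (1 / m))
  refine mul_le_mul_left (mul_le_mul_right (le_of_eq ?_) _) _
  rw [← Real.div_rpow ht.le hu.le, ← Real.div_rpow hu.le ht.le, pw_of_rpow (div_pos ht hu),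
    pw_of_rpow (div_pos hu ht)]
  rcases lt_or_gt_of_ne hm with h | h
  · have hinv : ∀ z : ℝ, 0 < z → pw z (1 / m * (ε * |m|)) = pw z⁻¹ ε := fun z hz => by
      rw [abs_of_neg h, show 1 / m * (ε * -m) = -1 * ε by field_simp, ← pw_of_rpow hz,
        Real.rpow_neg_one]
    rw [hinv _ (div_pos ht hu), hinv _ (div_pos hu ht), inv_div, inv_div, max_comm]
  · rw [abs_of_pos h, show 1 / m * (ε * m) = ε by field_simp]

/-! ### Lebesgue norms -/

theorem recip_eq (r : ℝ≥0∞) : recip r = 1 / r.toReal := by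
  rw [recip, ENNReal.toReal_inv, one_div]

theorem lebNorm_eq {s : ℝ≥0∞} (hs : s ≠ 0) {I : Set ℝ} (hI : MeasurableSet I) (h0 : I ⊆ Ioi 0)
    (φ : ℝ → ℝ≥0∞) :
    lebNorm s I (fun t => pw t (-recip s) * φ t) = eLpNorm φ s (logMeasure.restrict I) := by
  have hdens : logMeasure.restrict I = (volume.restrict I).withDensity fun t => pw t (-1) :=
    logMeasure_restrict hI h0
  rcases eq_or_ne s ∞ with rfl | hst
  · have h1 : recip ∞ = 0 := by simp [recip]
    simp only [h1, neg_zero, pw_zero, one_mul]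
    rw [lebNorm, eLpNorm_exponent_top, eLpNorm_exponent_top]
    refine le_antisymm (eLpNormEssSup_mono_measure _ ?_) (eLpNormEssSup_mono_measure _ ?_)
    · rw [hdens]
      exact withDensity_absolutelyContinuous' (measurable_pw _).aemeasurable
        ((ae_restrict_iff' hI).2 (Filter.Eventually.of_forall fun t ht => pw_ne_zero (h0 ht) _))
    · rw [hdens]
      exact withDensity_absolutelyContinuous _ _
  · have hs0 : 0 < s.toReal := ENNReal.toReal_pos hs hst
    rw [lebNorm, eLpNorm_eq_lintegral_rpow_enorm_toReal hs hst,
      eLpNorm_eq_lintegral_rpow_enorm_toReal hs hst, setLIntegral_logMeasure hI h0]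
    congr 1
    refine setLIntegral_congr_fun hI fun t _ => ?_
    simp only [enorm_eq_self]
    rw [ENNReal.mul_rpow_of_nonneg _ _ hs0.le, pw_rpow, recip_eq]
    congr 2
    field_simp

theorem logMeasure_restrict_Ioi : logMeasure.restrict (Ioi 0) = logMeasure :=
  Measure.restrict_eq_self_of_ae_mem (ae_pos_of_null logMeasure_Iic)

/-- The measure `a(t)^r dt / t`. -/
def weight (a : ℝ → ℝ≥0∞) (r : ℝ) : Measure ℝ := logMeasure.withDensity fun t => a t ^ r

instance (a : ℝ → ℝ≥0∞) (r : ℝ) : SFinite (weight a r) :=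
  inferInstanceAs (SFinite (Measure.withDensity _ _))

instance (a : ℝ → ℝ≥0∞) (r : ℝ) : NullSingletonClass (weight a r) :=
  inferInstanceAs (NullSingletonClass (Measure.withDensity _ _))

theorem weight_Iic (a : ℝ → ℝ≥0∞) (r : ℝ) : weight a r (Iic 0) = 0 :=
  withDensity_absolutelyContinuous _ _ logMeasure_Iic

section

variable {a : ℝ → ℝ≥0∞} {r : ℝ}

theorem HasSlowBound.setLIntegral_weight (ha : HasSlowBound a) (hr : 0 ≤ r) {S : Set ℝ}
    (hS : MeasurableSet S) (g : ℝ → ℝ≥0∞) :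
    ∫⁻ t in S, g t ∂(weight a r) = ∫⁻ t in S, a t ^ r * g t ∂logMeasure := by
  rw [weight, restrict_withDensity hS,
    lintegral_withDensity_eq_lintegral_mul_non_measurable₀ _ (ha.aemeasurable.pow_const _).restrict]
  · rfl
  · refine ae_restrict_of_ae ?_
    filter_upwards [ae_pos_of_null logMeasure_Iic] with t ht
    exact (ENNReal.rpow_ne_top_of_nonneg hr (ha.ne_top t ht)).lt_top

theorem HasSlowBound.lintegral_weight (ha : HasSlowBound a) (hr : 0 ≤ r) (g : ℝ → ℝ≥0∞) :
    ∫⁻ t, g t ∂(weight a r) = ∫⁻ t, a t ^ r * g t ∂logMeasure := by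
  have := ha.setLIntegral_weight hr MeasurableSet.univ g
  rwa [Measure.restrict_univ, Measure.restrict_univ] at this

theorem HasSlowBound.weight_Ioo_ne_top (ha : HasSlowBound a) (hr : 0 ≤ r) {x y : ℝ} (hx : 0 < x) :
    weight a r (Ioo x y) ≠ ∞ := by
  rcases le_or_gt y x with h | hxy
  · rw [Ioo_eq_empty (not_lt.2 h), measure_empty]
    exact ENNReal.zero_ne_top
  obtain ⟨B, hB, hle⟩ := ha.bounded (y := y) hx
  rw [weight, withDensity_apply _ measurableSet_Ioo]
  refine ne_top_of_le_ne_top ?_ (setLIntegral_mono' (g := fun _ => B ^ r) measurableSet_Ioo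
    fun t ht => ENNReal.rpow_le_rpow (hle t ht) hr)
  rw [setLIntegral_const, logMeasure_Ioo hx (hx.trans hxy)]
  exact ENNReal.mul_ne_top (ENNReal.rpow_ne_top_of_nonneg hr hB) (logK_ne_top _ _)

theorem HasSlowBound.weight_Ioo_ne_zero (ha : HasSlowBound a) {x y : ℝ} (hx : 0 < x)
    (hxy : x < y) : weight a r (Ioo x y) ≠ 0 := by
  rw [weight, Ne, withDensity_apply_eq_zero' (ha.aemeasurable.pow_const _)]
  have : {t | a t ^ r ≠ 0} ∩ Ioo x y = Ioo x y := by
    refine inter_eq_right.2 fun t ht => ?_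
    have ht0 : 0 < t := hx.trans ht.1
    exact (ENNReal.rpow_pos (pos_iff_ne_zero.2 (ha.ne_zero t ht0)) (ha.ne_top t ht0)).ne'
  rw [this, logMeasure_Ioo hx (hx.trans hxy)]
  exact logK_ne_zero hx hxy

theorem HasSlowBound.weight_Iio_ne_zero (ha : HasSlowBound a) {x : ℝ} (hx : 0 < x) :
    weight a r (Iio x) ≠ 0 := fun h =>
  ha.weight_Ioo_ne_zero (x := x / 2) (y := x) (by linarith) (by linarith)
    (measure_mono_null (fun _ ht => ht.2) h)

theorem HasSlowBound.isWeight (ha : HasSlowBound a) (hr : 0 ≤ r) {x : ℝ} (hx : 0 < x)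
    (hfin : weight a r (Iio x) ≠ ∞) (htot : weight a r univ = ∞) : IsWeight (weight a r) := by
  refine ⟨weight_Iic a r, fun y => ?_, fun x y hx hxy => ha.weight_Ioo_ne_zero hx hxy, htot⟩
  have h1 : Iio y ⊆ Iio x ∪ ({x} ∪ Ioo x y) := fun t ht => by
    rcases lt_trichotomy t x with h | h | h
    · exact Or.inl h
    · exact Or.inr (Or.inl h)
    · exact Or.inr (Or.inr ⟨h, ht⟩)
  refine ne_top_of_le_ne_top ?_ ((measure_mono h1).trans ((measure_union_le _ _).trans
    (add_le_add_right (measure_union_le _ _) _)))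
  rw [measure_singleton, zero_add]
  exact ENNReal.add_ne_top.2 ⟨hfin, ha.weight_Ioo_ne_top hr hx⟩

theorem restrict_Iio_eq {m : Measure ℝ} (h : m (Iic 0) = 0) (x : ℝ) :
    m.restrict (Iio x) = m.restrict (Ioo 0 x) := by
  refine Measure.restrict_congr_set ?_
  filter_upwards [ae_pos_of_null h] with t ht
  exact propext ⟨fun hx => ⟨ht, hx⟩, fun hx => hx.2⟩

theorem weight_Iio (a : ℝ → ℝ≥0∞) (r : ℝ) (x : ℝ) :
    weight a r (Iio x) = ∫⁻ t in Ioo 0 x, a t ^ r ∂logMeasure := by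
  rw [weight, withDensity_apply _ measurableSet_Iio, restrict_Iio_eq logMeasure_Iic]

theorem weight_Iio_eq_V (a : ℝ → ℝ≥0∞) (r : ℝ≥0∞) (x : ℝ) : weight a r.toReal (Iio x) = V r a x := by
  rw [weight_Iio, setLIntegral_logMeasure measurableSet_Ioo fun t ht => ht.1, V]

end

/-! ### Norms of non-negative functions -/

theorem eLpNorm_le_mul {α : Type*} [MeasurableSpace α] {μ : Measure α} {f g : α → ℝ≥0∞} {c : ℝ≥0}
    (s : ℝ≥0∞) (h : ∀ᵐ x ∂μ, f x ≤ c * g x) : eLpNorm f s μ ≤ c * eLpNorm g s μ :=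
  eLpNorm_le_nnreal_smul_eLpNorm_of_ae_le_mul' (f := f) (g := g) (by simpa using h) s

theorem eLpNorm_mono_ae_ennreal {α : Type*} [MeasurableSpace α] {μ : Measure α} {f g : α → ℝ≥0∞}
    (s : ℝ≥0∞) (h : ∀ᵐ x ∂μ, f x ≤ g x) : eLpNorm f s μ ≤ eLpNorm g s μ :=
  eLpNorm_mono_enorm_ae (by simpa using h)

theorem eLpNorm_rpow_toReal {α : Type*} [MeasurableSpace α] {μ : Measure α} {s : ℝ≥0∞}
    (h0 : s ≠ 0) (ht : s ≠ ∞) (f : α → ℝ≥0∞) :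
    eLpNorm f s μ = (∫⁻ x, f x ^ s.toReal ∂μ) ^ (1 / s.toReal) := by
  rw [eLpNorm_eq_lintegral_rpow_enorm_toReal h0 ht]
  rfl

theorem eLpNorm_iSup_le {α : Type*} [MeasurableSpace α] {μ : Measure α} {f : ℕ → α → ℝ≥0∞}
    (hf : ∀ n, AEMeasurable (f n) μ) (hmono : ∀ x, Monotone fun n => f n x) {s : ℝ≥0∞} (hs : s ≠ 0)
    {B : ℝ≥0∞} (hB : ∀ n, eLpNorm (f n) s μ ≤ B) : eLpNorm (fun x => ⨆ n, f n x) s μ ≤ B := by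
  rcases eq_or_ne s ∞ with rfl | hst
  · rw [eLpNorm_exponent_top]
    refine eLpNormEssSup_le_of_ae_enorm_bound ?_
    have : ∀ n, ∀ᵐ x ∂μ, f n x ≤ B := fun n => by
      filter_upwards [enorm_ae_le_eLpNormEssSup (f n) μ] with x hx
      refine hx.trans ?_
      rw [← eLpNorm_exponent_top]
      exact hB n
    filter_upwards [ae_all_iff.2 this] with x hx
    exact iSup_le hx
  · have hs0 : 0 < s.toReal := ENNReal.toReal_pos hs hst
    rw [eLpNorm_rpow_toReal hs hst]
    simp only [iSup_rpow _ hs0]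
    rw [lintegral_iSup' (fun n => (hf n).pow_const _)
      (Filter.Eventually.of_forall fun x n k h => ENNReal.rpow_le_rpow (hmono x h) hs0.le),
      iSup_rpow _ (by positivity)]
    refine iSup_le fun n => ?_
    rw [← eLpNorm_rpow_toReal hs hst]
    exact hB n

theorem eLpNorm_tsum_le {α : Type*} [MeasurableSpace α] {μ : Measure α} {f : ℕ → α → ℝ≥0∞}
    (hf : ∀ n, AEMeasurable (f n) μ) {s : ℝ≥0∞} (hs : 1 ≤ s) :
    eLpNorm (fun x => ∑' n, f n x) s μ ≤ ∑' n, eLpNorm (f n) s μ := by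
  have : (fun x => ∑' n, f n x) = fun x => ⨆ n, (∑ k ∈ Finset.range n, f k) x := by
    ext x
    simp only [Finset.sum_apply]
    exact ENNReal.tsum_eq_iSup_nat
  rw [this]
  refine eLpNorm_iSup_le (fun n => ?_) (fun x n k h => ?_) (one_pos.trans_le hs).ne' fun n => ?_
  · exact Finset.aemeasurable_sum _ fun k _ => hf k
  · simp only [Finset.sum_apply]
    exact Finset.sum_le_sum_of_subset (Finset.range_subset_range.2 h)
  · exact (eLpNorm_sum_le (fun k _ => (hf k).aestronglyMeasurable) hs).trans (ENNReal.sum_le_tsum _)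

theorem ae_ne_top_of_eLpNorm {α : Type*} [MeasurableSpace α] {μ : Measure α} {f : α → ℝ≥0∞}
    (hf : AEMeasurable f μ) {s : ℝ≥0∞} (hs : s ≠ 0) (h : eLpNorm f s μ ≠ ∞) :
    ∀ᵐ x ∂μ, f x ≠ ∞ := by
  rcases eq_or_ne s ∞ with rfl | hst
  · filter_upwards [enorm_ae_le_eLpNormEssSup f μ] with x hx
    exact ne_top_of_le_ne_top h hx
  · have hs0 : 0 < s.toReal := ENNReal.toReal_pos hs hst
    rw [eLpNorm_rpow_toReal hs hst, Ne, ENNReal.rpow_eq_top_iff_of_pos (by positivity)] at h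
    filter_upwards [ae_lt_top' (hf.pow_const _) h] with x hx hx'
    rw [hx', ENNReal.top_rpow_of_pos hs0] at hx
    exact lt_irrefl _ hx

/-! ### Averages of decreasing functions -/

theorem lintegral_Ioc_le_sub {φ : ℝ → ℝ≥0∞} (hφ : Antitone φ) {δ : ℝ} (hδ : 0 ≤ δ) {y : ℝ}
    (hy : 0 < y) :
    ∫⁻ u in Ioc (y / 2) y, pw u δ * φ u ∂logMeasure ≤
      pw y δ * ∫⁻ v in Ioi (y / 4), φ v ∂logMeasure := by
  have hlog : ∀ z : ℝ, 0 < z → logMeasure (Ioo (z / 2) z) = ENNReal.ofReal (Real.log 2) := fun z hz => by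
    rw [logMeasure_Ioo (by positivity) hz, logK]
    congr 2
    field_simp
  calc ∫⁻ u in Ioc (y / 2) y, pw u δ * φ u ∂logMeasure
      ≤ ∫⁻ _ in Ioc (y / 2) y, pw y δ * φ (y / 2) ∂logMeasure :=
        setLIntegral_mono' measurableSet_Ioc fun u hu => mul_le_mul' (pw_mono hu.2 hδ) (hφ hu.1.le)
    _ = pw y δ * (φ (y / 2) * ENNReal.ofReal (Real.log 2)) := by
        rw [setLIntegral_const, ← measure_congr Ioo_ae_eq_Ioc, hlog y hy, mul_assoc]
    _ = pw y δ * ∫⁻ _ in Ioo (y / 4) (y / 2), φ (y / 2) ∂logMeasure := by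
        rw [setLIntegral_const, show y / 4 = y / 2 / 2 by ring, hlog (y / 2) (by positivity)]
    _ ≤ pw y δ * ∫⁻ v in Ioo (y / 4) (y / 2), φ v ∂logMeasure := by
        gcongr pw y δ * ?_
        exact setLIntegral_mono' measurableSet_Ioo fun v hv => hφ hv.2.le
    _ ≤ _ := by
        gcongr
        exact Ioo_subset_Ioi_self

theorem lintegral_Ioo_le_tsum {φ : ℝ → ℝ≥0∞} (hφ : Antitone φ) {δ : ℝ} (hδ : 0 ≤ δ) {t : ℝ}
    (ht : 0 < t) :
    ∫⁻ u in Ioo 0 t, pw u δ * φ u ∂logMeasure ≤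
      ∑' k : ℕ, pw (t / 2 ^ k) δ * ∫⁻ v in Ioi (t / 2 ^ k / 4), φ v ∂logMeasure := by
  calc ∫⁻ u in Ioo 0 t, pw u δ * φ u ∂logMeasure
      ≤ ∫⁻ u in ⋃ k : ℕ, Ioc (t / 2 ^ k / 2) (t / 2 ^ k), pw u δ * φ u ∂logMeasure := by
        refine lintegral_mono_set fun u hu => ?_
        obtain ⟨n, hn, hn'⟩ := exists_nat_pow_near ((one_le_div hu.1).2 hu.2.le) one_lt_two
        refine mem_iUnion.2 ⟨n, ?_, ?_⟩
        · rw [div_div, ← pow_succ, div_lt_iff₀ (by positivity), mul_comm]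
          exact (div_lt_iff₀ hu.1).1 hn'
        · rw [le_div_iff₀ (by positivity), mul_comm]
          exact (le_div_iff₀ hu.1).1 hn
    _ ≤ ∑' k : ℕ, ∫⁻ u in Ioc (t / 2 ^ k / 2) (t / 2 ^ k), pw u δ * φ u ∂logMeasure :=
        lintegral_iUnion_le _ _
    _ ≤ _ := ENNReal.tsum_le_tsum fun k => lintegral_Ioc_le_sub hφ hδ (by positivity)

theorem HasSlowBound.eLpNorm_average_le {b : ℝ → ℝ≥0∞} (hb : HasSlowBound b) {δ : ℝ} (hδ : 0 < δ)
    {s : ℝ≥0∞} (hs : 1 ≤ s) :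
    ∃ C : ℝ≥0, ∀ φ : ℝ → ℝ≥0∞, Antitone φ →
      eLpNorm (fun t => b t * (pw t (-δ) * ∫⁻ u in Ioo 0 t, pw u δ * φ u ∂logMeasure)) s logMeasure ≤
        C * eLpNorm (fun t => b t * ∫⁻ v in Ioi t, φ v ∂logMeasure) s logMeasure := by
  obtain ⟨C, hC⟩ := hb.bound (δ / 2) (by positivity)
  set ξ : ℝ≥0∞ := pw 2 (-(δ / 2)) with hξ
  have hξ1 : ξ < 1 := by
    rw [hξ, pw, show ENNReal.ofReal 2 = 2 by simp]
    exact ENNReal.rpow_lt_one_of_one_lt_of_neg (by norm_num) (by linarith)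
  set A : ℝ≥0 := C * (pw 2 δ).toNNReal with hA
  have hA' : (A : ℝ≥0∞) = C * pw 2 δ := by
    rw [hA, ENNReal.coe_mul, ENNReal.coe_toNNReal (pw_ne_top two_pos _)]
  have hgeom : ∑' k : ℕ, (A : ℝ≥0∞) * ξ ^ k ≠ ∞ := by
    rw [ENNReal.tsum_mul_left, ENNReal.tsum_geometric]
    exact ENNReal.mul_ne_top ENNReal.coe_ne_top (ENNReal.inv_ne_top.2 (tsub_pos_of_lt hξ1).ne')
  refine ⟨(∑' k : ℕ, (A : ℝ≥0∞) * ξ ^ k).toNNReal, fun φ hφ => ?_⟩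
  rw [ENNReal.coe_toNNReal hgeom]
  set G : ℝ → ℝ≥0∞ := fun t => b t * ∫⁻ v in Ioi t, φ v ∂logMeasure with hG
  have hFm : AEMeasurable G logMeasure :=
    hb.aemeasurable.mul (measurable_lintegral_Ioi _ _).aemeasurable
  have hpt : ∀ t, 0 < t → b t * (pw t (-δ) * ∫⁻ u in Ioo 0 t, pw u δ * φ u ∂logMeasure) ≤
      ∑' k : ℕ, (A : ℝ≥0∞) * ξ ^ k * G (1 / (2 ^ k * 4) * t) := by
    intro t ht
    calc b t * (pw t (-δ) * ∫⁻ u in Ioo 0 t, pw u δ * φ u ∂logMeasure)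
        ≤ b t * (pw t (-δ) * ∑' k : ℕ, pw (t / 2 ^ k) δ *
            ∫⁻ v in Ioi (t / 2 ^ k / 4), φ v ∂logMeasure) := by
          gcongr
          exact lintegral_Ioo_le_tsum hφ hδ.le ht
      _ = ∑' k : ℕ, b t * (pw t (-δ) * (pw (t / 2 ^ k) δ *
            ∫⁻ v in Ioi (t / 2 ^ k / 4), φ v ∂logMeasure)) := by
          rw [← ENNReal.tsum_mul_left, ← ENNReal.tsum_mul_left]
      _ ≤ _ := ENNReal.tsum_le_tsum fun k => ?_
    have h2k : (0 : ℝ) < 2 ^ k := by positivity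
    have harg : t / 2 ^ k / 4 = 1 / (2 ^ k * 4) * t := by field_simp
    have hy : 0 < t / 2 ^ k / 4 := by positivity
    have hb1 : b t ≤ C * pw (2 ^ k * 4) (δ / 2) * b (t / 2 ^ k / 4) := by
      refine (hC t _ ht hy).trans ?_
      gcongr C * ?_ * _
      have e1 : t / (t / 2 ^ k / 4) = 2 ^ k * 4 := by field_simp
      have e2 : t / 2 ^ k / 4 / t = (2 ^ k * 4)⁻¹ := by field_simp
      rw [e1, e2]
      refine max_le le_rfl (pw_mono ?_ (by positivity))
      have : (1 : ℝ) ≤ 2 ^ k * 4 := by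
        have : (1 : ℝ) ≤ 2 ^ k := one_le_pow₀ one_le_two
        linarith
      exact (inv_le_one_of_one_le₀ this).trans this
    have hp : pw t (-δ) * pw (t / 2 ^ k) δ = pw (2 ^ k) (-δ) := by
      have : pw t δ = pw (2 ^ k) δ * pw (t / 2 ^ k) δ := by
        rw [← pw_mul_left h2k.le δ hδ.le]
        congr 1
        field_simp
      have h1 : pw t (-δ) * pw t δ = 1 := by rw [pw_mul ht, neg_add_cancel, pw_zero]
      have h2 : pw (2 ^ k) (-δ) * pw (2 ^ k) δ = 1 := by rw [pw_mul h2k, neg_add_cancel, pw_zero]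
      calc pw t (-δ) * pw (t / 2 ^ k) δ
          = pw t (-δ) * (pw (2 ^ k) (-δ) * pw (2 ^ k) δ * pw (t / 2 ^ k) δ) := by rw [h2, one_mul]
        _ = pw t (-δ) * pw t δ * pw (2 ^ k) (-δ) := by rw [this]; ring
        _ = _ := by rw [h1, one_mul]
    have hcoef : pw (2 ^ k * 4) (δ / 2) * pw (2 ^ k) (-δ) = pw 2 δ * ξ ^ k := by
      have e1 : pw (2 ^ k) (-δ) = pw 2 (k * -δ) := by
        rw [← pw_of_rpow two_pos, Real.rpow_natCast]
      have e2 : pw (2 ^ k * 4) (δ / 2) = pw 2 ((k + 2) * (δ / 2)) := by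
        rw [← pw_of_rpow two_pos]
        congr 1
        rw [show (k : ℝ) + 2 = ((k + 2 : ℕ) : ℝ) by push_cast; ring, Real.rpow_natCast, pow_add]
        norm_num
      have e3 : ξ ^ k = pw 2 (-(δ / 2) * k) := by
        rw [hξ, ← pw_rpow, ENNReal.rpow_natCast]
      rw [e1, e2, e3, pw_mul two_pos, pw_mul two_pos]
      congr 1
      ring
    calc b t * (pw t (-δ) * (pw (t / 2 ^ k) δ * ∫⁻ v in Ioi (t / 2 ^ k / 4), φ v ∂logMeasure))
        = b t * (pw t (-δ) * pw (t / 2 ^ k) δ) * ∫⁻ v in Ioi (t / 2 ^ k / 4), φ v ∂logMeasure := by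
          ring
      _ ≤ C * pw (2 ^ k * 4) (δ / 2) * b (t / 2 ^ k / 4) * pw (2 ^ k) (-δ) *
            ∫⁻ v in Ioi (t / 2 ^ k / 4), φ v ∂logMeasure := by
          rw [hp]
          gcongr
      _ = C * (pw (2 ^ k * 4) (δ / 2) * pw (2 ^ k) (-δ)) * G (t / 2 ^ k / 4) := by
          rw [hG]; ring
      _ = (A : ℝ≥0∞) * ξ ^ k * G (1 / (2 ^ k * 4) * t) := by
          rw [hcoef, hA', harg]; ring
  have hGm : ∀ k : ℕ, AEMeasurable (fun t => G (1 / (2 ^ k * 4) * t)) logMeasure := fun k => by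
    refine AEMeasurable.comp_measurable (g := G) (f := fun t : ℝ => 1 / (2 ^ k * 4) * t) ?_ (by fun_prop)
    rwa [logMeasure_map_mul (by positivity)]
  calc eLpNorm (fun t => b t * (pw t (-δ) * ∫⁻ u in Ioo 0 t, pw u δ * φ u ∂logMeasure)) s logMeasure
      ≤ eLpNorm (fun t => ∑' k : ℕ, (A : ℝ≥0∞) * ξ ^ k * G (1 / (2 ^ k * 4) * t)) s logMeasure := by
        refine eLpNorm_mono_ae_ennreal s ?_
        filter_upwards [ae_pos_of_null logMeasure_Iic] with t ht using hpt t ht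
    _ ≤ ∑' k : ℕ, eLpNorm (fun t => (A : ℝ≥0∞) * ξ ^ k * G (1 / (2 ^ k * 4) * t)) s logMeasure :=
        eLpNorm_tsum_le (fun k => (hGm k).const_mul _) hs
    _ ≤ ∑' k : ℕ, (A : ℝ≥0∞) * ξ ^ k * eLpNorm G s logMeasure := by
        refine ENNReal.tsum_le_tsum fun k => ?_
        have hfin : (A : ℝ≥0∞) * ξ ^ k ≠ ∞ :=
          ENNReal.mul_ne_top ENNReal.coe_ne_top (ENNReal.pow_ne_top hξ1.ne_top)
        rw [← eLpNorm_comp_mul (show (0 : ℝ) < 1 / (2 ^ k * 4) by positivity) s hFm,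
          ← ENNReal.coe_toNNReal hfin]
        exact eLpNorm_le_mul s (Filter.Eventually.of_forall fun t => le_rfl)
    _ = _ := ENNReal.tsum_mul_right

/-! ### Reduction to an inequality for decreasing functions -/

/-- The weighted inequality `‖b ∫_t^∞ f du/u‖_s ≤ K ‖a f‖_r` for decreasing functions `f`, with
norms with respect to `dt/t`. -/
def TailInequality (r s : ℝ≥0∞) (a b : ℝ → ℝ≥0∞) (K : ℝ≥0∞) : Prop :=
  ∀ f : ℝ → ℝ≥0∞, Antitone f →
    eLpNorm (fun t => b t * ∫⁻ v in Ioi t, f v ∂logMeasure) s logMeasure ≤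
      K * eLpNorm (fun t => a t * f t) r logMeasure

theorem antitone_rearrangement {𝕜 R : Type*} [RCLike 𝕜] [MeasurableSpace R] (μ : Measure R)
    (f : R → 𝕜) : Antitone (rearrangement μ f) := fun _ _ h =>
  sInf_le_sInf fun _ hy => ⟨hy.1, hy.2.trans (ENNReal.ofReal_le_ofReal h)⟩

theorem Equimeasurable.rearrangement_le {𝕜 R : Type*} [RCLike 𝕜] [MeasurableSpace R]
    {μ : Measure R} {g : R → 𝕜} {f : ℝ → ℝ≥0} (h : Equimeasurable μ g f) (hf : AntitoneOn f (Ioi 0))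
    {t : ℝ} (ht : 0 < t) : rearrangement μ g t ≤ f t := by
  refine ENNReal.le_of_forall_pos_le_add fun ε hε _ => sInf_le ⟨?_, ?_⟩
  · exact (ENNReal.coe_pos.2 hε).trans_le le_add_self
  · rw [← ENNReal.coe_add, h, distribution, Measure.restrict_apply' measurableSet_Ioi]
    calc volume ({u | ((f t + ε : ℝ≥0) : ℝ≥0∞) < f u} ∩ Ioi 0) ≤ volume (Ioo 0 t) := by
          refine measure_mono fun u hu => ⟨hu.2, ?_⟩
          by_contra hlt
          have h1 : f u ≤ f t := hf ht hu.2 (not_lt.1 hlt)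
          have h2 : f t + ε < f u := by exact_mod_cast hu.1
          exact absurd (h2.trans_le h1) (not_lt.2 le_self_add)
      _ = ENNReal.ofReal t := by rw [Real.volume_Ioo, sub_zero]

theorem lkNorm_eq {𝕜 R : Type*} [RCLike 𝕜] [MeasurableSpace R] (μ : Measure R) (p : ℝ≥0∞)
    {r : ℝ≥0∞} (hr : r ≠ 0) (a : ℝ → ℝ≥0∞) (f : R → 𝕜) :
    lkNorm μ p r a f =
      eLpNorm (fun t => pw t (recip p) * a t * rearrangement μ f t) r logMeasure := by
  rw [← logMeasure_restrict_Ioi, ← lebNorm_eq hr measurableSet_Ioi Subset.rfl, lkNorm, lebNorm,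
    lebNorm]
  refine eLpNorm_congr_ae ?_
  filter_upwards [ae_restrict_mem measurableSet_Ioi] with t ht
  rw [sub_eq_add_neg, ← pw_mul ht]
  ring

theorem recip_top : recip ∞ = 0 := by simp [recip]

theorem lkNorm_top_eq {𝕜 R : Type*} [RCLike 𝕜] [MeasurableSpace R] (μ : Measure R)
    {r : ℝ≥0∞} (hr : r ≠ 0) (a : ℝ → ℝ≥0∞) (f : R → 𝕜) :
    lkNorm μ ∞ r a f = eLpNorm (fun t => a t * rearrangement μ f t) r logMeasure := by
  simp only [lkNorm_eq μ ∞ hr, recip_top, pw_zero, one_mul]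

theorem calderonRight_top_eq (q : ℝ≥0∞) (m : ℝ) (g : ℝ → ℝ≥0∞) {x : ℝ} (hx : 0 < x) :
    calderonRight ∞ q m g x = pw x (-recip q) * ∫⁻ t in Ioi (x ^ m), g t ∂logMeasure := by
  rw [calderonRight, setLIntegral_logMeasure measurableSet_Ioi
    (Ioi_subset_Ioi (Real.rpow_pos_of_pos hx m).le), recip_top, zero_sub]

theorem calderonLeft_eq (p q : ℝ≥0∞) (m : ℝ) (g : ℝ → ℝ≥0∞) (x : ℝ) :
    calderonLeft p q m g x =
      pw x (-recip q) * ∫⁻ t in Ioo 0 (x ^ m), pw t (recip p) * g t ∂logMeasure := by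
  rw [calderonLeft, setLIntegral_logMeasure measurableSet_Ioo fun t ht => ht.1]
  congr 1
  refine setLIntegral_congr_fun measurableSet_Ioo fun t ht => ?_
  rw [← mul_assoc, pw_mul ht.1, sub_eq_add_neg, add_comm]

theorem tailInequality_of_nnreal {r s : ℝ≥0∞} {a b : ℝ → ℝ≥0∞} (hs : s ≠ 0)
    (hb : AEMeasurable b logMeasure) {K : ℝ≥0∞}
    (H : ∀ f : ℝ → ℝ≥0, Antitone f →
      eLpNorm (fun t => b t * ∫⁻ v in Ioi t, f v ∂logMeasure) s logMeasure ≤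
        K * eLpNorm (fun t => a t * f t) r logMeasure) : TailInequality r s a b K := by
  intro f hf
  have hcoe : ∀ n t, ((trunc f n t).toNNReal : ℝ≥0∞) = trunc f n t := fun n t =>
    ENNReal.coe_toNNReal (ne_top_of_le_ne_top (ENNReal.natCast_ne_top n) (trunc_le_natCast f n t))
  have hF : ∀ t, ∫⁻ v in Ioi t, f v ∂logMeasure = ⨆ n, ∫⁻ v in Ioi t, trunc f n v ∂logMeasure :=
    fun t => by
      rw [← lintegral_iSup (fun n => measurable_trunc hf.measurable n) (trunc_mono f)]
      simp only [iSup_trunc]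
  simp only [hF, ENNReal.mul_iSup]
  refine eLpNorm_iSup_le (fun n => hb.mul (measurable_lintegral_Ioi _ _).aemeasurable)
    (fun t n k h => ?_) hs fun n => ?_
  · exact mul_le_mul_right (lintegral_mono (trunc_mono f h)) _
  · have := H (fun t => (trunc f n t).toNNReal) fun x y h =>
      ENNReal.toNNReal_mono (ne_top_of_le_ne_top (ENNReal.natCast_ne_top n) (trunc_le_natCast f n x))
        (antitone_trunc hf n h)
    simp only [hcoe] at this
    refine this.trans (mul_le_mul_right (eLpNorm_mono_ae_ennreal r ?_) _)
    exact Filter.Eventually.of_forall fun t => mul_le_mul_right (trunc_le f n t) _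

theorem lowerStar_rpow {m : ℝ} (hm : m ≠ 0) (b : ℝ → ℝ≥0∞) {x : ℝ} (hx : 0 < x) :
    lowerStar m b (x ^ m) = b x := by
  rw [lowerStar, one_div, Real.rpow_rpow_inv hx.le hm]

section

variable {𝕜 : Type*} [RCLike 𝕜] {Ω₁ Ω₂ : Type*} [MeasurableSpace Ω₁] [MeasurableSpace Ω₂]
  {μ₁ : Measure Ω₁} {μ₂ : Measure Ω₂} {T : QuasilinearOperator 𝕜 μ₁ μ₂}

theorem LowerBound₂.exists_tailInequality {q r s : ℝ≥0∞} {m : ℝ} {a b : ℝ → ℝ≥0∞}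
    (hLB : LowerBound₂ T ∞ q m) (hm : m ≠ 0) (hr : r ≠ 0) (hs : s ≠ 0)
    (hb : AEMeasurable b logMeasure) (hT : BoundedLK T ∞ r a q s b) :
    ∃ K : ℝ≥0∞, K ≠ ∞ ∧ TailInequality r s a (lowerStar m b) K := by
  obtain ⟨C, hC⟩ := hT
  obtain ⟨c, hc, hLB⟩ := hLB
  obtain ⟨κ, hκ0, hκ, hκm⟩ := exists_eLpNorm_comp_rpow hm s
  have hc0 : (c : ℝ≥0∞) ≠ 0 := by exact_mod_cast hc.ne'
  have hbs : AEMeasurable (lowerStar m b) logMeasure := aemeasurable_comp_rpow (one_div_ne_zero hm) hb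
  refine ⟨κ⁻¹ * ((c⁻¹ : ℝ≥0) * (C + 1)), ENNReal.mul_ne_top (ENNReal.inv_ne_top.2 hκ0)
    (ENNReal.mul_ne_top ENNReal.coe_ne_top (by simp)), ?_⟩
  refine tailInequality_of_nnreal hs hbs fun f hf => ?_
  obtain ⟨g, hg, hgf, hgT⟩ := hLB f (hf.antitoneOn _)
  have hle : lkNorm μ₁ ∞ r a g ≤ eLpNorm (fun t => a t * f t) r logMeasure := by
    rw [lkNorm_top_eq _ hr]
    refine eLpNorm_mono_ae_ennreal r ?_
    filter_upwards [ae_pos_of_null logMeasure_Iic] with t ht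
    exact mul_le_mul_right (hgf.rearrangement_le (hf.antitoneOn _) ht) _
  rcases eq_or_ne (eLpNorm (fun t => a t * f t) r logMeasure) ∞ with htop | htop
  · rw [htop, ENNReal.mul_top]
    · exact le_top
    · exact mul_ne_zero (ENNReal.inv_ne_zero.2 hκ) (mul_ne_zero
        (by exact_mod_cast (inv_pos.2 hc).ne') (by simp))
  obtain ⟨hgd, hTg⟩ := hC g ⟨hg, hle.trans_lt htop.lt_top⟩
  set F : ℝ → ℝ≥0∞ := fun t => ∫⁻ v in Ioi t, f v ∂logMeasure with hF
  have hGm : AEMeasurable (fun t => lowerStar m b t * F t) logMeasure :=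
    hbs.mul (measurable_lintegral_Ioi _ _).aemeasurable
  have hlow : eLpNorm (fun x => lowerStar m b (x ^ m) * F (x ^ m)) s logMeasure ≤
      (c⁻¹ : ℝ≥0) * lkNorm μ₂ q s b (T.toFun ⟨g, hgd⟩) := by
    rw [lkNorm_eq _ _ hs]
    refine eLpNorm_le_mul s ?_
    filter_upwards [ae_pos_of_null logMeasure_Iic] with x hx
    have h1 := hgT hgd x hx
    rw [calderonRight_top_eq _ _ _ hx] at h1
    rw [lowerStar_rpow hm b hx, ENNReal.coe_inv hc.ne']
    have h2 : pw x (recip q) * pw x (-recip q) = 1 := by rw [pw_mul hx, add_neg_cancel, pw_zero]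
    calc b x * F (x ^ m)
        = (c : ℝ≥0∞)⁻¹ * c * (pw x (recip q) * pw x (-recip q)) * (b x * F (x ^ m)) := by
          rw [h2, ENNReal.inv_mul_cancel hc0 ENNReal.coe_ne_top, one_mul, one_mul]
      _ = (c : ℝ≥0∞)⁻¹ * (pw x (recip q) * b x * (c * (pw x (-recip q) * F (x ^ m)))) := by ring
      _ ≤ _ := by gcongr
  rw [hκm _ hGm] at hlow
  calc eLpNorm (fun t => lowerStar m b t * F t) s logMeasure
      = κ⁻¹ * (κ * eLpNorm (fun t => lowerStar m b t * F t) s logMeasure) := by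
        rw [← mul_assoc, ENNReal.inv_mul_cancel hκ0 hκ, one_mul]
    _ ≤ κ⁻¹ * ((c⁻¹ : ℝ≥0) * ((C + 1) * eLpNorm (fun t => a t * f t) r logMeasure)) := by
        refine mul_le_mul_right (hlow.trans (mul_le_mul_right ?_ _)) _
        refine hTg.trans ?_
        gcongr
        exact le_self_add
    _ = _ := by ring

theorem JointWeakType.boundedLK {p₁ q₁ q₂ r s : ℝ≥0∞} {a b : ℝ → ℝ≥0∞}
    (hJW : JointWeakType T p₁ q₁ ∞ q₂) (hp : 0 < recip p₁) (hm : slope p₁ q₁ ∞ q₂ ≠ 0) (hr : r ≠ 0)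
    (hs : 1 ≤ s) (hb : HasSlowBound b) {K : ℝ≥0∞} (hK : K ≠ ∞)
    (H : TailInequality r s a (lowerStar (slope p₁ q₁ ∞ q₂) b) K) : BoundedLK T ∞ r a q₂ s b := by
  set m := slope p₁ q₁ ∞ q₂ with hm_def
  have hs0 : s ≠ 0 := (one_pos.trans_le hs).ne'
  have hmδ : recip q₁ = recip q₂ + m * recip p₁ := by
    rw [hm_def, slope, recip_top, sub_zero, div_mul_cancel₀ _ hp.ne']
    ring
  have hbs : HasSlowBound (lowerStar m b) := hb.lowerStar hm
  obtain ⟨C, hC⟩ := hJW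
  obtain ⟨C', hC'⟩ := hbs.eLpNorm_average_le hp hs
  obtain ⟨κ, hκ0, hκ, hκm⟩ := exists_eLpNorm_comp_rpow hm s
  have hfin : (C : ℝ≥0∞) * (κ * ((C' + 1) * K)) ≠ ∞ := ENNReal.mul_ne_top ENNReal.coe_ne_top
    (ENNReal.mul_ne_top hκ (ENNReal.mul_ne_top (by simp) hK))
  refine ⟨((C : ℝ≥0∞) * (κ * ((C' + 1) * K))).toNNReal, fun f ⟨hfm, hf⟩ => ?_⟩
  rw [ENNReal.coe_toNNReal hfin]
  set φ := rearrangement μ₁ f with hφ_def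
  have hφ : Antitone φ := antitone_rearrangement μ₁ f
  set F : ℝ → ℝ≥0∞ := fun t => ∫⁻ v in Ioi t, φ v ∂logMeasure with hF
  set P : ℝ → ℝ≥0∞ := fun t => pw t (-recip p₁) * ∫⁻ u in Ioo 0 t, pw u (recip p₁) * φ u ∂logMeasure
    with hP
  have hFm : Measurable F := measurable_lintegral_Ioi _ _
  have hPm : Measurable P := by
    refine (measurable_pw _).mul (Monotone.measurable fun x y h => ?_)
    exact lintegral_mono_set (Ioo_subset_Ioo_right h)
  have hcal : ∀ x, 0 < x →
      calderon p₁ q₁ ∞ q₂ φ x = pw x (-recip q₂) * (P (x ^ m) + F (x ^ m)) := by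
    intro x hx
    rw [calderon, calderonRight_top_eq _ _ _ hx, calderonLeft_eq, ← hm_def, hmδ, neg_add,
      ← pw_mul hx]
    simp only [hP, hF, pw_of_rpow hx, mul_neg]
    ring
  have hbound : eLpNorm (fun t => lowerStar m b t * (P t + F t)) s logMeasure ≤
      (C' + 1) * K * lkNorm μ₁ ∞ r a f := by
    have h1 := H φ hφ
    rw [← lkNorm_top_eq _ hr] at h1
    have h2 := hC' φ hφ
    have hsplit : (fun t => lowerStar m b t * (P t + F t)) =
        (fun t => lowerStar m b t * P t) + fun t => lowerStar m b t * F t := by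
      ext t
      simp only [Pi.add_apply, mul_add]
    rw [hsplit]
    refine (eLpNorm_add_le (hbs.aemeasurable.mul hPm.aemeasurable).aestronglyMeasurable
      (hbs.aemeasurable.mul hFm.aemeasurable).aestronglyMeasurable hs).trans ?_
    calc _ ≤ C' * (K * lkNorm μ₁ ∞ r a f) + K * lkNorm μ₁ ∞ r a f :=
          add_le_add (h2.trans (by gcongr)) h1
      _ = _ := by ring
  have hGm : AEMeasurable (fun t => lowerStar m b t * (P t + F t)) logMeasure :=
    hbs.aemeasurable.mul (hPm.add hFm).aemeasurable
  have hone : calderon p₁ q₁ ∞ q₂ φ 1 < ∞ := by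
    have hae := ae_ne_top_of_eLpNorm hGm hs0 (ne_top_of_le_ne_top
      (ENNReal.mul_ne_top (ENNReal.mul_ne_top (by simp) hK) hf.ne) hbound)
    have hae' : ∀ᵐ t ∂logMeasure, P t ≠ ∞ ∧ F t ≠ ∞ := by
      filter_upwards [hae, ae_pos_of_null logMeasure_Iic] with t ht ht0
      have : P t + F t ≠ ∞ := fun h => ht (by rw [h, ENNReal.mul_top (hbs.ne_zero t ht0)])
      exact ENNReal.add_ne_top.1 this
    have hex : ∀ x y : ℝ, 0 < x → x < y → ∃ t ∈ Ioo x y, P t ≠ ∞ ∧ F t ≠ ∞ := by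
      intro x y hx hxy
      by_contra! hcon
      have : logMeasure (Ioo x y) = 0 := by
        refine measure_mono_null (fun t ht => ?_) (ae_iff.1 hae')
        simp only [mem_ofPred_eq, not_and, not_not]
        exact hcon t ht
      rw [logMeasure_Ioo hx (hx.trans hxy)] at this
      exact logK_ne_zero hx hxy this
    obtain ⟨t, ht, -, hFt⟩ := hex (1 / 2) 1 (by norm_num) (by norm_num)
    obtain ⟨u, hu, hPu, -⟩ := hex 1 2 (by norm_num) (by norm_num)
    rw [hcal 1 one_pos, Real.one_rpow]
    refine ENNReal.mul_lt_top (pw_ne_top one_pos _).lt_top (ENNReal.add_lt_top.2 ⟨?_, ?_⟩)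
    · have hu0 : 0 < u := one_pos.trans hu.1
      have : ∫⁻ v in Ioo 0 u, pw v (recip p₁) * φ v ∂logMeasure ≠ ∞ := fun h =>
        hPu (by simp only [hP]; rw [h, ENNReal.mul_top (pw_ne_zero hu0 _)])
      refine ENNReal.mul_lt_top (pw_ne_top one_pos _).lt_top (lt_of_le_of_lt ?_ this.lt_top)
      exact lintegral_mono_set (Ioo_subset_Ioo_right hu.1.le)
    · exact lt_of_le_of_lt (lintegral_mono_set (Ioi_subset_Ioi ht.2.le)) hFt.lt_top
  obtain ⟨hfd, hTf⟩ := hC f hfm hone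
  refine ⟨hfd, ?_⟩
  have hup : lkNorm μ₂ q₂ s b (T.toFun ⟨f, hfd⟩) ≤
      C * eLpNorm (fun x => lowerStar m b (x ^ m) * (P (x ^ m) + F (x ^ m))) s logMeasure := by
    rw [lkNorm_eq _ _ hs0]
    refine eLpNorm_le_mul s ?_
    filter_upwards [ae_pos_of_null logMeasure_Iic] with x hx
    have h1 := hTf x hx
    rw [hcal x hx] at h1
    rw [lowerStar_rpow hm b hx]
    have h2 : pw x (recip q₂) * pw x (-recip q₂) = 1 := by rw [pw_mul hx, add_neg_cancel, pw_zero]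
    calc pw x (recip q₂) * b x * rearrangement μ₂ (T.toFun ⟨f, hfd⟩) x
        ≤ pw x (recip q₂) * b x * (C * (pw x (-recip q₂) * (P (x ^ m) + F (x ^ m)))) := by gcongr
      _ = C * (pw x (recip q₂) * pw x (-recip q₂) * (b x * (P (x ^ m) + F (x ^ m)))) := by ring
      _ = _ := by rw [h2, one_mul]
  rw [hκm _ hGm] at hup
  calc _ ≤ C * (κ * ((C' + 1) * K * lkNorm μ₁ ∞ r a f)) := hup.trans (by gcongr)
    _ = _ := by ring

end

/-! ### The quantities `R₁`, `R₂`, `R₃` in terms of the measure `dt / t` -/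

theorem mul_eLpNorm_le {α : Type*} [MeasurableSpace α] {μ : Measure α} {f g : α → ℝ≥0∞} {c : ℝ≥0∞}
    (s : ℝ≥0∞) (h : ∀ᵐ x ∂μ, c * g x ≤ f x) : c * eLpNorm g s μ ≤ eLpNorm f s μ := by
  have key : ∀ d : ℝ≥0, (d : ℝ≥0∞) ≤ c → d * eLpNorm g s μ ≤ eLpNorm f s μ := by
    intro d hd
    rcases eq_or_ne d 0 with rfl | hd0
    · simp
    have hd1 : (d : ℝ≥0∞) ≠ 0 := by exact_mod_cast hd0
    have : eLpNorm g s μ ≤ (d⁻¹ : ℝ≥0) * eLpNorm f s μ := by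
      refine eLpNorm_le_mul s ?_
      filter_upwards [h] with x hx
      rw [ENNReal.coe_inv hd0, ← ENNReal.div_eq_inv_mul,
        ENNReal.le_div_iff_mul_le (Or.inl hd1) (Or.inl ENNReal.coe_ne_top), mul_comm]
      exact (mul_le_mul_left hd _).trans hx
    calc (d : ℝ≥0∞) * eLpNorm g s μ ≤ d * ((d⁻¹ : ℝ≥0) * eLpNorm f s μ) := by gcongr
      _ = eLpNorm f s μ := by
        rw [← mul_assoc, ENNReal.coe_inv hd0, ENNReal.mul_inv_cancel hd1 ENNReal.coe_ne_top, one_mul]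
  rcases eq_or_ne c ∞ with rfl | hc
  · rw [← ENNReal.iSup_natCast, ENNReal.iSup_mul]
    exact iSup_le fun n => by simpa using key n le_top
  · simpa [ENNReal.coe_toNNReal hc] using key c.toNNReal (ENNReal.coe_toNNReal hc).le

theorem lebNorm_Ioo_eq {r : ℝ≥0∞} (hr : r ≠ 0) (a : ℝ → ℝ≥0∞) (x : ℝ) :
    lebNorm r (Ioo 0 x) (fun t => pw t (-recip r) * a t) =
      eLpNorm a r (logMeasure.restrict (Ioo 0 x)) :=
  lebNorm_eq hr measurableSet_Ioo (fun _ ht => ht.1) a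

theorem lebNorm_Ioo_log_eq {s : ℝ≥0∞} (hs : s ≠ 0) (b : ℝ → ℝ≥0∞) (x : ℝ) :
    lebNorm s (Ioo 0 x) (fun t => pw t (-recip s) * b t * ENNReal.ofReal (Real.log (x / t))) =
      eLpNorm (fun t => b t * logK t x) s (logMeasure.restrict (Ioo 0 x)) := by
  rw [← lebNorm_eq hs measurableSet_Ioo (fun _ ht => ht.1)]
  simp only [mul_assoc]
  rfl

theorem lebNorm_Ioi_log_eq {r r' : ℝ≥0∞} (hr : r' ≠ 0) (a v : ℝ → ℝ≥0∞) {x : ℝ} (hx : 0 ≤ x) :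
    lebNorm r' (Ioi x) (fun t => pw t (-recip r') * a t ^ (r.toReal * recip r') * (v t)⁻¹ *
        ENNReal.ofReal (Real.log (t / x))) =
      eLpNorm (fun t => a t ^ (r.toReal * recip r') * (logK x t * (v t)⁻¹)) r'
        (logMeasure.restrict (Ioi x)) := by
  rw [← lebNorm_eq hr measurableSet_Ioi (Ioi_subset_Ioi hx)]
  simp only [mul_assoc]
  congr 1
  ext t
  rw [mul_comm (v t)⁻¹]
  rfl

section

variable {a b : ℝ → ℝ≥0∞} {r s : ℝ≥0∞} {K : ℝ≥0∞}

theorem HasSlowBound.eLpNorm_mul_eq (ha : HasSlowBound a) (h0 : r ≠ 0) (ht : r ≠ ∞)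
    (f : ℝ → ℝ≥0∞) :
    eLpNorm (fun t => a t * f t) r logMeasure =
      (∫⁻ t, f t ^ r.toReal ∂(weight a r.toReal)) ^ (1 / r.toReal) := by
  rw [eLpNorm_rpow_toReal h0 ht, ha.lintegral_weight ENNReal.toReal_nonneg]
  simp only [ENNReal.mul_rpow_of_nonneg _ _ ENNReal.toReal_nonneg]

theorem HasSlowBound.eLpNorm_mul_restrict_eq (ha : HasSlowBound a) (h0 : r ≠ 0) (ht : r ≠ ∞)
    {S : Set ℝ} (hS : MeasurableSet S) (f : ℝ → ℝ≥0∞) :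
    eLpNorm (fun t => a t * f t) r (logMeasure.restrict S) =
      (∫⁻ t in S, f t ^ r.toReal ∂(weight a r.toReal)) ^ (1 / r.toReal) := by
  rw [eLpNorm_rpow_toReal h0 ht, ha.setLIntegral_weight ENNReal.toReal_nonneg hS]
  simp only [ENNReal.mul_rpow_of_nonneg _ _ ENNReal.toReal_nonneg]

theorem eLpNorm_Ioo_eq (h0 : r ≠ 0) (ht : r ≠ ∞) (a : ℝ → ℝ≥0∞) (x : ℝ) :
    eLpNorm a r (logMeasure.restrict (Ioo 0 x)) = weight a r.toReal (Iio x) ^ (1 / r.toReal) := by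
  rw [eLpNorm_rpow_toReal h0 ht, weight_Iio]

theorem eLpNorm_log_eq (hb : HasSlowBound b) (h0 : s ≠ 0) (ht : s ≠ ∞) {x : ℝ} (hx : 0 < x) :
    eLpNorm (fun t => b t * logK t x) s (logMeasure.restrict (Ioo 0 x)) =
      (∫⁻ u, logK u x ^ s.toReal ∂(weight b s.toReal)) ^ (1 / s.toReal) := by
  rw [hb.eLpNorm_mul_restrict_eq h0 ht measurableSet_Ioo, ← restrict_Iio_eq (weight_Iic _ _),
    ← lintegral_indicator measurableSet_Iio]
  congr 1
  refine lintegral_congr fun u => ?_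
  by_cases hu : u < x
  · rw [indicator_of_mem (show u ∈ Iio x from hu)]
  · rw [indicator_of_notMem (show u ∉ Iio x from hu), logK_eq_zero hx (not_lt.1 hu),
      ENNReal.zero_rpow_of_pos (ENNReal.toReal_pos h0 ht)]

theorem holderConjugate_conj (h1 : 1 < r) (ht : r ≠ ∞) :
    r.toReal.HolderConjugate (conj r).toReal := by
  have hr1 : 1 < r.toReal := by
    rw [← ENNReal.toReal_one]
    exact ENNReal.toReal_strict_mono ht h1
  rw [Real.holderConjugate_iff]
  refine ⟨hr1, ?_⟩
  rw [conj, ENNReal.toReal_inv, inv_inv, ENNReal.toReal_sub_of_le (ENNReal.inv_le_one.2 h1.le)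
    ENNReal.one_ne_top, ENNReal.toReal_inv, ENNReal.toReal_one]
  ring

theorem conj_ne_zero (r : ℝ≥0∞) : conj r ≠ 0 :=
  ENNReal.inv_ne_zero.2 (ne_top_of_le_ne_top ENNReal.one_ne_top tsub_le_self)

theorem conj_ne_top (h1 : 1 < r) : conj r ≠ ∞ :=
  ENNReal.inv_ne_top.2 (tsub_pos_of_lt (ENNReal.inv_lt_one.2 h1)).ne'

theorem rpow_mul_recip_rpow (c : ℝ≥0∞) {t : ℝ} {p : ℝ≥0∞} (h0 : p ≠ 0) (ht : p ≠ ∞) :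
    (c ^ (t * recip p)) ^ p.toReal = c ^ t := by
  have := (ENNReal.toReal_pos h0 ht).ne'
  rw [← ENNReal.rpow_mul, recip_eq]
  congr 1
  field_simp

theorem HasSlowBound.lebNorm_tail_eq (ha : HasSlowBound a) (h1 : 1 < r) {x : ℝ}
    (hx : 0 < x) :
    lebNorm (conj r) (Ioi x) (fun t => pw t (-recip (conj r)) *
          a t ^ (r.toReal * recip (conj r)) * (V r a t)⁻¹ * ENNReal.ofReal (Real.log (t / x))) =
      tail (weight a r.toReal) (conj r).toReal x ^ (1 / (conj r).toReal) := by
  have h0 := conj_ne_zero r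
  have ht := conj_ne_top h1
  rw [lebNorm_Ioi_log_eq h0 a _ hx.le, eLpNorm_rpow_toReal h0 ht, tail,
    ha.setLIntegral_weight ENNReal.toReal_nonneg measurableSet_Ioi]
  simp only [ENNReal.mul_rpow_of_nonneg _ _ (ENNReal.toReal_nonneg (a := conj r)),
    rpow_mul_recip_rpow _ h0 ht, weight_Iio_eq_V]

theorem tailInequality_iff (ha : HasSlowBound a) (hb : HasSlowBound b) (hr : r ≠ 0) (hr' : r ≠ ∞)
    (hs : s ≠ 0) (hs' : s ≠ ∞) :
    TailInequality r s a b K ↔ ∀ f : ℝ → ℝ≥0∞, Antitone f →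
      ∫⁻ u, (∫⁻ v in Ioi u, f v ∂logMeasure) ^ s.toReal ∂(weight b s.toReal) ≤
        K ^ s.toReal * (∫⁻ u, f u ^ r.toReal ∂(weight a r.toReal)) ^ (s.toReal / r.toReal) := by
  have hs0 := ENNReal.toReal_pos hs hs'
  refine forall₂_congr fun f _ => ?_
  rw [hb.eLpNorm_mul_eq hs hs', ha.eLpNorm_mul_eq hr hr', one_div s.toReal,
    ENNReal.rpow_inv_le_iff hs0, ENNReal.mul_rpow_of_nonneg _ _ hs0.le, ← ENNReal.rpow_mul]
  rw [show 1 / r.toReal * s.toReal = s.toReal / r.toReal by ring]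

theorem logMeasure_Ioi {t : ℝ} (ht : 0 < t) : logMeasure (Ioi t) = ∞ := by
  refine ENNReal.eq_top_of_forall_nnreal_le fun n => ?_
  calc (n : ℝ≥0∞) = logMeasure (Ioo t (t * Real.exp n)) := by
        rw [logMeasure_Ioo ht (by positivity), logK, mul_div_cancel_left₀ _ ht.ne', Real.log_exp,
          ENNReal.ofReal_coe_nnreal]
    _ ≤ _ := measure_mono Ioo_subset_Ioi_self

theorem TailInequality.eLpNorm_eq_top (H : TailInequality r s a b K) (hb : HasSlowBound b)
    (hs : s ≠ 0) (hK : K ≠ ∞) : eLpNorm a r logMeasure = ∞ := by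
  have h1 := H (fun _ => 1) antitone_const
  simp only [mul_one, lintegral_const, one_mul, Measure.restrict_apply_univ] at h1
  by_contra hne
  have h2 := ae_ne_top_of_eLpNorm (hb.aemeasurable.mul (Antitone.measurable fun _ _ h =>
    measure_mono (Ioi_subset_Ioi h)).aemeasurable) hs
    (ne_top_of_le_ne_top (ENNReal.mul_ne_top hK hne) h1)
  have h3 : logMeasure (Ioi 1) = 0 := by
    refine measure_mono_null (fun t ht => ?_) (ae_iff.1 h2)
    have ht0 : 0 < t := one_pos.trans ht
    simp only [mem_ofPred_eq, not_not]
    rw [Pi.mul_apply, logMeasure_Ioi ht0, ENNReal.mul_top (hb.ne_zero t ht0)]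
  rw [logMeasure_Ioi one_pos] at h3
  exact ENNReal.top_ne_zero h3

/-! ### Necessity for `r ≤ s` -/

theorem lintegral_Ioi_indicator {u x : ℝ} (hu : 0 < u) (hx : 0 < x) :
    ∫⁻ v in Ioi u, (Iio x).indicator (fun _ => 1) v ∂logMeasure = logK u x := by
  rw [lintegral_indicator measurableSet_Iio, setLIntegral_one,
    logMeasure_restrict_Ioi_Iio hu hx]

theorem TailInequality.eLpNorm_log_le (H : TailInequality r s a b K) {x : ℝ} (hx : 0 < x) :
    eLpNorm (fun t => b t * logK t x) s (logMeasure.restrict (Ioo 0 x)) ≤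
      K * eLpNorm a r (logMeasure.restrict (Ioo 0 x)) := by
  have h1 := H ((Iio x).indicator fun _ => 1) (fun u v h => by
    simp only [indicator, mem_Iio]
    split_ifs with h1 h2
    · exact le_rfl
    · exact absurd (h.trans_lt h1) h2
    · exact zero_le
    · exact le_rfl)
  calc eLpNorm (fun t => b t * logK t x) s (logMeasure.restrict (Ioo 0 x))
      ≤ eLpNorm (fun t => b t * logK t x) s logMeasure :=
        eLpNorm_mono_measure _ Measure.restrict_le_self
    _ ≤ eLpNorm (fun t => b t * ∫⁻ v in Ioi t, (Iio x).indicator (fun _ => 1) v ∂logMeasure) s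
          logMeasure := by
        refine eLpNorm_mono_ae_ennreal s ?_
        filter_upwards [ae_pos_of_null logMeasure_Iic] with t ht
        rw [lintegral_Ioi_indicator ht hx]
    _ ≤ _ := h1
    _ = K * eLpNorm ((Iio x).indicator a) r logMeasure := by
        congr 2
        ext t
        simp only [indicator]
        split_ifs <;> simp
    _ = _ := by
        rw [eLpNorm_indicator_eq_eLpNorm_restrict measurableSet_Iio, restrict_Iio_eq logMeasure_Iic]

theorem TailInequality.eLpNorm_mul_le (H : TailInequality r s a b K) (x : ℝ) {f : ℝ → ℝ≥0∞}
    (hf : Antitone f) :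
    eLpNorm b s (logMeasure.restrict (Ioo 0 x)) * ∫⁻ v in Ioi x, f v ∂logMeasure ≤
      K * eLpNorm (fun t => a t * f t) r logMeasure := by
  refine le_trans ?_ (H f hf)
  rw [mul_comm]
  refine (mul_eLpNorm_le (f := fun t => b t * ∫⁻ v in Ioi t, f v ∂logMeasure) s ?_).trans
    (eLpNorm_mono_measure _ Measure.restrict_le_self)
  filter_upwards [ae_restrict_mem measurableSet_Ioo] with t ht
  rw [mul_comm]
  gcongr
  exact ht.2.le

theorem TailInequality.R₁_le (H : TailInequality r s a b K) (hr : r ≠ 0) (hs : s ≠ 0) (hrs : r ≤ s) :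
    R₁ r s a b ≤ K := by
  rw [R₁, if_pos hrs]
  refine iSup₂_le fun x hx => ?_
  rw [lebNorm_Ioo_log_eq hs, lebNorm_Ioo_eq hr, ← div_eq_mul_inv]
  refine ENNReal.div_le_of_le_mul ?_
  exact H.eLpNorm_log_le hx

theorem TailInequality.R₂_le (ha : HasSlowBound a) (h1 : 1 < r)
    (hr' : r ≠ ∞) (hs : s ≠ 0) (hrs : r ≤ s) (hν : IsWeight (weight a r.toReal)) :
    ∃ C : ℝ≥0, ∀ K, TailInequality r s a b K → R₂ r s a b ≤ C * K := by
  have hr0 : r ≠ 0 := (one_pos.trans h1).ne'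
  obtain ⟨C, hC⟩ := hν.tail_le (holderConjugate_conj h1 hr')
  refine ⟨C, fun K H => ?_⟩
  rw [R₂, if_pos hrs]
  refine iSup₂_le fun x hx => ?_
  rw [lebNorm_Ioo_eq hs, ha.lebNorm_tail_eq h1 hx]
  refine hC x hx _ K fun g hg => ?_
  rw [← ha.eLpNorm_mul_eq hr0 hr']
  exact H.eLpNorm_mul_le x hg

/-! ### The cases `s = ∞` and `r = ∞` -/

theorem HasSlowBound.le_eLpNorm_top (hb : HasSlowBound b) :
    ∃ C : ℝ≥0, ∀ k : ℝ → ℝ≥0∞, ∀ u x, 0 < u → u ≤ x → (∀ t, 0 < t → t ≤ u → k u ≤ k t) →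
      b u * k u ≤ C * eLpNorm (fun t => b t * k t) ∞ (logMeasure.restrict (Ioo 0 x)) := by
  obtain ⟨C, hC⟩ := hb.bound 1 one_pos
  refine ⟨C * 2, fun k u x hu hux hk => ?_⟩
  have hae := enorm_ae_le_eLpNormEssSup (fun t => b t * k t) (logMeasure.restrict (Ioo 0 x))
  rw [← eLpNorm_exponent_top] at hae
  obtain ⟨t, ht, hle⟩ : ∃ t ∈ Ioo (u / 2) u, b t * k t ≤
      eLpNorm (fun t => b t * k t) ∞ (logMeasure.restrict (Ioo 0 x)) := by
    by_contra! hcon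
    have h0 : logMeasure (Ioo (u / 2) u) = 0 := by
      have h1 : logMeasure.restrict (Ioo 0 x) (Ioo (u / 2) u) = 0 :=
        measure_mono_null (fun t ht => not_le.2 (hcon t ht)) (ae_iff.1 hae)
      rwa [Measure.restrict_apply measurableSet_Ioo, inter_eq_left.2] at h1
      exact Ioo_subset_Ioo (by positivity) hux
    rw [logMeasure_Ioo (by positivity) hu] at h0
    exact logK_ne_zero (by positivity) (by linarith) h0
  have ht0 : 0 < t := (half_pos hu).trans ht.1
  have hmax : max (pw (u / t) 1) (pw (t / u) 1) ≤ 2 := by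
    have h2 : (2 : ℝ≥0∞) = pw 2 1 := by simp [pw]
    rw [h2]
    refine max_le (pw_mono ?_ zero_le_one) (pw_mono ?_ zero_le_one)
    · rw [div_le_iff₀ ht0]
      linarith [ht.1]
    · rw [div_le_iff₀ hu]
      linarith [ht.2]
  calc b u * k u ≤ C * 2 * b t * k t := by
        gcongr
        · refine (hC u t hu ht0).trans ?_
          gcongr
        · exact hk t ht0 ht.2.le
    _ = C * 2 * (b t * k t) := by ring
    _ ≤ ((C * 2 : ℝ≥0) : ℝ≥0∞) * _ := by
        push_cast
        gcongr

theorem tailInequality_top_left (ha : HasSlowBound a) (hs : s ≠ 0) :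
    (∃ K, K ≠ ∞ ∧ TailInequality ∞ s a b K) ↔ R₃ s a b ≠ ∞ := by
  obtain ⟨C, hC⟩ := ha.le_eLpNorm_top
  set α : ℝ → ℝ≥0∞ := fun u => eLpNorm a ∞ (logMeasure.restrict (Ioo 0 u)) with hα_def
  have hα : ∀ u, lebNorm ∞ (Ioo 0 u) a = α u := fun u => by
    change _ = eLpNorm a ∞ _
    rw [← lebNorm_Ioo_eq ENNReal.top_ne_zero]
    simp only [recip_top, neg_zero, pw_zero, one_mul]
  have hα0 : Antitone fun u => (α u)⁻¹ := fun u v h =>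
    ENNReal.inv_le_inv.2 (eLpNorm_mono_measure _
      (Measure.restrict_mono (Ioo_subset_Ioo_right h) le_rfl))
  have haα : ∀ u, 0 < u → a u ≤ C * α u := fun u hu => by
    have := hC (fun _ => 1) u u hu le_rfl fun _ _ _ => le_rfl
    simp only [mul_one] at this
    exact this
  have hR : R₃ s a b =
      eLpNorm (fun t => b t * ∫⁻ u in Ioi t, (α u)⁻¹ ∂logMeasure) s logMeasure := by
    nth_rw 2 [← logMeasure_restrict_Ioi]
    rw [← lebNorm_eq hs measurableSet_Ioi Subset.rfl, R₃, lebNorm, lebNorm]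
    refine eLpNorm_congr_ae ?_
    filter_upwards [ae_restrict_mem measurableSet_Ioi] with t ht
    rw [setLIntegral_logMeasure measurableSet_Ioi (Ioi_subset_Ioi (le_of_lt ht)), mul_assoc]
    simp only [hα]
  rw [hR]
  constructor
  · rintro ⟨K, hK, H⟩
    refine ne_top_of_le_ne_top (ENNReal.mul_ne_top hK (ENNReal.coe_ne_top (r := C)))
      ((H _ hα0).trans ?_)
    gcongr
    rw [eLpNorm_exponent_top]
    refine eLpNormEssSup_le_of_ae_enorm_bound ?_
    filter_upwards [ae_pos_of_null logMeasure_Iic] with t ht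
    calc a t * (α t)⁻¹ ≤ C * α t * (α t)⁻¹ := by
          gcongr
          exact haα t ht
      _ = C * (α t * (α t)⁻¹) := mul_assoc _ _ _
      _ ≤ C * 1 := by
          gcongr
          exact ENNReal.mul_inv_le_one _
      _ = C := mul_one _
  · intro hfin
    refine ⟨_, ENNReal.add_ne_top.2 ⟨hfin, ENNReal.one_ne_top⟩, fun f hf => ?_⟩
    set M := eLpNorm (fun t => a t * f t) ∞ logMeasure with hM_def
    rcases eq_or_ne M ∞ with hM | hM
    · rw [hM, ENNReal.mul_top (by simp)]
      exact le_top
    have hfα : ∀ u, 0 < u → f u ≤ M * (α u)⁻¹ := by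
      intro u hu
      have h1 : f u * α u ≤ M := by
        refine (mul_eLpNorm_le (f := fun t => a t * f t) ∞ ?_).trans
          (eLpNorm_mono_measure _ Measure.restrict_le_self)
        filter_upwards [ae_restrict_mem measurableSet_Ioo] with t ht
        rw [mul_comm]
        gcongr
        exact hf ht.2.le
      rw [← div_eq_mul_inv]
      have hα1 : α u ≠ 0 := fun h => ha.ne_zero u hu (by simpa [h] using haα u hu)
      rcases eq_or_ne (α u) ∞ with h | h
      · rw [h] at h1 ⊢
        rcases eq_or_ne (f u) 0 with h0 | h0
        · rw [h0]
          exact zero_le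
        · rw [ENNReal.mul_top h0] at h1
          exact absurd (top_le_iff.1 h1) hM
      · exact (ENNReal.le_div_iff_mul_le (Or.inl hα1) (Or.inl h)).2 h1
    calc eLpNorm (fun t => b t * ∫⁻ v in Ioi t, f v ∂logMeasure) s logMeasure
        ≤ M.toNNReal * eLpNorm (fun t => b t * ∫⁻ u in Ioi t, (α u)⁻¹ ∂logMeasure) s logMeasure := by
          refine eLpNorm_le_mul s ?_
          filter_upwards [ae_pos_of_null logMeasure_Iic] with t ht
          rw [ENNReal.coe_toNNReal hM, mul_left_comm, ← lintegral_const_mul' _ _ hM]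
          gcongr b t * ?_
          exact setLIntegral_mono' measurableSet_Ioi fun u hu => hfα u (ht.trans hu)
      _ ≤ _ := by
          rw [ENNReal.coe_toNNReal hM, mul_comm]
          gcongr
          exact le_self_add

theorem R₁_top_tailInequality (ha : HasSlowBound a) (hb : HasSlowBound b)
    (hν : IsWeight (weight a 1)) :
    ∃ C : ℝ≥0, TailInequality 1 ∞ a b (C * R₁ 1 ∞ a b) := by
  obtain ⟨C, hC⟩ := hb.le_eLpNorm_top
  refine ⟨C, fun f hf => ?_⟩
  rw [eLpNorm_exponent_top, ha.eLpNorm_mul_eq one_ne_zero ENNReal.one_ne_top]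
  simp only [ENNReal.toReal_one, ENNReal.rpow_one, div_one]
  refine eLpNormEssSup_le_of_ae_enorm_bound ?_
  filter_upwards [ae_pos_of_null logMeasure_Iic] with u hu
  have key := lintegral_rpow_le_of_antitone (ν := weight a 1) (M := b u • logMeasure.restrict (Ioi u))
    (R := C * R₁ 1 ∞ a b) (q := 1) le_rfl (fun x => ?_) hf
  · simpa using key
  rw [ENNReal.rpow_one, Measure.smul_apply, smul_eq_mul, Measure.restrict_apply measurableSet_Iic]
  rcases le_or_gt x u with hxu | hux
  · have : Iic x ∩ Ioi u = ∅ := by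
      ext t
      simp only [mem_inter_iff, mem_Iic, mem_Ioi, mem_empty_iff_false, iff_false, not_and, not_lt]
      exact fun h => h.trans hxu
    rw [this, measure_empty, mul_zero]
    exact zero_le
  · have hx : 0 < x := hu.trans hux
    have h1 : logMeasure (Iic x ∩ Ioi u) = logK u x := by
      rw [inter_comm, Ioi_inter_Iic, ← measure_congr Ioo_ae_eq_Ioc, logMeasure_Ioo hu hx]
    have h2 : eLpNorm (fun t => b t * logK t x) ∞ (logMeasure.restrict (Ioo 0 x)) *
        (weight a 1 (Iio x))⁻¹ ≤ R₁ 1 ∞ a b := by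
      rw [R₁, if_pos le_top]
      refine le_trans (le_of_eq ?_) (le_iSup₂ x hx)
      rw [lebNorm_Ioo_log_eq ENNReal.top_ne_zero, lebNorm_Ioo_eq one_ne_zero,
        eLpNorm_Ioo_eq one_ne_zero ENNReal.one_ne_top]
      simp
    have h3 : eLpNorm (fun t => b t * logK t x) ∞ (logMeasure.restrict (Ioo 0 x)) ≤
        R₁ 1 ∞ a b * weight a 1 (Iio x) := by
      rwa [← div_eq_mul_inv, ENNReal.div_le_iff (ha.weight_Iio_ne_zero hx) (hν.ne_top x)] at h2
    rw [h1]
    calc b u * logK u x ≤ C * eLpNorm (fun t => b t * logK t x) ∞ (logMeasure.restrict (Ioo 0 x)) :=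
          hC (fun t => logK t x) u x hu hux.le fun t ht htu => logK_anti ht hx htu
      _ ≤ C * (R₁ 1 ∞ a b * weight a 1 (Iio x)) := by gcongr
      _ = _ := by ring

theorem R₂_top_tailInequality (ha : HasSlowBound a) (hb : HasSlowBound b) (h1 : 1 < r)
    (hr' : r ≠ ∞) (hν : IsWeight (weight a r.toReal)) :
    ∃ C : ℝ≥0, TailInequality r ∞ a b (C * R₂ r ∞ a b) := by
  obtain ⟨C, hC⟩ := hb.le_eLpNorm_top
  obtain ⟨C', hC'⟩ := hν.lintegral_Ioi_le_tail (holderConjugate_conj h1 hr')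
  refine ⟨C * C', fun f hf => ?_⟩
  rw [eLpNorm_exponent_top, ha.eLpNorm_mul_eq (one_pos.trans h1).ne' hr']
  refine eLpNormEssSup_le_of_ae_enorm_bound ?_
  filter_upwards [ae_pos_of_null logMeasure_Iic] with u hu
  have h2 : eLpNorm b ∞ (logMeasure.restrict (Ioo 0 u)) *
      tail (weight a r.toReal) (conj r).toReal u ^ (1 / (conj r).toReal) ≤ R₂ r ∞ a b := by
    rw [R₂, if_pos le_top, ← ha.lebNorm_tail_eq h1 hu, ← lebNorm_Ioo_eq ENNReal.top_ne_zero]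
    exact le_iSup₂_of_le u hu le_rfl
  have h3 : b u ≤ C * eLpNorm b ∞ (logMeasure.restrict (Ioo 0 u)) := by
    have := hC (fun _ => 1) u u hu le_rfl fun _ _ _ => le_rfl
    simp only [mul_one] at this
    exact this
  set N := (∫⁻ t, f t ^ r.toReal ∂(weight a r.toReal)) ^ (1 / r.toReal)
  calc b u * ∫⁻ v in Ioi u, f v ∂logMeasure
      ≤ C * eLpNorm b ∞ (logMeasure.restrict (Ioo 0 u)) *
          (C' * tail (weight a r.toReal) (conj r).toReal u ^ (1 / (conj r).toReal) * N) :=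
        mul_le_mul' h3 (hC' u hu f hf)
    _ = C * C' * (eLpNorm b ∞ (logMeasure.restrict (Ioo 0 u)) *
          tail (weight a r.toReal) (conj r).toReal u ^ (1 / (conj r).toReal)) * N := by ring
    _ ≤ C * C' * R₂ r ∞ a b * N := by gcongr
    _ = _ := by push_cast; ring

end

/-! ### Characterization of the inequality for decreasing functions -/

section

variable {a b : ℝ → ℝ≥0∞} {r s : ℝ≥0∞}

theorem tailInequality_of_le (ha : HasSlowBound a) (hb : HasSlowBound b) (hr : 1 ≤ r) (hrs : r ≤ s)
    (hs : s ≠ ∞) (hν : ∀ x, weight a r.toReal (Iio x) ≠ ∞) {Θ : ℝ → ℝ≥0∞} {A : ℝ≥0∞} (hA : A ≠ ∞)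
    (hΘ : ∀ x, 0 < x → ∀ g : ℝ → ℝ≥0∞, Antitone g → ∫⁻ v in Ioi x, g v ∂logMeasure ≤
      Θ x * (∫⁻ u, g u ^ r.toReal ∂(weight a r.toReal)) ^ (1 / r.toReal))
    (hΘA : ∀ x, 0 < x → weight b s.toReal (Iio x) ^ (1 / s.toReal) * Θ x ≤ A)
    (hR : R₁ r s a b ≤ A) : ∃ K, K ≠ ∞ ∧ TailInequality r s a b K := by
  have hr' : r ≠ ∞ := ne_top_of_le_ne_top hs hrs
  have hr0 : r ≠ 0 := (one_pos.trans_le hr).ne'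
  have hs0 : s ≠ 0 := (one_pos.trans_le (hr.trans hrs)).ne'
  have hs1 := ENNReal.toReal_pos hs0 hs
  have hr1 : 1 ≤ r.toReal := by
    rw [← ENNReal.toReal_one]
    exact ENNReal.toReal_mono hr' hr
  have hrs1 : r.toReal ≤ s.toReal := ENNReal.toReal_mono hs hrs
  have h1 : ∀ x, 0 < x → weight b s.toReal (Iio x) * Θ x ^ s.toReal ≤ A ^ s.toReal := by
    intro x hx
    have := ENNReal.rpow_le_rpow (hΘA x hx) hs1.le
    rwa [ENNReal.mul_rpow_of_nonneg _ _ hs1.le, one_div, ENNReal.rpow_inv_rpow hs1.ne'] at this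
  have h2 : ∀ x, 0 < x → ∫⁻ u, logK u x ^ s.toReal ∂(weight b s.toReal) ≤
      A ^ s.toReal * weight a r.toReal (Iio x) ^ (s.toReal / r.toReal) := by
    intro x hx
    have h3 : (∫⁻ u, logK u x ^ s.toReal ∂(weight b s.toReal)) ^ (1 / s.toReal) *
        (weight a r.toReal (Iio x) ^ (1 / r.toReal))⁻¹ ≤ A := by
      refine le_trans ?_ hR
      rw [R₁, if_pos hrs, ← eLpNorm_log_eq hb hs0 hs hx, ← eLpNorm_Ioo_eq hr0 hr',
        ← lebNorm_Ioo_log_eq hs0, ← lebNorm_Ioo_eq hr0]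
      exact le_iSup₂_of_le x hx le_rfl
    rw [← div_eq_mul_inv, ENNReal.div_le_iff, one_div s.toReal, ENNReal.rpow_inv_le_iff hs1,
      ENNReal.mul_rpow_of_nonneg _ _ hs1.le, ← ENNReal.rpow_mul] at h3
    · rwa [show 1 / r.toReal * s.toReal = s.toReal / r.toReal by ring] at h3
    · exact (ENNReal.rpow_pos (pos_iff_ne_zero.2 (ha.weight_Iio_ne_zero hx)) (hν x)).ne'
    · exact ENNReal.rpow_ne_top_of_nonneg (by positivity) (hν x)
  set c : ℝ≥0∞ := (4 ^ s.toReal * 2 ^ (s.toReal - 1) * (ENNReal.ofReal (s.toReal / r.toReal) + 1)) *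
    A ^ s.toReal with hc
  have hctop : c ≠ ∞ := by
    refine ENNReal.mul_ne_top (ENNReal.mul_ne_top (ENNReal.mul_ne_top ?_ ?_) (by simp)) ?_
    · exact ENNReal.rpow_ne_top_of_nonneg hs1.le (by norm_num)
    · exact ENNReal.rpow_ne_top_of_nonneg (by linarith) (by norm_num)
    · exact ENNReal.rpow_ne_top_of_nonneg hs1.le hA
  refine ⟨c ^ (s.toReal)⁻¹, ENNReal.rpow_ne_top_of_nonneg (by positivity) hctop,
    (tailInequality_iff ha hb hr0 hr' hs0 hs).2 fun f hf => ?_⟩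
  rw [ENNReal.rpow_inv_rpow hs1.ne']
  exact hardy_of_le (weight_Iic _ _) hr1 hrs1 hΘ h1 h2 hf

theorem tailInequality_of_one_lt_of_le (ha : HasSlowBound a) (hb : HasSlowBound b) (hr : 1 < r)
    (hrs : r ≤ s) (hs : s ≠ ∞) (hν : IsWeight (weight a r.toReal)) (h₁ : R₁ r s a b ≠ ∞)
    (h₂ : R₂ r s a b ≠ ∞) : ∃ K, K ≠ ∞ ∧ TailInequality r s a b K := by
  have hr' : r ≠ ∞ := ne_top_of_le_ne_top hs hrs
  have hs0 : s ≠ 0 := (one_pos.trans_le (hr.le.trans hrs)).ne'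
  obtain ⟨C, hC⟩ := hν.lintegral_Ioi_le_tail (holderConjugate_conj hr hr')
  refine tailInequality_of_le ha hb hr.le hrs hs hν.ne_top
    (ENNReal.add_ne_top.2 ⟨h₁, ENNReal.mul_ne_top (ENNReal.coe_ne_top (r := C)) h₂⟩) hC
    (fun x hx => ?_) le_self_add
  calc _ = C * (weight b s.toReal (Iio x) ^ (1 / s.toReal) *
        tail (weight a r.toReal) (conj r).toReal x ^ (1 / (conj r).toReal)) := by ring
    _ ≤ C * R₂ r s a b := by
        gcongr
        rw [R₂, if_pos hrs, ← ha.lebNorm_tail_eq hr hx, ← eLpNorm_Ioo_eq hs0 hs,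
          ← lebNorm_Ioo_eq hs0]
        exact le_iSup₂_of_le x hx le_rfl
    _ ≤ _ := le_add_self

theorem tailInequality_of_eq_one (ha : HasSlowBound a) (hb : HasSlowBound b) (hs1 : 1 ≤ s)
    (hs : s ≠ ∞) (hν : IsWeight (weight a 1)) (h₁ : R₁ 1 s a b ≠ ∞) :
    ∃ K, K ≠ ∞ ∧ TailInequality 1 s a b K := by
  have hs0 : s ≠ 0 := (one_pos.trans_le hs1).ne'
  have hs' := ENNReal.toReal_pos hs0 hs
  refine tailInequality_of_le ha hb le_rfl hs1 hs (by simpa using hν.ne_top) h₁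
    (Θ := fun x => ⨆ t ∈ Ioi x, logK x t * (weight a 1 (Iio t))⁻¹) (fun x hx g hg => ?_)
    (fun x hx => ?_) le_rfl
  · have key := lintegral_rpow_le_of_antitone (ν := weight a 1) (M := logMeasure.restrict (Ioi x))
      (R := ⨆ t ∈ Ioi x, logK x t * (weight a 1 (Iio t))⁻¹) (q := 1) le_rfl (fun t => ?_) hg
    · simpa using key
    rcases le_or_gt t x with htx | hxt
    · have : Iic t ∩ Ioi x = ∅ := by
        ext u
        simp only [mem_inter_iff, mem_Iic, mem_Ioi, mem_empty_iff_false, iff_false, not_and, not_lt]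
        exact fun h => h.trans htx
      rw [Measure.restrict_apply measurableSet_Iic, this, measure_empty]
      exact zero_le
    · have ht : 0 < t := hx.trans hxt
      rw [← measure_congr Iio_ae_eq_Iic, logMeasure_restrict_Ioi_Iio hx ht, ENNReal.rpow_one,
        ← ENNReal.div_le_iff (ha.weight_Iio_ne_zero ht) (hν.ne_top t), div_eq_mul_inv]
      exact le_iSup₂_of_le t hxt le_rfl
  · simp only [ENNReal.mul_iSup]
    refine iSup₂_le fun t ht => ?_
    have ht0 : 0 < t := hx.trans ht
    have h2 : weight b s.toReal (Iio x) ^ (1 / s.toReal) * logK x t ≤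
        (∫⁻ u, logK u t ^ s.toReal ∂(weight b s.toReal)) ^ (1 / s.toReal) := by
      rw [one_div, ENNReal.le_rpow_inv_iff hs', ENNReal.mul_rpow_of_nonneg _ _ hs'.le,
        ENNReal.rpow_inv_rpow hs'.ne', mul_comm, ← setLIntegral_const,
        restrict_Iio_eq (weight_Iic _ _)]
      refine (setLIntegral_mono' measurableSet_Ioo fun u hu => ?_).trans (setLIntegral_le_lintegral _ _)
      exact ENNReal.rpow_le_rpow (logK_anti hu.1 ht0 hu.2.le) hs'.le
    rw [← mul_assoc]
    refine (mul_le_mul_left h2 _).trans ?_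
    rw [R₁, if_pos hs1, ← eLpNorm_log_eq hb hs0 hs ht0, ← lebNorm_Ioo_log_eq hs0]
    refine le_trans (le_of_eq ?_) (le_iSup₂_of_le t ht0 le_rfl)
    rw [lebNorm_Ioo_eq one_ne_zero, eLpNorm_Ioo_eq one_ne_zero ENNReal.one_ne_top]
    simp

/-! ### The case `s < r` -/

theorem recip_rho (hs : 1 ≤ s) (hsr : s < r) : recip (rho r s) = 1 / s.toReal - 1 / r.toReal := by
  rw [recip, rho, inv_inv, ENNReal.toReal_sub_of_le (ENNReal.inv_le_inv.2 hsr.le)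
    (ENNReal.inv_ne_top.2 (one_pos.trans_le hs).ne'), ENNReal.toReal_inv, ENNReal.toReal_inv,
    one_div, one_div]

theorem rho_ne_zero (hs : 1 ≤ s) : rho r s ≠ 0 :=
  ENNReal.inv_ne_zero.2 (ne_top_of_le_ne_top (ENNReal.inv_ne_top.2 (one_pos.trans_le hs).ne')
    tsub_le_self)

theorem rho_ne_top (hsr : s < r) : rho r s ≠ ∞ :=
  ENNReal.inv_ne_top.2 (tsub_pos_of_lt (ENNReal.inv_lt_inv.2 hsr)).ne'

theorem rho_toReal (hs : 1 ≤ s) (hsr : s < r) (hr : r ≠ ∞) :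
    (rho r s).toReal = s.toReal * (r.toReal / (r.toReal - s.toReal)) := by
  have h := recip_rho hs hsr
  have h0 := ENNReal.toReal_pos (rho_ne_zero (r := r) hs) (rho_ne_top hsr)
  have hs0 : 0 < s.toReal := ENNReal.toReal_pos (one_pos.trans_le hs).ne' hsr.ne_top
  have hsr' : s.toReal < r.toReal := ENNReal.toReal_strict_mono hr hsr
  have hr0 : 0 < r.toReal := hs0.trans hsr'
  have hd : 0 < r.toReal - s.toReal := sub_pos.2 hsr'
  rw [recip_eq] at h
  have h1 : (rho r s).toReal = 1 / (1 / s.toReal - 1 / r.toReal) := by rw [← h, one_div_one_div]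
  rw [h1]
  field_simp

theorem holderConjugate_div {x y : ℝ} (hy : 0 < y) (hxy : y < x) :
    (x / y).HolderConjugate (x / (x - y)) := by
  have hd : 0 < x - y := sub_pos.2 hxy
  have hx : 0 < x := hy.trans hxy
  rw [Real.holderConjugate_iff]
  refine ⟨(one_lt_div hy).2 hxy, ?_⟩
  field_simp
  ring

theorem R₁_rpow_eq (ha : HasSlowBound a) (hb : HasSlowBound b) (hs : 1 ≤ s) (hsr : s < r)
    (hr : r ≠ ∞) {q : ℝ} (hq : q = r.toReal / (r.toReal - s.toReal)) :
    R₁ r s a b ^ s.toReal = (∫⁻ t, ((∫⁻ u, logK u t ^ s.toReal ∂(weight b s.toReal)) *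
      (weight a r.toReal (Iio t))⁻¹) ^ q ∂(weight a r.toReal)) ^ (1 / q) := by
  have hs0 : s ≠ 0 := (one_pos.trans_le hs).ne'
  have hr0 : r ≠ 0 := (hsr.trans_le' zero_le).ne'
  have hst := hsr.ne_top
  have hs' := ENNReal.toReal_pos hs0 hst
  have hr' := ENNReal.toReal_pos hr0 hr
  have hρ0 := rho_ne_zero (r := r) hs
  have hρt := rho_ne_top hsr
  have hρ' := ENNReal.toReal_pos hρ0 hρt
  have hρ := rho_toReal hs hsr hr
  rw [← hq] at hρ
  have hq0 : 0 < q := by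
    rw [hρ] at hρ'
    exact pos_of_mul_pos_right hρ' hs'.le
  rw [R₁, if_neg (not_le.2 hsr)]
  simp only [mul_assoc]
  rw [lebNorm_eq hρ0 measurableSet_Ioi Subset.rfl, logMeasure_restrict_Ioi,
    eLpNorm_rpow_toReal hρ0 hρt, ← ENNReal.rpow_mul, ha.lintegral_weight ENNReal.toReal_nonneg]
  congr 1
  · refine lintegral_congr_ae ?_
    filter_upwards [ae_pos_of_null logMeasure_Iic] with t ht
    simp only [← mul_assoc]
    rw [lebNorm_Ioo_log_eq hs0, eLpNorm_log_eq hb hs0 hst ht, lebNorm_Ioo_eq hr0,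
      eLpNorm_Ioo_eq hr0 hr, ENNReal.mul_rpow_of_nonneg _ _ hρ'.le,
      ENNReal.mul_rpow_of_nonneg _ _ hρ'.le, rpow_mul_recip_rpow _ hρ0 hρt,
      ENNReal.mul_rpow_of_nonneg _ _ hq0.le, mul_assoc, ← ENNReal.rpow_mul, ← ENNReal.rpow_mul,
      ← ENNReal.rpow_mul, ENNReal.inv_rpow, ← ENNReal.rpow_neg, hρ, recip_eq]
    congr 3
    · field_simp
    · field_simp
  · rw [hρ]
    field_simp

theorem R₂_rpow_eq (ha : HasSlowBound a) (hb : HasSlowBound b) (hs : 1 ≤ s) (hsr : s < r)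
    (hr : r ≠ ∞) {q : ℝ} (hq : q = r.toReal / (r.toReal - s.toReal)) :
    R₂ r s a b ^ s.toReal = (∫⁻ u, weight b s.toReal (Iio u) ^ (q - 1) *
      tail (weight a r.toReal) (conj r).toReal u ^ (s.toReal * q / (conj r).toReal)
        ∂(weight b s.toReal)) ^ (1 / q) := by
  have hs0 : s ≠ 0 := (one_pos.trans_le hs).ne'
  have hr0 : r ≠ 0 := (hsr.trans_le' zero_le).ne'
  have hst := hsr.ne_top
  have hs' := ENNReal.toReal_pos hs0 hst
  have hr' := ENNReal.toReal_pos hr0 hr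
  have hsr' : s.toReal < r.toReal := ENNReal.toReal_strict_mono hr hsr
  have hd : 0 < r.toReal - s.toReal := sub_pos.2 hsr'
  have hρ0 := rho_ne_zero (r := r) hs
  have hρt := rho_ne_top hsr
  have hρ' := ENNReal.toReal_pos hρ0 hρt
  have hρ := rho_toReal hs hsr hr
  rw [← hq] at hρ
  have hq0 : 0 < q := by
    rw [hρ] at hρ'
    exact pos_of_mul_pos_right hρ' hs'.le
  rw [R₂, if_neg (not_le.2 hsr)]
  simp only [mul_assoc]
  rw [lebNorm_eq hρ0 measurableSet_Ioi Subset.rfl, logMeasure_restrict_Ioi,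
    eLpNorm_rpow_toReal hρ0 hρt, ← ENNReal.rpow_mul, hb.lintegral_weight ENNReal.toReal_nonneg]
  congr 1
  · refine lintegral_congr_ae ?_
    filter_upwards [ae_pos_of_null logMeasure_Iic] with t ht
    simp only [← mul_assoc]
    rw [ha.lebNorm_tail_eq (hs.trans_lt hsr) ht, lebNorm_Ioo_eq hs0,
      eLpNorm_Ioo_eq hs0 hst, ENNReal.mul_rpow_of_nonneg _ _ hρ'.le,
      ENNReal.mul_rpow_of_nonneg _ _ hρ'.le, rpow_mul_recip_rpow _ hρ0 hρt,
      ← ENNReal.rpow_mul, ← ENNReal.rpow_mul, ← ENNReal.rpow_mul, hρ, recip_eq]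
    congr 1
    · congr 2
      rw [hq]
      field_simp
      ring
    · congr 1
      ring
  · rw [hρ]
    field_simp

theorem tailInequality_iff_of_lt (ha : HasSlowBound a) (hb : HasSlowBound b) (hs : 1 < s)
    (hsr : s < r) (hr : r ≠ ∞) (hν : IsWeight (weight a r.toReal)) :
    (∃ K, K ≠ ∞ ∧ TailInequality r s a b K) ↔ R₁ r s a b + R₂ r s a b ≠ ∞ := by
  have hs0 : s ≠ 0 := (one_pos.trans hs).ne'
  have hr0 : r ≠ 0 := (hsr.trans_le' zero_le).ne'
  have hst := hsr.ne_top
  have hs' := ENNReal.toReal_pos hs0 hst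
  have hsr' : s.toReal < r.toReal := ENNReal.toReal_strict_mono hr hsr
  have hs1 : 1 ≤ s.toReal := by
    rw [← ENNReal.toReal_one]
    exact ENNReal.toReal_mono hst hs.le
  have hrp : r.toReal = s.toReal * (r.toReal / s.toReal) := by field_simp
  have hpe : 1 / (r.toReal / s.toReal) = s.toReal / r.toReal := one_div_div _ _
  have hpq := holderConjugate_div hs' hsr'
  have hrr := holderConjugate_conj (hs.trans hsr) hr
  constructor
  · rintro ⟨K, hK, H⟩
    rw [tailInequality_iff ha hb hr0 hr hs0 hst, ← hpe] at H
    obtain ⟨C, hC⟩ := hν.lintegral_logK_div_rpow_le hpq hs1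
    obtain ⟨C', hC'⟩ := hν.lintegral_tail_rpow_le hs1 hrr hrp hpq
    have hKs : K ^ s.toReal ≠ ∞ := ENNReal.rpow_ne_top_of_nonneg hs'.le hK
    have h1 := hC (weight b s.toReal) (weight_Iic _ _) _ (by rwa [← hrp])
    have h2 := hC' (weight b s.toReal) (weight_Iic _ _)
      (fun x y hx => hb.weight_Ioo_ne_top ENNReal.toReal_nonneg hx) _ H
    rw [← R₁_rpow_eq ha hb hs.le hsr hr rfl] at h1
    rw [← R₂_rpow_eq ha hb hs.le hsr hr rfl] at h2
    refine ENNReal.add_ne_top.2 ⟨fun h => ?_, fun h => ?_⟩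
    · rw [h, ENNReal.top_rpow_of_pos hs', top_le_iff] at h1
      exact ENNReal.mul_ne_top ENNReal.coe_ne_top hKs h1
    · rw [h, ENNReal.top_rpow_of_pos hs', top_le_iff] at h2
      exact ENNReal.mul_ne_top ENNReal.coe_ne_top hKs h2
  · intro h
    obtain ⟨h1, h2⟩ := ENNReal.add_ne_top.1 h
    obtain ⟨C, hC⟩ := hν.hardy_of_lt (ω := weight b s.toReal) (weight_Iic _ _)
      (fun x y hx => hb.weight_Ioo_ne_top ENNReal.toReal_nonneg hx) hs1 hrr hrp hpq
    rw [← R₁_rpow_eq ha hb hs.le hsr hr rfl, ← R₂_rpow_eq ha hb hs.le hsr hr rfl, hpe] at hC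
    have hc : (C : ℝ≥0∞) * (R₁ r s a b ^ s.toReal + R₂ r s a b ^ s.toReal) ≠ ∞ :=
      ENNReal.mul_ne_top ENNReal.coe_ne_top (ENNReal.add_ne_top.2
        ⟨ENNReal.rpow_ne_top_of_nonneg hs'.le h1, ENNReal.rpow_ne_top_of_nonneg hs'.le h2⟩)
    refine ⟨_, ENNReal.rpow_ne_top_of_nonneg (inv_nonneg.2 hs'.le) hc,
      (tailInequality_iff ha hb hr0 hr hs0 hst).2 fun f hf => ?_⟩
    rw [ENNReal.rpow_inv_rpow hs'.ne']
    exact hC f hf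

theorem tailInequality_iff_of_eq_one (ha : HasSlowBound a) (hb : HasSlowBound b) (h1 : 1 < r)
    (hr : r ≠ ∞) (hν : IsWeight (weight a r.toReal)) :
    (∃ K, K ≠ ∞ ∧ TailInequality r 1 a b K) ↔ R₁ r 1 a b ≠ ∞ := by
  have hr0 : r ≠ 0 := (one_pos.trans h1).ne'
  have hr1 : 1 < r.toReal := by
    rw [← ENNReal.toReal_one]
    exact ENNReal.toReal_strict_mono hr h1
  have hpq := holderConjugate_div one_pos hr1
  rw [div_one] at hpq
  have hR := R₁_rpow_eq ha hb le_rfl h1 hr (q := r.toReal / (r.toReal - 1)) (by simp)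
  simp only [ENNReal.toReal_one, ENNReal.rpow_one] at hR
  have hiff := fun K => tailInequality_iff (K := K) ha hb hr0 hr one_ne_zero ENNReal.one_ne_top
  simp only [ENNReal.toReal_one, ENNReal.rpow_one] at hiff
  simp only [hiff]
  constructor
  · rintro ⟨K, hK, H⟩
    obtain ⟨C, hC⟩ := hν.lintegral_logK_div_rpow_le hpq le_rfl
    have := hC (weight b 1) (weight_Iic _ _) K (by simpa only [one_mul, ENNReal.rpow_one] using H)
    simp only [ENNReal.rpow_one] at this
    rw [hR]
    exact ne_top_of_le_ne_top (ENNReal.mul_ne_top ENNReal.coe_ne_top hK) this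
  · intro h
    obtain ⟨C, hC⟩ := hν.hardy_one (ω := weight b 1) (weight_Iic _ _) hpq
    rw [← hR] at hC
    exact ⟨C * R₁ r 1 a b, ENNReal.mul_ne_top ENNReal.coe_ne_top h, hC⟩

/-! ### The degenerate case -/

theorem lebNorm_eq_zero {p : ℝ≥0∞} {I : Set ℝ} (hI : MeasurableSet I) {h : ℝ → ℝ≥0∞}
    (hh : ∀ t ∈ I, h t = 0) : lebNorm p I h = 0 := by
  rw [lebNorm, eLpNorm_congr_ae (g := fun _ => 0)]
  · exact eLpNorm_zero'
  · filter_upwards [ae_restrict_mem hI] with t ht using hh t ht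

theorem Rinf_eq_zero (hr : 1 ≤ r) (hr' : r ≠ ∞) (hs : 1 ≤ s)
    (hν : ∀ x, 0 < x → weight a r.toReal (Iio x) = ∞) : Rinf r s a b = 0 := by
  have hr0 : r ≠ 0 := (one_pos.trans_le hr).ne'
  have hs0 : s ≠ 0 := (one_pos.trans_le hs).ne'
  have hr1 := ENNReal.toReal_pos hr0 hr'
  have hN : ∀ x, 0 < x → lebNorm r (Ioo 0 x) (fun t => pw t (-recip r) * a t) = ∞ := fun x hx => by
    rw [lebNorm_Ioo_eq hr0, eLpNorm_Ioo_eq hr0 hr', hν x hx, ENNReal.top_rpow_of_pos (by positivity)]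
  have h₁ : R₁ r s a b = 0 := by
    rw [R₁]
    split_ifs with h
    · refine le_antisymm (iSup₂_le fun x hx => ?_) zero_le
      rw [hN x hx, ENNReal.inv_top, mul_zero]
    · refine lebNorm_eq_zero measurableSet_Ioi fun t ht => ?_
      have hs' : 0 < s.toReal := ENNReal.toReal_pos hs0 (not_le.1 h).ne_top
      rw [hN t ht, ENNReal.top_rpow_of_neg, mul_zero]
      rw [recip_eq]
      exact neg_neg_of_pos (by positivity)
  have h₂ : R₂ r s a b = 0 := by
    have hz : ∀ x, 0 < x → lebNorm (conj r) (Ioi x) (fun t => pw t (-recip (conj r)) *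
          a t ^ (r.toReal * recip (conj r)) * (V r a t)⁻¹ * ENNReal.ofReal (Real.log (t / x))) = 0 :=
      fun x hx => lebNorm_eq_zero measurableSet_Ioi fun t ht => by
        rw [← weight_Iio_eq_V, hν t (hx.trans ht), ENNReal.inv_top, mul_zero, zero_mul]
    rw [R₂]
    split_ifs with h
    · refine le_antisymm (iSup₂_le fun x hx => ?_) zero_le
      rw [hz x hx, mul_zero]
    · refine lebNorm_eq_zero measurableSet_Ioi fun t ht => ?_
      rw [hz t ht, mul_zero]
  rw [Rinf, if_neg hr', h₁, h₂]
  split_ifs <;> simp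

theorem tailInequality_of_weight_eq_top (ha : HasSlowBound a) (hr : 1 ≤ r) (hr' : r ≠ ∞)
    (hν : ∀ x, 0 < x → weight a r.toReal (Iio x) = ∞) : TailInequality r s a b 1 := by
  have hr0 : r ≠ 0 := (one_pos.trans_le hr).ne'
  have hr1 := ENNReal.toReal_pos hr0 hr'
  intro f hf
  rw [one_mul]
  by_cases h : ∀ t, 0 < t → f t = 0
  · have h0 : eLpNorm (fun t => b t * ∫⁻ v in Ioi t, f v ∂logMeasure) s logMeasure = 0 := by
      rw [eLpNorm_congr_ae (g := fun _ => 0)]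
      · exact eLpNorm_zero'
      · filter_upwards [ae_pos_of_null logMeasure_Iic] with t ht
        rw [setLIntegral_congr_fun measurableSet_Ioi fun v hv => h v (ht.trans hv), lintegral_zero,
          mul_zero]
    rw [h0]
    exact zero_le
  · push Not at h
    obtain ⟨t, ht, hft⟩ := h
    rw [ha.eLpNorm_mul_eq hr0 hr']
    have : ∫⁻ u, f u ^ r.toReal ∂(weight a r.toReal) = ∞ := by
      refine top_le_iff.1 ?_
      calc ∞ = f t ^ r.toReal * weight a r.toReal (Iio t) := by
            rw [hν t ht, ENNReal.mul_top]
            exact fun h => hft ((ENNReal.rpow_eq_zero_iff_of_pos hr1).1 h)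
        _ = ∫⁻ _ in Iio t, f t ^ r.toReal ∂(weight a r.toReal) := (setLIntegral_const _ _).symm
        _ ≤ ∫⁻ u in Iio t, f u ^ r.toReal ∂(weight a r.toReal) :=
            setLIntegral_mono' measurableSet_Iio fun u hu =>
              ENNReal.rpow_le_rpow (hf (le_of_lt hu)) hr1.le
        _ ≤ _ := setLIntegral_le_lintegral _ _
    rw [this, ENNReal.top_rpow_of_pos (by positivity)]
    exact le_top

theorem tailInequality_iff_Rinf_of_isWeight (ha : HasSlowBound a) (hb : HasSlowBound b)
    (hr : 1 ≤ r) (hr' : r ≠ ∞) (hs : 1 ≤ s) (hν : IsWeight (weight a r.toReal)) :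
    (∃ K, K ≠ ∞ ∧ TailInequality r s a b K) ↔ Rinf r s a b ≠ ∞ := by
  have hr0 : r ≠ 0 := (one_pos.trans_le hr).ne'
  have hs0 : s ≠ 0 := (one_pos.trans_le hs).ne'
  rw [Rinf, if_neg hr']
  rcases hr.eq_or_lt with rfl | hr1
  · rw [if_pos (Or.inl rfl)]
    rw [ENNReal.toReal_one] at hν
    refine ⟨fun ⟨K, hK, H⟩ => ne_top_of_le_ne_top hK (H.R₁_le hr0 hs0 hs), fun h => ?_⟩
    rcases eq_or_ne s ∞ with rfl | hst
    · obtain ⟨C, hC⟩ := R₁_top_tailInequality ha hb hν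
      exact ⟨_, ENNReal.mul_ne_top ENNReal.coe_ne_top h, hC⟩
    · exact tailInequality_of_eq_one ha hb hs hst hν h
  rcases hs.eq_or_lt with rfl | hs1
  · rw [if_pos (Or.inr rfl)]
    exact tailInequality_iff_of_eq_one ha hb hr1 hr' hν
  rw [if_neg (by simp [hr1.ne', hs1.ne'])]
  rcases eq_or_ne s ∞ with rfl | hst
  · rw [if_pos rfl]
    constructor
    · rintro ⟨K, hK, H⟩
      obtain ⟨C, hC⟩ := TailInequality.R₂_le (b := b) ha hr1 hr' hs0 le_top hν
      exact ne_top_of_le_ne_top (ENNReal.mul_ne_top ENNReal.coe_ne_top hK) (hC K H)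
    · intro h
      obtain ⟨C, hC⟩ := R₂_top_tailInequality ha hb hr1 hr' hν
      exact ⟨_, ENNReal.mul_ne_top ENNReal.coe_ne_top h, hC⟩
  rw [if_neg hst]
  rcases le_or_gt r s with hrs | hsr
  · constructor
    · rintro ⟨K, hK, H⟩
      obtain ⟨C, hC⟩ := TailInequality.R₂_le (b := b) ha hr1 hr' hs0 hrs hν
      exact ENNReal.add_ne_top.2 ⟨ne_top_of_le_ne_top hK (H.R₁_le hr0 hs0 hrs),
        ne_top_of_le_ne_top (ENNReal.mul_ne_top ENNReal.coe_ne_top hK) (hC K H)⟩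
    · intro h
      obtain ⟨h1, h2⟩ := ENNReal.add_ne_top.1 h
      exact tailInequality_of_one_lt_of_le ha hb hr1 hrs hst hν h1 h2
  · exact tailInequality_iff_of_lt ha hb hs1 hsr hr' hν

theorem tailInequality_iff_Rinf (ha : HasSlowBound a) (hb : HasSlowBound b) (hr : 1 ≤ r)
    (hs : 1 ≤ s) :
    (∃ K, K ≠ ∞ ∧ TailInequality r s a b K) ↔
      eLpNorm a r logMeasure = ∞ ∧ Rinf r s a b ≠ ∞ := by
  have hr0 : r ≠ 0 := (one_pos.trans_le hr).ne'
  have hs0 : s ≠ 0 := (one_pos.trans_le hs).ne'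
  have hnec : (∃ K, K ≠ ∞ ∧ TailInequality r s a b K) → eLpNorm a r logMeasure = ∞ :=
    fun ⟨K, hK, H⟩ => H.eLpNorm_eq_top hb hs0 hK
  rcases eq_or_ne r ∞ with rfl | hr'
  · have h := tailInequality_top_left (b := b) ha hs0
    rw [Rinf, if_pos rfl]
    exact ⟨fun H => ⟨hnec H, h.1 H⟩, fun H => h.2 H.2⟩
  have hr1 := ENNReal.toReal_pos hr0 hr'
  have hnorm : eLpNorm a r logMeasure = weight a r.toReal univ ^ (1 / r.toReal) := by
    rw [eLpNorm_rpow_toReal hr0 hr', weight, withDensity_apply _ MeasurableSet.univ,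
      Measure.restrict_univ]
  have htop : eLpNorm a r logMeasure = ∞ ↔ weight a r.toReal univ = ∞ := by
    rw [hnorm, ENNReal.rpow_eq_top_iff_of_pos (by positivity)]
  by_cases hfin : ∃ x, 0 < x ∧ weight a r.toReal (Iio x) ≠ ∞
  · obtain ⟨x, hx, hfin⟩ := hfin
    have key := fun h => tailInequality_iff_Rinf_of_isWeight (s := s) ha hb hr hr' hs
      (ha.isWeight ENNReal.toReal_nonneg hx hfin (htop.1 h))
    exact ⟨fun H => ⟨hnec H, (key (hnec H)).1 H⟩, fun H => (key H.1).2 H.2⟩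
  · push Not at hfin
    refine ⟨fun H => ⟨hnec H, ?_⟩, fun _ => ⟨1, ENNReal.one_ne_top,
      tailInequality_of_weight_eq_top ha hr hr' hfin⟩⟩
    rw [Rinf_eq_zero hr hr' hs hfin]
    exact ENNReal.zero_ne_top

end

end LorentzKaramata

end

theorem theorem3p4 {𝕜 : Type*} [RCLike 𝕜] {Ω₁ Ω₂ : Type*} [MeasurableSpace Ω₁]
    [MeasurableSpace Ω₂] (μ₁ : Measure Ω₁) (μ₂ : Measure Ω₂) [SigmaFinite μ₁] [SigmaFinite μ₂]
    (hμ₁ : μ₁ univ = ∞) (hμ₂ : μ₂ univ = ∞)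
    (p₁ q₁ q₂ r s : ℝ≥0∞) (hp₁ : 1 ≤ p₁) (hp₁' : p₁ < ∞) (hq₁ : 1 ≤ q₁) (hq₂ : 1 ≤ q₂)
    (hq : q₁ ≠ q₂) (hr : 1 ≤ r) (hs : 1 ≤ s) (a b : ℝ → ℝ≥0∞)
    (ha : LorentzKaramata.SlowlyVarying (Ioi 0) a) (hb : LorentzKaramata.SlowlyVarying (Ioi 0) b)
    (h210 : r = ∞ → MonotoneOn a (Ioi 0))
    (T : LorentzKaramata.QuasilinearOperator 𝕜 μ₁ μ₂)
    (hJW : LorentzKaramata.JointWeakType T p₁ q₁ ∞ q₂)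
    (hLB : LorentzKaramata.LowerBound₂ T ∞ q₂ (LorentzKaramata.slope p₁ q₁ ∞ q₂)) :
    LorentzKaramata.BoundedLK T ∞ r a q₂ s b ↔
      LorentzKaramata.lebNorm r (Ioi 0)
          (fun t => LorentzKaramata.pw t (-LorentzKaramata.recip r) * a t) = ∞ ∧
        LorentzKaramata.Rinf r s a
          (LorentzKaramata.lowerStar (LorentzKaramata.slope p₁ q₁ ∞ q₂) b) < ∞ := by
  have hr0 : r ≠ 0 := (one_pos.trans_le hr).ne'
  have hs0 : s ≠ 0 := (one_pos.trans_le hs).ne'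
  have hp : 0 < LorentzKaramata.recip p₁ := by
    rw [LorentzKaramata.recip_eq]
    exact one_div_pos.2 (ENNReal.toReal_pos (one_pos.trans_le hp₁).ne' hp₁'.ne)
  have hm : LorentzKaramata.slope p₁ q₁ ∞ q₂ ≠ 0 := by
    rw [LorentzKaramata.slope, LorentzKaramata.recip_top, sub_zero]
    refine div_ne_zero (fun h => hq ?_) hp.ne'
    rw [sub_eq_zero, LorentzKaramata.recip, LorentzKaramata.recip,
      ENNReal.toReal_eq_toReal_iff' (ENNReal.inv_ne_top.2 (one_pos.trans_le hq₁).ne')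
        (ENNReal.inv_ne_top.2 (one_pos.trans_le hq₂).ne')] at h
    exact inv_injective h
  have hb' := hb.hasSlowBound
  rw [LorentzKaramata.lebNorm_eq hr0 measurableSet_Ioi Subset.rfl,
    LorentzKaramata.logMeasure_restrict_Ioi, lt_top_iff_ne_top,
    ← LorentzKaramata.tailInequality_iff_Rinf ha.hasSlowBound (hb'.lowerStar hm) hr hs]
  exact ⟨hLB.exists_tailInequality hm hr0 hs0 hb'.aemeasurable,
    fun ⟨_, hK, H⟩ => hJW.boundedLK hp hm hr0 hs hb' hK H⟩
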